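/- Let $k$ be a field. For a $k$-algebra $A$ let $A^{\circ}$ be the opposite algebra and $A^{\mathrm e}=A\otimes_k A^{\circ}$. View $A$ as a left $A^{\mathrm e}$-module by $(a\otimes b)\cdot x=axb$, and view $\operatorname{Ext}^i_{A^{\mathrm e}}(A,A^{\mathrm e})$ (Ext of left $A^{\mathrm e}$-modules) as an $A$-bimodule through the right multiplication of $A^{\mathrm e}$ on itself, that is, $a\cdot x\cdot b=x\,(b\otimes a)$. Put $$\operatorname{fhtr} A=\sup\{i\ge 0 : \operatorname{Ext}^i_{A^{\mathrm e}}(A,A^{\mathrm e})\neq 0\}\in\{-\infty\}\cup\mathbb N\cup\{\infty\},$$ with $\sup\emptyset=-\infty$ and $\pm\infty+1=\pm\infty$. The algebra $A$ is *doubly noetherian* if $A^{\mathrm e}$ is noetherian. A simple artinian $k$-algebra $A$ is *rigid* if there are an integer $n$ and an automorphism $\sigma$ of $A$ such that $\operatorname{Ext}^i_{A^{\mathrm e}}(A,A^{\mathrm e})=0$ for $i\neq n$ and $\operatorname{Ext}^n_{A^{\mathrm e}}(A,A^{\mathrm e})\cong A^{\sigma}$ as $A$-bimodules, where $A^{\sigma}$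 is $A$ with the bimodule structure $a*s*b=a\,s\,\sigma(b)$. **Proposition 2.6.** Let $D$ be a doubly noetherian simple artinian $k$-algebra and let $\alpha$ be a $k$-algebra automorphism of $D$. Let $B=D[t^{\pm1};\alpha]$ be the skew Laurent polynomial ring (with $td=\alpha(d)t$ for $d\in D$), and let $Q=D(t;\alpha)$ be the Goldie quotient ring of the skew polynomial ring $D[t;\alpha]$, that is, its ring of fractions with respect to all regular elements. Then $$\operatorname{fhtr} B=\operatorname{fhtr} Q=\operatorname{fhtr} D+1.$$ Moreover, $D$ is rigid if and only if $Q$ is rigid. -/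

import Mathlib

/-! ### Ore condition for skew polynomial rings over Artinian rings -/

namespace SkewOre

open SkewPolynomial Multiplicative

universe u
variable {R : Type u} [Ring R]

/-- The polynomial `∑ i < m, c i * t ^ i`. -/
noncomputable def trunc (m : ℕ) : (Fin m → R) →ₗ[R] SkewPolynomial R :=
  ∑ i : Fin m, (monomial (R := R) i).comp (LinearMap.proj i)

/-- The first `m` coefficients. -/
noncomputable def coeffs (m : ℕ) : SkewPolynomial R →ₗ[R] (Fin m → R) where
  toFun p i := p.coeff i
  map_add' p q := funext fun i ↦ coeff_add p q i
  map_smul' r p := funext fun i ↦ by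
    change (SkewMonoidAlgebra.coeff (r • p)) (ofAdd (i : ℕ)) = _
    rw [SkewMonoidAlgebra.coeff_smul]
    rfl

theorem coeff_sum' {ι : Type*} (s : Finset ι) (F : ι → SkewPolynomial R) (j : ℕ) :
    (∑ i ∈ s, F i).coeff j = ∑ i ∈ s, (F i).coeff j := by
  classical
  induction s using Finset.induction_on with
  | empty => rfl
  | insert a s ha ih =>
    rw [Finset.sum_insert ha, Finset.sum_insert ha, ← ih, coeff_add]

theorem coeff_trunc (m : ℕ) (c : Fin m → R) (j : ℕ) :
    (trunc m c).coeff j = if h : j < m then c ⟨j, h⟩ else 0 := by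
  simp only [trunc, LinearMap.sum_apply, LinearMap.comp_apply, LinearMap.proj_apply, coeff_sum',
    coeff_monomial]
  split_ifs with h
  · rw [Finset.sum_eq_single (⟨j, h⟩ : Fin m)]
    · simp
    · intro b _ hb
      rw [if_neg]
      rintro rfl
      exact hb rfl
    · simp
  · refine Finset.sum_eq_zero fun i _ ↦ if_neg ?_
    have := i.2
    omega

theorem poly_ext {p q : SkewPolynomial R} (h : ∀ n, p.coeff n = q.coeff n) : p = q :=
  SkewMonoidAlgebra.ext fun a ↦ h (toAdd a)

theorem trunc_coeffs {m : ℕ} {p : SkewPolynomial R} (h : ∀ i, m ≤ i → p.coeff i = 0) :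
    trunc m (coeffs m p) = p := by
  refine poly_ext fun n ↦ ?_
  rw [coeff_trunc]
  split_ifs with hn
  · simp [coeffs]
  · exact (h n (not_lt.1 hn)).symm

theorem exists_bound (p : SkewPolynomial R) : ∃ d, ∀ i, d ≤ i → p.coeff i = 0 := by
  refine ⟨p.support.sup id + 1, fun i hi ↦ ?_⟩
  by_contra h
  have : i ≤ p.support.sup id := Finset.le_sup (f := id) (mem_support_iff.2 h)
  omega

theorem trunc_bound {m : ℕ} (c : Fin m → R) : ∀ i, m ≤ i → (trunc m c).coeff i = 0 := by
  intro i hi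
  rw [coeff_trunc, dif_neg (not_lt.2 hi)]

theorem length_range_add_ker {M N : Type*} [AddCommGroup M] [AddCommGroup N] [Module R M]
    [Module R N] (g : M →ₗ[R] N) :
    Module.length R M = Module.length R (LinearMap.ker g) + Module.length R (LinearMap.range g) :=
  Module.length_eq_add_of_exact (LinearMap.ker g).subtype g.rangeRestrict
    (Submodule.injective_subtype _) g.surjective_rangeRestrict (by
      rw [LinearMap.exact_iff, LinearMap.ker_rangeRestrict, Submodule.range_subtype])

variable [MulSemiringAction (Multiplicative ℕ) R]

theorem coeff_mul (f g : SkewPolynomial R) (n : ℕ) :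
    (f * g).coeff n =
      ∑ p ∈ Finset.HasAntidiagonal.antidiagonal n, f.coeff p.1 * ofAdd p.1 • g.coeff p.2 := by
  have h := SkewMonoidAlgebra.coeff_mul_antidiagonal_of_finset f g (ofAdd n)
    ((Finset.HasAntidiagonal.antidiagonal n).map ((ofAdd.toEmbedding.prodMap ofAdd.toEmbedding :
      ℕ × ℕ ↪ Multiplicative ℕ × Multiplicative ℕ))) (by
      rintro ⟨a, b⟩
      simp only [Finset.mem_map, Finset.HasAntidiagonal.mem_antidiagonal, Prod.exists]
      constructor
      · rintro ⟨x, y, h, e⟩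
        cases e
        exact congrArg ofAdd h
      · intro h
        exact ⟨toAdd a, toAdd b, congrArg toAdd h, rfl⟩)
  rw [Finset.sum_map] at h
  exact h

theorem mul_bound {f g : SkewPolynomial R} {m d : ℕ} (hf : ∀ i, m ≤ i → f.coeff i = 0)
    (hg : ∀ i, d ≤ i → g.coeff i = 0) : ∀ i, m + d ≤ i → (f * g).coeff i = 0 := by
  intro i hi
  rw [coeff_mul]
  refine Finset.sum_eq_zero fun p hp ↦ ?_
  rw [Finset.HasAntidiagonal.mem_antidiagonal] at hp
  by_cases h : m ≤ p.1
  · rw [hf _ h, zero_mul]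
  · rw [hg _ (by omega), smul_zero, mul_zero]

/-- Right multiplication by `f`. -/
noncomputable def mulR (f : SkewPolynomial R) : SkewPolynomial R →ₗ[R] SkewPolynomial R where
  toFun x := x * f
  map_add' x y := add_mul x y f
  map_smul' r x := smul_mul_assoc r x f

/-- Monic polynomials are regular. -/
theorem monic_mem (hinj : Function.Injective (fun x : R ↦ ofAdd (1 : ℕ) • x)) (m : ℕ)
    (c : Fin m → R) : monomial m 1 - trunc m c ∈ nonZeroDivisors (SkewPolynomial R) := by
  set s : SkewPolynomial R := monomial m 1 - trunc m c with hs
  have hsm : s.coeff m = 1 := by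
    rw [hs, coeff_sub, coeff_monomial, if_pos rfl, trunc_bound c m le_rfl, sub_zero]
  have hsb : ∀ i, m < i → s.coeff i = 0 := by
    intro i hi
    rw [hs, coeff_sub, coeff_monomial, if_neg hi.ne, trunc_bound c i hi.le, sub_zero]
  have hinj' : ∀ n : ℕ, ∀ x : R, ofAdd n • x = 0 → x = 0 := by
    intro n
    induction n with
    | zero => intro x hx; simpa using hx
    | succ n ih =>
      intro x hx
      rw [ofAdd_add, mul_smul] at hx
      exact hinj ((ih _ hx).trans (smul_zero _).symm)
  have top : ∀ y : SkewPolynomial R, y ≠ 0 → ∃ j, y.coeff j ≠ 0 ∧ ∀ i, j < i → y.coeff i = 0 := by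
    intro y hy
    have hne : y.support.Nonempty := by
      rw [Finset.nonempty_iff_ne_empty, Ne, support_eq_empty]
      exact hy
    refine ⟨y.support.max' hne, mem_support_iff.1 (Finset.max'_mem _ _), fun i hi ↦ ?_⟩
    by_contra h
    exact absurd (Finset.le_max' _ i (mem_support_iff.2 h)) (not_le.2 hi)
  rw [mem_nonZeroDivisors_iff]
  constructor
  · intro y hy
    by_contra hne
    obtain ⟨j, hj, hj'⟩ := top y hne
    have h0 : (s * y).coeff (m + j) = 0 := by rw [hy]; rfl
    rw [coeff_mul, Finset.sum_eq_single (m, j), hsm, one_mul] at h0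
    · exact hj (hinj' m _ h0)
    · rintro ⟨a, b⟩ hab hne
      rw [Finset.HasAntidiagonal.mem_antidiagonal] at hab
      rcases lt_trichotomy a m with h | h | h
      · rw [hj' b (by simp only at hab; omega), smul_zero, mul_zero]
      · exact absurd (by rw [h, show b = j by simp only at hab; omega]) hne
      · rw [hsb a h, zero_mul]
    · intro h
      exact absurd (Finset.HasAntidiagonal.mem_antidiagonal.2 (by rfl)) h
  · intro y hy
    by_contra hne
    obtain ⟨j, hj, hj'⟩ := top y hne
    have h0 : (y * s).coeff (j + m) = 0 := by rw [hy]; rfl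
    rw [coeff_mul, Finset.sum_eq_single (j, m), hsm, smul_one, mul_one] at h0
    · exact hj h0
    · rintro ⟨a, b⟩ hab hne
      rw [Finset.HasAntidiagonal.mem_antidiagonal] at hab
      rcases lt_trichotomy b m with h | h | h
      · rw [hj' a (by simp only at hab; omega), zero_mul]
      · exact absurd (by rw [h, show a = j by simp only at hab; omega]) hne
      · rw [hsb b h, smul_zero, mul_zero]
    · intro h
      exact absurd (Finset.HasAntidiagonal.mem_antidiagonal.2 (by rfl)) h

variable [IsArtinianRing R]

theorem ore_aux (hinj : Function.Injective (fun x : R ↦ ofAdd (1 : ℕ) • x))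
    (g f : SkewPolynomial R) (hf : f ∈ nonZeroDivisors (SkewPolynomial R)) :
    ∃ s ∈ nonZeroDivisors (SkewPolynomial R), ∃ r, s * g = r * f := by
  obtain ⟨d, hd⟩ := exists_bound f
  obtain ⟨e₀, he₀⟩ := exists_bound g
  let e := e₀ + d
  have he : ∀ i, e ≤ i → g.coeff i = 0 := fun i hi ↦ he₀ i (le_trans (Nat.le_add_right _ _) hi)
  let N := LinearMap.range (mulR f)
  let ℓ := Module.length R R
  have hℓ : ℓ ≠ ⊤ := Module.length_ne_top
  let K : (m : ℕ) → Submodule R (SkewPolynomial R ⧸ N) := fun m ↦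
    LinearMap.range (N.mkQ.comp (trunc m))
  have hK : ∀ m, Module.length R (K (m + d)) ≤ d * ℓ := by
    intro m
    let γ := N.mkQ.comp (trunc (R := R) (m + d))
    have h1 := length_range_add_ker γ
    have h2 : Module.length R (Fin m → R) ≤ Module.length R (LinearMap.ker γ) := by
      have key : ∀ c : Fin m → R, trunc (m + d) (coeffs (m + d) (trunc m c * f)) = trunc m c * f :=
        fun c ↦ trunc_coeffs (mul_bound (trunc_bound c) hd)
      refine Module.length_le_of_injective
        (LinearMap.codRestrict (LinearMap.ker γ)
          ((coeffs (m + d)).comp ((mulR f).comp (trunc m))) ?_) ?_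
      · intro c
        rw [LinearMap.mem_ker]
        change N.mkQ (trunc (m + d) (coeffs (m + d) (trunc m c * f))) = 0
        rw [key, Submodule.mkQ_apply, Submodule.Quotient.mk_eq_zero]
        exact ⟨trunc m c, rfl⟩
      · rw [← LinearMap.ker_eq_bot, LinearMap.ker_codRestrict, LinearMap.ker_eq_bot']
        intro c hc
        have h3 : trunc m c * f = 0 := by
          rw [← key c]
          exact (congrArg (trunc (m + d)) hc).trans (map_zero _)
        have h4 := (mem_nonZeroDivisors_iff.1 hf).2 _ h3
        funext i
        have := coeff_trunc m c i
        rw [h4, dif_pos i.2] at this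
        exact this.symm
    simp only [Module.length_pi_of_fintype, Finset.sum_const, Finset.card_univ, Fintype.card_fin,
      nsmul_eq_mul] at h1 h2
    have h5 : (m : ℕ∞) * ℓ + Module.length R (K (m + d)) ≤ (m : ℕ∞) * ℓ + d * ℓ := by
      calc _ ≤ Module.length R (LinearMap.ker γ) + Module.length R (LinearMap.range γ) := by
            gcongr
        _ = _ := by rw [← h1]; push_cast; ring
    exact (ENat.add_le_add_iff_left (WithTop.mul_ne_top (ENat.natCast_ne_top m) hℓ)).1 h5
  let K' : (m : ℕ) → Submodule R (SkewPolynomial R ⧸ N) := fun m ↦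
    LinearMap.range (N.mkQ.comp ((mulR g).comp (trunc m)))
  have hK'K : ∀ m, K' m ≤ K (m + e₀ + d) := by
    rintro m _ ⟨c, rfl⟩
    refine ⟨coeffs (m + e₀ + d) (trunc m c * g), ?_⟩
    change N.mkQ (trunc (m + e₀ + d) _) = N.mkQ (trunc m c * g)
    rw [trunc_coeffs]
    rw [add_assoc]
    exact mul_bound (trunc_bound c) he
  have hK' : ∀ m, Module.length R (K' m) ≤ d * ℓ := fun m ↦
    (Module.length_le_of_injective (Submodule.inclusion (hK'K m))
      (Submodule.inclusion_injective _)).trans (hK _)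
  have hmono : ∀ m, K' m ≤ K' (m + 1) := by
    rintro m _ ⟨c, rfl⟩
    refine ⟨coeffs (m + 1) (trunc m c), ?_⟩
    change N.mkQ (trunc (m + 1) _ * g) = N.mkQ (trunc m c * g)
    rw [trunc_coeffs]
    exact fun i hi ↦ trunc_bound c i (by omega)
  have hstab : ∃ m, K' (m + 1) ≤ K' m := by
    by_contra! hcon
    have hlow : ∀ m : ℕ, (m : ℕ∞) ≤ Module.length R (K' m) := by
      intro m
      induction m with
      | zero => simp
      | succ m ih =>
        have hlt : Module.length R (K' m) < Module.length R (K' (m + 1)) := by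
          have hx : Module.length R ((K' m).submoduleOf (K' (m + 1))) <
              Module.length R (K' (m + 1)) := by
            apply Submodule.length_lt
            intro h
            exact hcon m (Submodule.submoduleOf_eq_top.1 h)
          rwa [(Submodule.submoduleOfEquivOfLe (hmono m)).length_eq] at hx
        push_cast
        exact (add_le_add_left ih 1).trans (Order.add_one_le_of_lt hlt)
    obtain ⟨b, hb⟩ := ENat.ne_top_iff_exists.1 (WithTop.mul_ne_top (ENat.natCast_ne_top d) hℓ)
    have h7 : ((b + 1 : ℕ) : ℕ∞) ≤ (b : ℕ∞) :=
      ((hlow (b + 1)).trans (hK' (b + 1))).trans_eq hb.symm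
    have h8 := Nat.cast_le.1 h7
    omega
  obtain ⟨m, hm⟩ := hstab
  have hmem : N.mkQ (monomial m 1 * g) ∈ K' (m + 1) := by
    refine ⟨coeffs (m + 1) (monomial m 1), ?_⟩
    change N.mkQ (trunc (m + 1) _ * g) = _
    rw [trunc_coeffs]
    intro i hi
    rw [coeff_monomial, if_neg (by omega)]
  obtain ⟨c, hc⟩ := hm hmem
  refine ⟨_, monic_mem hinj m c, ?_⟩
  have h6 : monomial m 1 * g - trunc m c * g ∈ N := by
    rw [← Submodule.Quotient.mk_eq_zero N, Submodule.Quotient.mk_sub, sub_eq_zero]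
    exact hc.symm
  obtain ⟨r, hr⟩ := h6
  exact ⟨r, by rw [sub_mul]; exact hr.symm⟩

end SkewOre

section SkewRings

universe v u

variable {k : Type v} {D : Type u} [Field k] [Ring D] [Algebra k D]

/-- The `k`-algebra `D`, remembering the automorphism `α`: the generator of `ℕ`, respectively of
`ℤ`, acts on it as `α`. -/
def Twist (_α : D ≃ₐ[k] D) : Type u := D

namespace Twist

variable (α : D ≃ₐ[k] D)

instance : Ring (Twist α) := inferInstanceAs (Ring D)

instance : Algebra k (Twist α) := inferInstanceAs (Algebra k D)

instance [IsArtinianRing D] : IsArtinianRing (Twist α) := inferInstanceAs (IsArtinianRing D)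

/-- `n` acts as `α ^ n`. -/
noncomputable instance : MulSemiringAction (Multiplicative ℕ) (Twist α) :=
  MulSemiringAction.compHom D (powersHom (D ≃ₐ[k] D) α)

/-- `n` acts as `α ^ n`. -/
noncomputable instance : MulSemiringAction (Multiplicative ℤ) (Twist α) :=
  MulSemiringAction.compHom D (zpowersHom (D ≃ₐ[k] D) α)

instance : SMulCommClass (Multiplicative ℕ) k (Twist α) :=
  ⟨fun n c d ↦ map_smul (powersHom (D ≃ₐ[k] D) α n) c (show D from d)⟩

instance : SMulCommClass (Multiplicative ℤ) k (Twist α) :=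
  ⟨fun n c d ↦ map_smul (zpowersHom (D ≃ₐ[k] D) α n) c (show D from d)⟩

end Twist

/-- The skew polynomial ring `D[t;α]`: polynomials `∑ dᵢ tⁱ` with `i ∈ ℕ` and `t d = α(d) t`. -/
abbrev SkewPolyRing (α : D ≃ₐ[k] D) : Type u := SkewPolynomial (Twist α)

/-- The skew Laurent polynomial ring `D[t^{±1};α]`: polynomials `∑ dᵢ tⁱ` with `i ∈ ℤ` and
`t d = α(d) t`. -/
abbrev SkewLaurentRing (α : D ≃ₐ[k] D) : Type u :=
  SkewMonoidAlgebra (Twist α) (Multiplicative ℤ)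

/-- For `D` Artinian, the regular elements of `D[t;α]` form a left Ore set. -/
noncomputable instance [IsArtinianRing D] (α : D ≃ₐ[k] D) :
    OreLocalization.OreSet (nonZeroDivisors (SkewPolyRing α)) :=
  have key := SkewOre.ore_aux (R := Twist α)
    (powersHom (D ≃ₐ[k] D) α (Multiplicative.ofAdd 1)).injective
  { ore_right_cancel r₁ r₂ s h := ⟨1, by
      have := (mem_nonZeroDivisors_iff.1 s.2).2 (r₁ - r₂) (by rw [sub_mul, h, sub_self])
      rw [sub_eq_zero.1 this]⟩
    oreNum r s := (key r s s.2).choose_spec.2.choose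
    oreDenom r s := ⟨_, (key r s s.2).choose_spec.1⟩
    ore_eq r s := (key r s s.2).choose_spec.2.choose_spec }

/-- `D(t;α)`, the Goldie quotient ring of `D[t;α]`: the ring of fractions `s⁻¹ r` whose
denominators `s` range over all regular elements (two-sided non-zero-divisors) of `D[t;α]`. -/
abbrev SkewRatRing [IsArtinianRing D] (α : D ≃ₐ[k] D) : Type u :=
  OreLocalization (nonZeroDivisors (SkewPolyRing α)) (SkewPolyRing α)

end SkewRings

/-! ### Bimodule cohomology -/

section Enveloping

universe v u

open CategoryTheory Abelian TensorProduct MulOpposite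

variable (k : Type v) (A : Type u) [Field k] [Ring A] [Algebra k A]

/-- The enveloping algebra `Aᵉ = A ⊗ A°`. -/
abbrev EnvAlg : Type u := A ⊗[k] Aᵐᵒᵖ

/-- A `k`-algebra is doubly noetherian if its enveloping algebra is noetherian. (`Aᵉ` has the
anti-automorphism `a ⊗ b ↦ b ⊗ a`, so left noetherian and right noetherian agree.) -/
def IsDoublyNoetherian : Prop := IsNoetherianRing (EnvAlg k A)

/-- `A` as a left `Aᵉ`-module: `(a ⊗ b) • x = a * x * b`. -/
noncomputable def envSelf : ModuleCat.{u} (EnvAlg k A) :=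
  letI : Module (EnvAlg k A) A := instModuleTensorProductMop k A
  ModuleCat.of (EnvAlg k A) A

/-- `Ext^i_{Aᵉ}(A, Aᵉ)`, the `Ext` of left `Aᵉ`-modules. -/
abbrev EnvExt (i : ℕ) : Type u :=
  Ext (envSelf k A) (ModuleCat.of (EnvAlg k A) (EnvAlg k A)) i

variable {k A} in
/-- The right action of `r ∈ Aᵉ` on `Ext^i_{Aᵉ}(A, Aᵉ)`, induced by the endomorphism `x ↦ x * r` of
the left `Aᵉ`-module `Aᵉ`. -/
noncomputable def EnvExt.rightMul {i : ℕ} (x : EnvExt k A i) (r : EnvAlg k A) : EnvExt k A i :=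
  x.comp (Ext.mk₀ (ModuleCat.ofHom (LinearMap.toSpanSingleton (EnvAlg k A) (EnvAlg k A) r)))
    (add_zero i)

/-- The first modification of the homological transcendence degree,
`sup {i | Ext^i_{Aᵉ}(A, Aᵉ) ≠ 0}`, where the supremum of the empty set is `⊥ = -∞`
and that of an unbounded set is `⊤ = ∞`. -/
noncomputable def fhtr : WithBot ℕ∞ :=
  sSup {d | ∃ i : ℕ, Nontrivial (EnvExt k A i) ∧ d = (i : WithBot ℕ∞)}

/-- `A` is rigid if, for some `n` and some automorphism `σ`, the group `Ext^i_{Aᵉ}(A, Aᵉ)` vanishes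
for `i ≠ n` and is isomorphic as an `A`-bimodule to `A^σ` for `i = n`. Here `A^σ` is `A` with
`a * s * b = a s σ(b)`, and a right `Aᵉ`-module is an `A`-bimodule through
`a x b = x · (b ⊗ a)`. -/
def IsRigid : Prop :=
  ∃ (n : ℕ) (σ : A ≃ₐ[k] A),
    (∃ e : EnvExt k A n ≃+ A, ∀ (a b : A) (x : EnvExt k A n),
      e (x.rightMul (b ⊗ₜ[k] op a)) = a * e x * σ b) ∧
    ∀ i : ℕ, i ≠ n → Subsingleton (EnvExt k A i)

end Enveloping

/-! ### `Ext` from a resolution by finite free modules -/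

section FreeResolution

universe u

open CategoryTheory Abelian Matrix

/-! Let `A` be `B` or `Q`. In both cases `A` is an Ore localization, at monic polynomials, of the
skew Laurent extension of `D` by a unit `t` (`SkewExt`), and `Aᵉ` is an Ore localization of the
extension of `Dᵉ` by the two commuting units `t ⊗ 1` and `1 ⊗ t` (`TorusExt`, `SkewExt.env`). The
unit `u = t ⊗ t⁻¹` fixes `1 ∈ A`, and `A` is the cokernel of an injective semilinear version of `u -
1` on `Aᵉ ⊗ D`, the tensor product being over `Dᵉ`. Since `Dᵉ` is noetherian, `D` has a resolution
`P` by finite free modules, and the mapping cone of `uθ - 1` on `Aᵉ ⊗ P` resolves `A` by finite free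
modules (`ConeData.cone`).

Cochains on `Aᵉ ⊗ P` are, up to denominators, finitely supported families of cochains on `P` indexed
by `ℤ × ℤ`. On cohomology `uθ - 1` acts as the shift by `(1, -1)`, twisted by an automorphism `φ` of
`Ext(D, Dᵉ)`, minus the identity. On finite supports such a map is injective, and its cokernel is
represented by the exponents `(0, a)`. Hence `Ext⁰(A, Aᵉ) = 0`, and `Extⁿ⁺¹(A, Aᵉ)` is a
localization of the sum of the `tᵃ Extⁿ(D, Dᵉ)` (`ConeData.exists_extMul_eq_sum`). Because the
denominators are monic, no class is lost in localizing (`ConeData.eq_zero_of_sum_eq_zero`). So the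
nonzero degrees move up by exactly one, which is `SkewExt.fhtr_eq`.

Rigidity says that only one `Ext` group survives and that it has an element generating it freely
from the left and from the right (`isRigid_iff`). Such a generator `m` over `D` remains one over
`Q`: if `m c = f m`, then `f` is regular because `c` is a unit, and regular Laurent polynomials are
invertible in `Q`, so that denominators can change sides (`BimodExt.isBiGen_j`). For the descent,
counting lengths of translates in a growing window of exponents shows that `Extⁿ(D, Dᵉ)` has on each
side at most the length of `D`, with equality on the right. It is therefore free of rank one on the
right; as `D` is simple and left lengths are bounded, a right generator is also a left generator
(`BimodExt.exists_isBiGen`). -/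

/-- In degree zero there are no nonzero coboundaries: the resolution, as a cochain complex, vanishes
in degree `1`. -/
theorem CategoryTheory.ProjectiveResolution.eq_zero_of_extMk_eq_zero {C : Type*} [Category C]
    [Abelian C] [HasExt.{u} C] {X Y : C} (R : ProjectiveResolution X) (f : R.complex.X 0 ⟶ Y)
    (hf : R.complex.d 1 0 ≫ f = 0) (h : R.extMk f 1 rfl hf = 0) : f = 0 := by
  rw [← R.extEquivCohomologyClass.apply_eq_iff_eq,
    ProjectiveResolution.extEquivCohomologyClass_extMk,
    ProjectiveResolution.extEquivCohomologyClass_zero,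
    CochainComplex.HomComplex.CohomologyClass.mk_eq_zero_iff,
    CochainComplex.HomComplex.Cocycle.toSingleMk_mem_coboundaries_iff _ _ _ _ _ 1 (by simp)] at h
  obtain ⟨g, hg⟩ := h
  have hz : Limits.IsZero (R.cochainComplex.X 1) :=
    R.cochainComplex.isZero_of_isStrictlyLE 0 1 (by simp)
  rw [hz.eq_of_src g 0, Limits.comp_zero] at hg
  rw [← cancel_epi (R.cochainComplexXIso (-(0 : ℕ)) 0 rfl).hom, ← hg, Limits.comp_zero]

/-- A resolution of the `S`-module `X` by finite free modules `ι n → S` of row vectors, on which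
the differentials act from the right. -/
structure FreeRes (S : Type u) [Ring S] (X : Type u) [AddCommGroup X] [Module S X] where
  /-- the index types of the bases -/
  ι : ℕ → Type
  [fintype : ∀ n, Fintype (ι n)]
  [decidableEq : ∀ n, DecidableEq (ι n)]
  /-- the differentials -/
  d : ∀ n, Matrix (ι (n + 1)) (ι n) S
  /-- the augmentation -/
  ε : ι 0 → X
  surj : ∀ x : X, ∃ v : ι 0 → S, ∑ i, v i • ε i = x
  exact_zero : ∀ v : ι 0 → S, ∑ i, v i • ε i = 0 ↔ ∃ w, w ᵥ* d 0 = v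
  exact_succ : ∀ n (v : ι (n + 1) → S), v ᵥ* d n = 0 ↔ ∃ w, w ᵥ* d (n + 1) = v

namespace FreeRes

attribute [instance] FreeRes.fintype FreeRes.decidableEq

variable {S : Type u} [Ring S] {X : Type u} [AddCommGroup X] [Module S X] (P : FreeRes S X)

/-- The complex of modules underlying a free resolution. -/
noncomputable def complex : ChainComplex (ModuleCat.{u} S) ℕ :=
  ChainComplex.of (fun n ↦ ModuleCat.of S (P.ι n → S))
    (fun n ↦ ModuleCat.ofHom (Matrix.vecMulLinear (P.d n))) fun n ↦ by
      refine ModuleCat.hom_ext (LinearMap.ext fun v ↦ ?_)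
      exact (P.exact_succ n _).2 ⟨v, rfl⟩

theorem complex_d (n : ℕ) :
    P.complex.d (n + 1) n = ModuleCat.ofHom (Matrix.vecMulLinear (P.d n)) :=
  ChainComplex.of_d (fun n ↦ ModuleCat.of S (P.ι n → S))
    (fun n ↦ ModuleCat.ofHom (Matrix.vecMulLinear (P.d n))) n

theorem d_comp_aug : P.complex.d 1 0 ≫
    (ModuleCat.ofHom (Fintype.linearCombination S P.ε) : P.complex.X 0 ⟶ ModuleCat.of S X) = 0 := by
  rw [complex_d]
  refine ModuleCat.hom_ext (LinearMap.ext fun v ↦ ?_)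
  exact (P.exact_zero _).2 ⟨v, rfl⟩

theorem exactAt_succ (n : ℕ) : P.complex.ExactAt (n + 1) := by
  rw [HomologicalComplex.exactAt_iff' _ (n + 1 + 1) (n + 1) n (by simp) (by simp)]
  rw [ShortComplex.moduleCat_exact_iff]
  intro x hx
  change P.ι (n + 1) → S at x
  change (P.complex.d (n + 1) n).hom x = 0 at hx
  change ∃ y, (P.complex.d (n + 1 + 1) (n + 1)).hom y = x
  rw [complex_d] at hx ⊢
  exact (P.exact_succ n x).1 hx

/-- The projective resolution underlying a free resolution. -/
noncomputable def toProjectiveResolution : ProjectiveResolution (ModuleCat.of S X) where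
  complex := P.complex
  projective n := ModuleCat.projective_of_free (Pi.basisFun S (P.ι n))
  π := (ChainComplex.toSingle₀Equiv _ _).symm ⟨_, P.d_comp_aug⟩
  quasiIso := ⟨fun n => by
    cases n
    · rw [ChainComplex.quasiIsoAt₀_iff, ShortComplex.quasiIso_iff_of_zeros']
      · refine (ShortComplex.exact_and_epi_g_iff_of_iso
          (S₂ := ShortComplex.mk _ _ P.d_comp_aug) ?_).2 ⟨?_, ?_⟩
        · exact ShortComplex.isoMk (Iso.refl _) (Iso.refl _) (Iso.refl _)
            (by simp [HomologicalComplex.shortComplexFunctor'])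
            (by
              refine (Category.id_comp _).trans (.trans ?_ (Category.comp_id _).symm)
              exact (ChainComplex.toSingle₀Equiv_symm_apply_f_zero _ P.d_comp_aug).symm)
        · rw [ShortComplex.moduleCat_exact_iff]
          intro x hx
          simp only [complex_d] at x hx ⊢
          exact (P.exact_zero x).1 hx
        · exact (ModuleCat.epi_iff_surjective _).2 fun x ↦ P.surj x
      all_goals rfl
    · rw [quasiIsoAt_iff_exactAt']
      · apply exactAt_succ
      · apply ChainComplex.exactAt_succ_single_obj⟩

/-- The functional on row vectors given by a column vector. -/
noncomputable def toHom {n : ℕ} (f : P.ι n → S) :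
    P.toProjectiveResolution.complex.X n ⟶ ModuleCat.of S S :=
  (ModuleCat.ofHom (Fintype.linearCombination S f) : ModuleCat.of S (P.ι n → S) ⟶ _)

theorem toHom_apply {n : ℕ} (f v : P.ι n → S) : (P.toHom f).hom v = v ⬝ᵥ f := rfl

theorem toHom_ext {n : ℕ} {g h : P.toProjectiveResolution.complex.X n ⟶ ModuleCat.of S S}
    (H : ∀ v : P.ι n → S, g.hom v = h.hom v) : g = h :=
  ModuleCat.hom_ext (LinearMap.ext H)

theorem toHom_injective {n : ℕ} {f g : P.ι n → S} (h : P.toHom f = P.toHom g) : f = g := by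
  classical
  funext i
  have := congrArg (fun q ↦ q.hom (Pi.single i 1 : P.ι n → S)) h
  change (Pi.single i 1 : P.ι n → S) ⬝ᵥ f = (Pi.single i 1 : P.ι n → S) ⬝ᵥ g at this
  simpa only [single_dotProduct, one_mul] using this

theorem toHom_surjective {n : ℕ} (g : P.toProjectiveResolution.complex.X n ⟶ ModuleCat.of S S) :
    ∃ f, P.toHom f = g := by
  classical
  let g' : (P.ι n → S) →ₗ[S] S := g.hom
  have hg' : Fintype.linearCombination S (fun i ↦ g' (Pi.single i 1)) = g' := by
    refine LinearMap.pi_ext' fun i ↦ LinearMap.ext_ring ?_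
    simp [Fintype.linearCombination_apply, Pi.single_apply]
  exact ⟨fun i ↦ g' (Pi.single i 1), P.toHom_ext fun v ↦ congrArg (· v) hg'⟩

/-- Differentials multiply rows from the right, so by associativity of row, matrix and column the
coboundary multiplies columns from the left. This leaves the right side of a column free for the
action of `S` on `Ext`. -/
theorem d_toHom {n : ℕ} (f : P.ι n → S) :
    P.toProjectiveResolution.complex.d (n + 1) n ≫ P.toHom f = P.toHom (P.d n *ᵥ f) := by
  change P.complex.d (n + 1) n ≫ _ = _
  rw [complex_d]
  refine P.toHom_ext fun v ↦ ?_
  rw [toHom_apply, Matrix.dotProduct_mulVec]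
  rfl

theorem toHom_zero {n : ℕ} : P.toHom (0 : P.ι n → S) = 0 :=
  P.toHom_ext fun v ↦ dotProduct_zero v

theorem toHom_add {n : ℕ} (f g : P.ι n → S) : P.toHom (f + g) = P.toHom f + P.toHom g :=
  P.toHom_ext fun v ↦ dotProduct_add v f g

theorem toHom_comp {n : ℕ} (f : P.ι n → S) (r : S) :
    P.toHom f ≫ ModuleCat.ofHom (LinearMap.toSpanSingleton S S r) = P.toHom fun i ↦ f i * r := by
  refine P.toHom_ext fun v ↦ ?_
  change (v ⬝ᵥ f) * r = v ⬝ᵥ _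
  simp only [dotProduct, Finset.sum_mul, mul_assoc]

/-- The class in `Ext^n(X, S)` of a column vector that is a cocycle. -/
noncomputable def cls (n : ℕ) (f : P.ι n → S) (hf : P.d n *ᵥ f = 0) :
    Ext (ModuleCat.of S X) (ModuleCat.of S S) n :=
  P.toProjectiveResolution.extMk (P.toHom f) (n + 1) rfl (by rw [d_toHom, hf, toHom_zero])

theorem cls_congr {n : ℕ} {f g : P.ι n → S} (h : f = g) (hf : P.d n *ᵥ f = 0) :
    P.cls n f hf = P.cls n g (h ▸ hf) := by
  subst h
  rfl

theorem cls_add {n : ℕ} (f g : P.ι n → S) (hf : P.d n *ᵥ f = 0) (hg : P.d n *ᵥ g = 0) :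
    P.cls n (f + g) (by rw [mulVec_add, hf, hg, add_zero]) = P.cls n f hf + P.cls n g hg := by
  simp only [cls, ProjectiveResolution.add_extMk, toHom_add]

theorem cls_surjective {n : ℕ} (x : Ext (ModuleCat.of S X) (ModuleCat.of S S) n) :
    ∃ f hf, P.cls n f hf = x := by
  obtain ⟨g, hg, rfl⟩ := P.toProjectiveResolution.extMk_surjective x (n + 1) rfl
  obtain ⟨f, rfl⟩ := P.toHom_surjective g
  refine ⟨f, P.toHom_injective ?_, rfl⟩
  rw [← d_toHom, hg, toHom_zero]

theorem cls_eq_zero_zero {f : P.ι 0 → S} (hf : P.d 0 *ᵥ f = 0) (h : P.cls 0 f hf = 0) : f = 0 := by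
  apply P.toHom_injective
  rw [toHom_zero]
  exact P.toProjectiveResolution.eq_zero_of_extMk_eq_zero _ _ h

theorem cls_eq_zero_succ {n : ℕ} {f : P.ι (n + 1) → S} (hf : P.d (n + 1) *ᵥ f = 0) :
    P.cls (n + 1) f hf = 0 ↔ ∃ h, P.d n *ᵥ h = f := by
  rw [cls, P.toProjectiveResolution.extMk_eq_zero_iff _ _ _ _ n rfl]
  constructor
  · rintro ⟨g, hg⟩
    obtain ⟨h, rfl⟩ := P.toHom_surjective g
    rw [d_toHom] at hg
    exact ⟨h, P.toHom_injective hg⟩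
  · rintro ⟨h, rfl⟩
    exact ⟨P.toHom h, P.d_toHom h⟩

theorem mulVec_mul_right {m n : Type*} [Fintype n] (M : Matrix m n S) (f : n → S) (r : S) :
    (M *ᵥ fun i ↦ f i * r) = fun i ↦ (M *ᵥ f) i * r := by
  funext i
  simp only [mulVec, dotProduct, Finset.sum_mul, mul_assoc]

/-- Coboundaries act from the left, so they commute with right multiplication of all entries; the
right module structure of `Ext` is visible on cocycles. -/
theorem cls_comp {n : ℕ} (f : P.ι n → S) (hf : P.d n *ᵥ f = 0) (r : S) :
    (P.cls n f hf).comp (Ext.mk₀ (ModuleCat.ofHom (LinearMap.toSpanSingleton S S r)))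
      (add_zero n) = P.cls n (fun i ↦ f i * r) (by
        rw [mulVec_mul_right, hf]; funext i; simp) := by
  simp only [cls, ProjectiveResolution.extMk_comp_mk₀, toHom_comp]

end FreeRes

end FreeResolution

/-! ### Extensions of rings by two commuting units -/

section TorusExtension

open Matrix

/-- `S` is an Ore localization of an iterated skew Laurent extension of `R` in two commuting
variables. The elements `T g` are the monomials, which normalize `R`; `C` is a set of denominators,
whose elements are monic polynomials. -/
structure TorusExt (R S : Type*) [Ring R] [Ring S] where
  /-- the inclusion -/
  ι : R →+* S
  /-- the monomials -/
  T : ℤ × ℤ → S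
  /-- the automorphisms induced by the monomials -/
  ω : ℤ × ℤ → R ≃+* R
  /-- the denominators -/
  C : Submonoid S
  T_zero : T 0 = 1
  T_add : ∀ g h, T (g + h) = T g * T h
  T_mul : ∀ g r, T g * ι r = ι (ω g r) * T g
  indep : ∀ f : ℤ × ℤ →₀ R, (f.sum fun g r ↦ ι r * T g) = 0 → f = 0
  isUnit : ∀ c ∈ C, IsUnit c
  monic : ∀ c ∈ C, ∃ (f : ℤ × ℤ →₀ R) (g₀ : ℤ × ℤ), (f.sum fun g r ↦ ι r * T g) = c ∧ f g₀ = 1 ∧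
    ∀ g, f g ≠ 0 → g ≤ g₀
  den_left : ∀ x, ∃ c ∈ C, ∃ f : ℤ × ℤ →₀ R, (f.sum fun g r ↦ ι r * T g) = c * x
  den_right : ∀ x, ∃ c ∈ C, ∃ f : ℤ × ℤ →₀ R, (f.sum fun g r ↦ ι r * T g) = x * c

namespace TorusExt

variable {R S : Type*} [Ring R] [Ring S] (E : TorusExt R S) {m n : Type*}

/-- Vectors of polynomials, written with coefficients on the left. -/
noncomputable def ev : (ℤ × ℤ →₀ (n → R)) →+ (n → S) :=
  Finsupp.liftAddHom fun g ↦
    { toFun r i := E.ι (r i) * E.T g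
      map_zero' := by funext i; simp
      map_add' r s := by funext i; simp [add_mul] }

/-- Vectors of polynomials, written with coefficients on the right. -/
noncomputable def evR : (ℤ × ℤ →₀ (n → R)) →+ (n → S) :=
  Finsupp.liftAddHom fun g ↦
    { toFun r i := E.T g * E.ι (r i)
      map_zero' := by funext i; simp
      map_add' r s := by funext i; simp [mul_add] }

@[simp]
theorem ev_single (g : ℤ × ℤ) (r : n → R) :
    E.ev (Finsupp.single g r) = fun i ↦ E.ι (r i) * E.T g :=
  Finsupp.liftAddHom_apply_single _ _ _

@[simp]
theorem evR_single (g : ℤ × ℤ) (r : n → R) :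
    E.evR (Finsupp.single g r) = fun i ↦ E.T g * E.ι (r i) :=
  Finsupp.liftAddHom_apply_single _ _ _

theorem ev_apply (F : ℤ × ℤ →₀ (n → R)) (i : n) :
    E.ev F i = (F.mapRange (fun r ↦ r i) rfl).sum fun g r ↦ E.ι r * E.T g := by
  induction F using Finsupp.induction_linear with
  | zero => simp
  | add F G hF hG =>
    rw [map_add, Pi.add_apply, hF, hG, Finsupp.mapRange_add (fun _ _ ↦ rfl),
      Finsupp.sum_add_index (by simp) (by simp [add_mul])]
  | single g r => simp

theorem ev_injective : Function.Injective (E.ev (n := n)) := by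
  rw [injective_iff_map_eq_zero]
  intro F hF
  refine Finsupp.ext fun g ↦ funext fun i ↦ ?_
  have := E.indep _ ((E.ev_apply F i).symm.trans (congrFun hF i))
  exact DFunLike.congr_fun this g

/-- Moving coefficients from the right to the left. -/
noncomputable def twist : (ℤ × ℤ →₀ (n → R)) →+ (ℤ × ℤ →₀ (n → R)) :=
  Finsupp.liftAddHom fun g ↦ (Finsupp.singleAddHom g).comp
    { toFun r i := E.ω g (r i)
      map_zero' := by funext i; simp
      map_add' r s := by funext i; simp }

theorem twist_single (g : ℤ × ℤ) (r : n → R) :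
    E.twist (Finsupp.single g r) = Finsupp.single g fun i ↦ E.ω g (r i) :=
  Finsupp.liftAddHom_apply_single _ _ _

theorem twist_apply (F : ℤ × ℤ →₀ (n → R)) (g : ℤ × ℤ) :
    E.twist F g = fun i ↦ E.ω g (F g i) := by
  classical
  induction F using Finsupp.induction_linear with
  | zero => funext i; simp
  | add F G hF hG => rw [map_add, Finsupp.add_apply, hF, hG]; funext i; simp
  | single h r =>
    rw [twist_single, Finsupp.single_apply, Finsupp.single_apply]
    split_ifs with hh
    · rw [hh]
    · funext i; simp

theorem ev_twist (F : ℤ × ℤ →₀ (n → R)) : E.ev (E.twist F) = E.evR F := by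
  induction F using Finsupp.induction_linear with
  | zero => simp
  | add F G hF hG => rw [map_add, map_add, map_add, hF, hG]
  | single h r => rw [twist_single, ev_single, evR_single]; simp [T_mul]

theorem evR_injective : Function.Injective (E.evR (n := n)) := by
  rw [injective_iff_map_eq_zero]
  intro F hF
  rw [← ev_twist] at hF
  have h := (injective_iff_map_eq_zero _).1 E.ev_injective _ hF
  refine Finsupp.ext fun g ↦ funext fun i ↦ ?_
  have := congrFun (DFunLike.congr_fun h g) i
  rw [twist_apply] at this
  simpa using this

theorem exists_evR_eq_ev (F : ℤ × ℤ →₀ (n → R)) : ∃ F', E.evR F' = E.ev F := by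
  induction F using Finsupp.induction_linear with
  | zero => exact ⟨0, by simp⟩
  | add F G hF hG =>
    obtain ⟨F', hF⟩ := hF
    obtain ⟨G', hG⟩ := hG
    exact ⟨F' + G', by rw [map_add, map_add, hF, hG]⟩
  | single g r =>
    exact ⟨Finsupp.single g fun i ↦ (E.ω g).symm (r i), by simp [T_mul]⟩

/-- With the monomials on the far right, a matrix over `R` acting from the left meets only the
coefficients. Equations between columns can thus be read off one exponent at a time. -/
theorem ev_mulVec [Fintype n] (M : Matrix m n R) (F : ℤ × ℤ →₀ (n → R)) :
    M.map E.ι *ᵥ E.ev F = E.ev (F.mapRange (M *ᵥ ·) (mulVec_zero M)) := by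
  induction F using Finsupp.induction_linear with
  | zero => simp
  | add F G hF hG =>
    rw [map_add, mulVec_add, hF, hG, Finsupp.mapRange_add (mulVec_add M), map_add]
  | single g r =>
    rw [Finsupp.mapRange_single, ev_single, ev_single, FreeRes.mulVec_mul_right]
    funext i
    exact congrArg (· * E.T g) (RingHom.map_mulVec E.ι M r i).symm

/-- The mirror image for rows, which is why `evR` keeps its monomials on the left. -/
theorem evR_vecMul [Fintype m] (M : Matrix m n R) (F : ℤ × ℤ →₀ (m → R)) :
    E.evR F ᵥ* M.map E.ι = E.evR (F.mapRange (· ᵥ* M) (zero_vecMul M)) := by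
  induction F using Finsupp.induction_linear with
  | zero => simp
  | add F G hF hG =>
    rw [map_add, add_vecMul, hF, hG, Finsupp.mapRange_add (add_vecMul M), map_add]
  | single g r =>
    rw [Finsupp.mapRange_single, evR_single, evR_single]
    funext i
    simp only [vecMul, dotProduct, map_apply, map_sum, map_mul, Finset.mul_sum, mul_assoc]

/-- The image of the iterated skew Laurent ring is closed under multiplication. -/
theorem exists_ev_mul (F : ℤ × ℤ →₀ (n → R)) (G : ℤ × ℤ →₀ R) :
    ∃ H, E.ev H = fun i ↦ E.ev F i * G.sum fun g r ↦ E.ι r * E.T g := by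
  induction F using Finsupp.induction_linear with
  | zero => exact ⟨0, by funext i; simp⟩
  | add F F' hF hF' =>
    obtain ⟨H, hH⟩ := hF
    obtain ⟨H', hH'⟩ := hF'
    exact ⟨H + H', by rw [map_add, hH, hH', map_add]; funext i; simp [add_mul]⟩
  | single g r =>
    induction G using Finsupp.induction_linear with
    | zero => exact ⟨0, by funext i; simp⟩
    | add F F' hF hF' =>
      obtain ⟨H, hH⟩ := hF
      obtain ⟨H', hH'⟩ := hF'
      refine ⟨H + H', ?_⟩
      rw [map_add, hH, hH', Finsupp.sum_add_index (by simp) (by simp [add_mul])]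
      funext i
      simp [mul_add]
    | single h s =>
      refine ⟨Finsupp.single (g + h) fun i ↦ r i * E.ω g s, ?_⟩
      rw [ev_single, ev_single]
      funext i
      rw [Finsupp.sum_single_index (by simp), T_add, map_mul, mul_assoc (E.ι (r i)),
        mul_assoc (E.ι (r i)), ← mul_assoc _ (E.T g), ← E.T_mul, mul_assoc]

theorem exists_mul_ev (F : ℤ × ℤ →₀ (n → R)) (G : ℤ × ℤ →₀ R) :
    ∃ H, E.ev H = fun i ↦ (G.sum fun g r ↦ E.ι r * E.T g) * E.ev F i := by
  induction F using Finsupp.induction_linear with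
  | zero => exact ⟨0, by funext i; simp⟩
  | add F F' hF hF' =>
    obtain ⟨H, hH⟩ := hF
    obtain ⟨H', hH'⟩ := hF'
    exact ⟨H + H', by rw [map_add, hH, hH', map_add]; funext i; simp [mul_add]⟩
  | single h s =>
    induction G using Finsupp.induction_linear with
    | zero => exact ⟨0, by funext i; simp⟩
    | add F F' hF hF' =>
      obtain ⟨H, hH⟩ := hF
      obtain ⟨H', hH'⟩ := hF'
      refine ⟨H + H', ?_⟩
      rw [map_add, hH, hH', Finsupp.sum_add_index (by simp) (by simp [add_mul])]
      funext i
      simp [add_mul]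
    | single g r =>
      refine ⟨Finsupp.single (g + h) fun i ↦ r * E.ω g (s i), ?_⟩
      rw [ev_single, ev_single]
      funext i
      rw [Finsupp.sum_single_index (by simp), T_add, map_mul, mul_assoc (E.ι r),
        mul_assoc (E.ι r), ← mul_assoc _ (E.T g), ← E.T_mul, mul_assoc]

theorem ev_mapRange_single [DecidableEq n] (f : ℤ × ℤ →₀ R) (i : n) :
    E.ev (f.mapRange (fun r ↦ (Pi.single i r : n → R)) (Pi.single_zero i)) =
      Pi.single i (f.sum fun g r ↦ E.ι r * E.T g) := by
  funext j
  rw [ev_apply]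
  induction f using Finsupp.induction_linear with
  | zero => simp
  | add F F' hF hF' =>
    rw [Finsupp.mapRange_add (Pi.single_add (f := fun _ ↦ R) i), Finsupp.mapRange_add (fun _ _ ↦ rfl),
      Finsupp.sum_add_index (by simp) (by simp [add_mul]), hF, hF',
      Finsupp.sum_add_index (by simp) (by simp [add_mul]), Pi.single_add, Pi.add_apply]
  | single h s =>
    rw [Finsupp.mapRange_single, Finsupp.mapRange_single, Finsupp.sum_single_index (by simp),
      Finsupp.sum_single_index (by simp)]
    obtain rfl | hij := eq_or_ne j i
    · simp
    · simp [hij]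

/-- A common denominator is built one coordinate at a time. The coordinates already cleared stay
cleared, since denominators are themselves polynomials. -/
theorem exists_ev_right [Finite n] (v : n → S) :
    ∃ c ∈ E.C, ∃ F, E.ev F = fun i ↦ v i * c := by
  classical
  have := Fintype.ofFinite n
  suffices h : ∀ s : Finset n, ∃ c ∈ E.C, ∃ F, E.ev F = fun i ↦ if i ∈ s then v i * c else 0 by
    simpa using h Finset.univ
  intro s
  induction s using Finset.induction_on with
  | empty => exact ⟨1, one_mem _, 0, by funext; simp⟩
  | insert i s hi ih =>
    obtain ⟨c, hc, F, hF⟩ := ih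
    obtain ⟨c', hc', f, hf⟩ := E.den_right (v i * c)
    obtain ⟨p, -, hp, -⟩ := E.monic c' hc'
    obtain ⟨H, hH⟩ := E.exists_ev_mul F p
    refine ⟨c * c', mul_mem hc hc', H + f.mapRange _ (Pi.single_zero i), ?_⟩
    rw [map_add, hH, hF, ev_mapRange_single, hp, hf]
    funext j
    obtain rfl | hij := eq_or_ne j i
    · simp [hi, mul_assoc]
    · simp [hij, mul_assoc]

theorem exists_ev_left [Finite n] (v : n → S) :
    ∃ c ∈ E.C, ∃ F, E.ev F = fun i ↦ c * v i := by
  classical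
  have := Fintype.ofFinite n
  suffices h : ∀ s : Finset n, ∃ c ∈ E.C, ∃ F, E.ev F = fun i ↦ if i ∈ s then c * v i else 0 by
    simpa using h Finset.univ
  intro s
  induction s using Finset.induction_on with
  | empty => exact ⟨1, one_mem _, 0, by funext; simp⟩
  | insert i s hi ih =>
    obtain ⟨c, hc, F, hF⟩ := ih
    obtain ⟨c', hc', f, hf⟩ := E.den_left (c * v i)
    obtain ⟨p, -, hp, -⟩ := E.monic c' hc'
    obtain ⟨H, hH⟩ := E.exists_mul_ev F p
    refine ⟨c' * c, mul_mem hc' hc, H + f.mapRange _ (Pi.single_zero i), ?_⟩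
    rw [map_add, hH, hF, ev_mapRange_single, hp, hf]
    funext j
    obtain rfl | hij := eq_or_ne j i
    · simp [hi, mul_assoc]
    · simp [hij, mul_assoc]

theorem exists_mapRange_eq {A B : Type*} [AddCommGroup A] [AddCommGroup B] {φ : A → B}
    (hφ : φ 0 = 0) (F : ℤ × ℤ →₀ B) (h : ∀ g, ∃ a, φ a = F g) : 
    ∃ F' : ℤ × ℤ →₀ A, F'.mapRange φ hφ = F := by
  classical
  choose a ha using h
  -- The preimage of a zero coefficient is taken to be `0`, to keep the support finite.
  refine ⟨Finsupp.onFinset F.support (fun g ↦ if F g = 0 then 0 else a g) (by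
    intro g hg
    rw [Finsupp.mem_support_iff]
    rintro h
    simp [h] at hg), Finsupp.ext fun g ↦ ?_⟩
  rw [Finsupp.mapRange_apply, Finsupp.onFinset_apply]
  split_ifs with h
  · rw [hφ, h]
  · exact ha g

/-- Exactness of complexes of finite free modules is preserved under extension of scalars. -/
theorem vecMul_exact {l : Type*} [Fintype l] [Fintype m] {M : Matrix m n R} {N : Matrix l m R}
    (h : ∀ v : m → R, v ᵥ* M = 0 ↔ ∃ w, w ᵥ* N = v) (v : m → S) :
    v ᵥ* M.map E.ι = 0 ↔ ∃ w, w ᵥ* N.map E.ι = v := by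
  constructor
  · intro hv
    -- Matrices act on the right of rows, so denominators are cleared on the left, where they
    -- commute with the matrices.
    obtain ⟨c, hc, F, hF⟩ := E.exists_ev_left v
    obtain ⟨F, hF⟩ := hF ▸ E.exists_evR_eq_ev F
    have h0 : E.evR (F.mapRange (· ᵥ* M) (zero_vecMul M)) = 0 := by
      rw [← evR_vecMul, hF]
      exact (smul_vecMul c v _).trans (by rw [hv, smul_zero])
    have h1 := (injective_iff_map_eq_zero _).1 E.evR_injective _ h0
    obtain ⟨W, rfl⟩ := exists_mapRange_eq (zero_vecMul N) F fun g ↦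
      (h _).1 (DFunLike.congr_fun h1 g)
    obtain ⟨c, rfl⟩ := E.isUnit c hc
    refine ⟨(↑c⁻¹ : S) • E.evR W, ?_⟩
    rw [smul_vecMul, evR_vecMul, hF]
    funext i
    simp
  · rintro ⟨w, rfl⟩
    rw [vecMul_vecMul, ← Matrix.map_mul]
    have : N * M = 0 := by
      classical
      funext i
      rw [mul_apply_eq_vecMul]
      exact (h (N i)).2 ⟨Pi.single i 1, single_one_vecMul i N⟩
    rw [this]
    simp

/-- The points `g - N • e` are pairwise distinct, and a finite support cannot contain all of them.
-/
theorem exists_shift_eq_zero {A : Type*} [Zero A] (F : ℤ × ℤ →₀ A) {e : ℤ × ℤ} (he : e ≠ 0)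
    (g : ℤ × ℤ) : ∃ N : ℕ, F (g - N • e) = 0 := by
  by_contra! h
  have hinj : Function.Injective fun N : ℕ ↦ g - N • e := by
    intro a b hab
    have h1 : (a : ℤ) • e = (b : ℤ) • e := by simpa using hab
    exact_mod_cast smul_left_injective ℤ he h1
  exact Set.infinite_of_injective_forall_mem hinj (fun N ↦ Finsupp.mem_support_iff.2 (h N))
    F.support.finite_toSet

/-- Induction along a direction. -/
theorem induction_shift {A : Type*} [Zero A] (F : ℤ × ℤ →₀ A) {e : ℤ × ℤ} (he : e ≠ 0)
    {Q : ℤ × ℤ → Prop} (h0 : ∀ g, F g = 0 → Q g) (h1 : ∀ g, Q (g - e) → Q g) (g : ℤ × ℤ) : Q g := by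
  obtain ⟨N, hN⟩ := exists_shift_eq_zero F he g
  have := h0 _ hN
  clear hN
  induction N with
  | zero => simpa using this
  | succ N ih => exact ih (h1 _ (by rwa [sub_sub, ← succ_nsmul]))

end TorusExt

end TorusExtension

/-! ### Semilinear chain maps on free resolutions -/

section SemilinearLift

universe u

open Matrix

namespace FreeRes

variable {R : Type u} [Ring R] {X : Type u} [AddCommGroup X] [Module R X] (P : FreeRes R X)

/-- The index types shifted by one. -/
def pι : ℕ → Type
  | 0 => Empty
  | n + 1 => P.ι n

instance : ∀ n, Fintype (P.pι n)
  | 0 => inferInstanceAs (Fintype Empty)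
  | n + 1 => inferInstanceAs (Fintype (P.ι n))

instance : ∀ n, DecidableEq (P.pι n)
  | 0 => inferInstanceAs (DecidableEq Empty)
  | n + 1 => inferInstanceAs (DecidableEq (P.ι n))

/-- The differential into degree `n - 1`, which is zero for `n = 0`. -/
def pd : ∀ n, Matrix (P.ι n) (P.pι n) R
  | 0 => fun _ e ↦ Empty.elim e
  | n + 1 => P.d n

theorem pd_zero_mulVec (h : P.pι 0 → R) : P.pd 0 *ᵥ h = 0 :=
  funext fun i ↦ show ∑ j, P.pd 0 i j * h j = 0 from
    Finset.sum_eq_zero fun e _ ↦ Empty.elim e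

theorem exists_pd_zero_iff {f : P.ι 0 → R} : (∃ h, P.pd 0 *ᵥ h = f) ↔ f = 0 :=
  ⟨by rintro ⟨h, rfl⟩; exact P.pd_zero_mulVec h, by
    rintro rfl; exact ⟨0, mulVec_zero _⟩⟩

/-- The incoming differential `pd` treats degree zero like the other degrees, sparing later
arguments a case distinction. -/
theorem cls_eq_zero_iff {n : ℕ} {f : P.ι n → R} (hf : P.d n *ᵥ f = 0) :
    P.cls n f hf = 0 ↔ ∃ h, P.pd n *ᵥ h = f := by
  cases n with
  | zero =>
    rw [exists_pd_zero_iff]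
    refine ⟨P.cls_eq_zero_zero hf, ?_⟩
    rintro rfl
    have := P.cls_add 0 0 hf hf
    rw [P.cls_congr (add_zero 0)] at this
    simpa using this
  | succ n => exact P.cls_eq_zero_succ hf

theorem d_mul_d (n : ℕ) : P.d (n + 1) * P.d n = 0 := by
  funext i
  rw [mul_apply_eq_vecMul]
  exact (P.exact_succ n _).2 ⟨Pi.single i 1, single_one_vecMul i _⟩

theorem d_mul_pd (n : ℕ) : P.d n * P.pd n = 0 := by
  cases n with
  | zero => exact funext fun _ ↦ funext fun e ↦ Empty.elim e
  | succ n => exact P.d_mul_d n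

theorem exists_mul_d_succ {κ : Type*} {n : ℕ} {M : Matrix κ (P.ι (n + 1)) R} (h : M * P.d n = 0) :
    
    ∃ N : Matrix κ (P.ι (n + 2)) R, N * P.d (n + 1) = M := by
  have : ∀ i, ∃ w, w ᵥ* P.d (n + 1) = M i := fun i ↦ (P.exact_succ n _).1 (by
    rw [← mul_apply_eq_vecMul, h]; rfl)
  choose N hN using this
  exact ⟨N, funext fun i ↦ (mul_apply_eq_vecMul _ _ _).trans (hN i)⟩

theorem exists_mul_d_zero {κ : Type*} {M : Matrix κ (P.ι 0) R}
    (h : ∀ i, ∑ j, M i j • P.ε j = 0) : ∃ N : Matrix κ (P.ι 1) R, N * P.d 0 = M := by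
  have : ∀ i, ∃ w, w ᵥ* P.d 0 = M i := fun i ↦ (P.exact_zero _).1 (h i)
  choose N hN using this
  exact ⟨N, funext fun i ↦ (mul_apply_eq_vecMul _ _ _).trans (hN i)⟩

/-- This is the comparison theorem for a semilinear map that fixes the generators of `X`: by
hypothesis it preserves their relations, so the identity matrix may be used in degree zero, and
exactness gives the higher degrees. -/
theorem exists_lift (ω : R ≃+* R)
    (h : ∀ v : P.ι 0 → R, ∑ i, v i • P.ε i = 0 → ∑ i, ω (v i) • P.ε i = 0) :
    ∃ θ : ∀ n, Matrix (P.ι n) (P.ι n) R, θ 0 = 1 ∧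
      ∀ n, θ (n + 1) * P.d n = (P.d n).map ω * θ n := by
  let A (n : ℕ) (θ : Matrix (P.ι n) (P.ι n) R) : Prop :=
    ∃ θ' : Matrix (P.ι (n + 1)) (P.ι (n + 1)) R, θ' * P.d n = (P.d n).map ω * θ
  have h0 : A 0 1 := by
    simp only [A, Matrix.mul_one]
    refine P.exists_mul_d_zero fun i ↦ ?_
    exact h _ ((P.exact_zero _).2 ⟨Pi.single i 1, single_one_vecMul i _⟩)
  have h1 : ∀ n θ (hθ : A n θ), A (n + 1) hθ.choose := fun n θ hθ ↦ by
    refine P.exists_mul_d_succ ?_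
    rw [Matrix.mul_assoc, hθ.choose_spec, ← Matrix.mul_assoc, ← Matrix.map_mul, d_mul_d]
    simp
  -- The recursion carries along the proof that the current matrix can be lifted once more.
  let θ : ∀ n, {θ // A n θ} := fun n ↦ Nat.rec (motive := fun n ↦ {θ // A n θ}) ⟨1, h0⟩
    (fun n θ ↦ ⟨θ.2.choose, h1 n _ θ.2⟩) n
  exact ⟨fun n ↦ (θ n).1, rfl, fun n ↦ (θ n).2.choose_spec⟩

/-- A chain map lifting the identity is homotopic to the identity. The homotopy of one degree
becomes the second matrix `s'` of the next. -/
theorem exists_homotopy (χ : ∀ n, Matrix (P.ι n) (P.ι n) R) (h0 : χ 0 = 1)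
    (h : ∀ n, χ (n + 1) * P.d n = P.d n * χ n) (n : ℕ) :
    ∃ (s : Matrix (P.ι n) (P.ι (n + 1)) R) (s' : Matrix (P.pι n) (P.ι n) R),
      χ n - 1 = s * P.d n + P.pd n * s' := by
  induction n with
  | zero => exact ⟨0, 0, by simp [h0]⟩
  | succ n ih =>
    obtain ⟨s, s', hs⟩ := ih
    -- By the homotopy formula in degree `n`, this error term times `P.d n` equals `P.d n * P.pd n *
    -- s' = 0`, so it factors through the next differential.
    obtain ⟨N, hN⟩ := P.exists_mul_d_succ (M := χ (n + 1) - 1 - P.d n * s) (by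
      rw [Matrix.sub_mul, Matrix.sub_mul, h, Matrix.one_mul, Matrix.mul_assoc,
        show P.d n * χ n - P.d n - P.d n * (s * P.d n) = P.d n * (χ n - 1 - s * P.d n) by
          simp [Matrix.mul_sub], hs, add_sub_cancel_left, ← Matrix.mul_assoc, d_mul_pd,
        Matrix.zero_mul])
    exact ⟨N, s, by rw [hN]; exact (sub_add_cancel _ _).symm⟩

/-- The semilinear map of cochains induced by a matrix. -/
def tw {n : Type*} [Fintype n] (ω : R ≃+* R) (θ : Matrix n n R) (x : n → R) : n → R :=
  fun i ↦ ω ((θ *ᵥ x) i)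

theorem tw_zero {n : Type*} [Fintype n] (ω : R ≃+* R) (θ : Matrix n n R) : tw ω θ 0 = 0 := by
  funext i
  simp [tw]

theorem tw_add {n : Type*} [Fintype n] (ω : R ≃+* R) (θ : Matrix n n R) (x y : n → R) :
    tw ω θ (x + y) = tw ω θ x + tw ω θ y := by
  funext i
  simp [tw, mulVec_add]

theorem map_mulVec_comp {m n : Type*} [Fintype n] (ω : R ≃+* R) (M : Matrix m n R) (x : n → R) :
    (M.map ω *ᵥ fun i ↦ ω (x i)) = fun i ↦ ω ((M *ᵥ x) i) :=
  funext fun i ↦ (RingHom.map_mulVec (ω : R →+* R) M x i).symm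

theorem map_symm_map {m n : Type*} (ω : R ≃+* R) (M : Matrix m n R) :
    (M.map ω.symm).map ω = M := by
  ext
  simp

theorem map_map_symm {m n : Type*} (ω : R ≃+* R) (M : Matrix m n R) :
    (M.map ω).map ω.symm = M := by
  ext
  simp

section lift

variable {ω : R ≃+* R} {θ : ∀ n, Matrix (P.ι n) (P.ι n) R} (h0 : θ 0 = 1)
  (h : ∀ n, θ (n + 1) * P.d n = (P.d n).map ω.symm * θ n)

include h

/-- Applying `ω` after `θ` cancels the `ω.symm` in the chain map relation, so `tw` is a semilinear
map of cochain complexes. -/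
theorem d_mulVec_tw (n : ℕ) (x : P.ι n → R) :
    P.d n *ᵥ tw ω (θ n) x = tw ω (θ (n + 1)) (P.d n *ᵥ x) := by
  have := map_mulVec_comp ω ((P.d n).map ω.symm) (θ n *ᵥ x)
  rw [mulVec_mulVec, ← h, ← mulVec_mulVec, map_symm_map] at this
  exact this

theorem exists_pd_tw {n : ℕ} {x : P.ι n → R} (hx : ∃ y, P.pd n *ᵥ y = x) :
    ∃ y, P.pd n *ᵥ y = tw ω (θ n) x := by
  cases n with
  | zero => rw [exists_pd_zero_iff] at hx ⊢; rw [hx, tw_zero]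
  | succ n =>
    obtain ⟨y, rfl⟩ := hx
    exact ⟨_, P.d_mulVec_tw h n y⟩

include h0

/-- The composite of the two semilinear maps is a linear chain map that starts with the identity, so
`exists_homotopy` applies; on a cocycle only the coboundary term of the homotopy survives. -/
theorem exists_pd_tw_tw {θ' : ∀ n, Matrix (P.ι n) (P.ι n) R} (h0' : θ' 0 = 1)
    (h' : ∀ n, θ' (n + 1) * P.d n = (P.d n).map ω * θ' n) {n : ℕ} {x : P.ι n → R}
    (hx : P.d n *ᵥ x = 0) : ∃ y, P.pd n *ᵥ y = tw ω.symm (θ' n) (tw ω (θ n) x) - x := by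
  obtain ⟨s, s', hs⟩ := P.exists_homotopy (fun n ↦ (θ' n).map ω.symm * θ n)
    (by simp [h0, h0', Matrix.map_one]) (fun n ↦ by
      have := congrArg (fun M ↦ M.map ω.symm) (h' n)
      simp only [Matrix.map_mul, map_map_symm] at this
      rw [Matrix.mul_assoc, h, ← Matrix.mul_assoc, this, Matrix.mul_assoc]) n
  refine ⟨s' *ᵥ x, ?_⟩
  have h1 := congrArg (· *ᵥ x) hs
  simp only [sub_mulVec, add_mulVec, one_mulVec, ← mulVec_mulVec, hx, mulVec_zero, zero_add] at h1
  rw [← h1]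
  congr 1
  refine .trans ?_ (map_mulVec_comp ω.symm (θ' n) (tw ω (θ n) x))
  congr 1
  funext i
  simp [tw]

end lift

end FreeRes

end SemilinearLift

/-! ### The mapping cone resolution -/

section Cone

universe u

open Matrix CategoryTheory Abelian

/-- An extension of rings `R ⊆ S` by two commuting units, an `R`-module `X` with a free resolution
and a semilinear automorphism, and the `S`-module `Y` of coinvariants of this automorphism on the
extension of scalars of `X`. -/
structure ConeData (R S : Type u) [Ring R] [Ring S] (X Y : Type u) [AddCommGroup X] [Module R X]
    [AddCommGroup Y] [Module S Y] extends TorusExt R S where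
  /-- the resolution -/
  P : FreeRes R X
  /-- the matrices of a semilinear chain map -/
  θ : ∀ n, Matrix (P.ι n) (P.ι n) R
  /-- the matrices of its inverse -/
  θ' : ∀ n, Matrix (P.ι n) (P.ι n) R
  θ_zero : θ 0 = 1
  θ'_zero : θ' 0 = 1
  θ_succ : ∀ n, θ (n + 1) * P.d n = (P.d n).map (ω (1, -1)).symm * θ n
  θ'_succ : ∀ n, θ' (n + 1) * P.d n = (P.d n).map (ω (1, -1)) * θ' n
  /-- generators of `Y` -/
  ε : P.ι 0 → Y
  stable : ∀ v : P.ι 0 → R, ∑ i, v i • P.ε i = 0 → ∑ i, (ω (1, -1)).symm (v i) • P.ε i = 0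
  surj : ∀ y, ∃ v : P.ι 0 → S, ∑ i, v i • ε i = y
  ker : ∀ v : P.ι 0 → S, ∑ i, v i • ε i = 0 ↔
    ∃ (w : P.ι 1 → S) (z : P.ι 0 → S), w ᵥ* (P.d 0).map ι + (fun i ↦ z i * (T (1, -1) - 1)) = v

namespace ConeData

variable {R S : Type u} [Ring R] [Ring S] {X Y : Type u} [AddCommGroup X] [Module R X]
    [AddCommGroup Y] [Module S Y] (E : ConeData R S X Y)

/-- The unit inducing the automorphism. -/
abbrev u : S := E.T (1, -1)

/-- The extended differentials. -/
abbrev δ (n : ℕ) : Matrix (E.P.ι (n + 1)) (E.P.ι n) S := (E.P.d n).map E.ι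

/-- The extended differentials, starting in degree zero. -/
abbrev δ' (n : ℕ) : Matrix (E.P.ι n) (E.P.pι n) S := (E.P.pd n).map E.ι

/-- The chain map whose cone is taken. -/
def γ (n : ℕ) : Matrix (E.P.ι n) (E.P.ι n) S := (E.θ n).map (fun r ↦ E.u * E.ι r) - 1

theorem u_mul (r : R) : E.u * E.ι ((E.ω (1, -1)).symm r) = E.ι r * E.u := by
  rw [E.T_mul, RingEquiv.apply_symm_apply]

theorem γ_zero : E.γ 0 = diagonal fun _ ↦ E.u - 1 := by
  rw [γ, E.θ_zero]
  ext i j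
  by_cases h : i = j
  · subst h; simp
  · simp [h]

/-- Moving `u` past a coefficient undoes the twist in `θ_succ`, so `uθ` is a genuinely linear chain
map over `S`. -/
theorem γ_mul_δ (n : ℕ) : E.γ (n + 1) * E.δ n = E.δ n * E.γ n := by
  have h1 : (E.θ (n + 1)).map (fun r ↦ E.u * E.ι r) * E.δ n =
      (E.θ (n + 1) * E.P.d n).map (fun r ↦ E.u * E.ι r) := by
    ext i j
    simp only [mul_apply, map_apply, map_sum, map_mul, Finset.mul_sum, mul_assoc]
  have h2 : E.δ n * (E.θ n).map (fun r ↦ E.u * E.ι r) =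
      ((E.P.d n).map (E.ω (1, -1)).symm * E.θ n).map (fun r ↦ E.u * E.ι r) := by
    ext i j
    simp only [mul_apply, map_apply, map_sum, map_mul, Finset.mul_sum, ← mul_assoc, u_mul]
  rw [γ, γ, Matrix.sub_mul, Matrix.mul_sub, h1, h2, E.θ_succ, Matrix.one_mul, Matrix.mul_one]

theorem δ_mul_δ (n : ℕ) : E.δ (n + 1) * E.δ n = 0 := by
  rw [← Matrix.map_mul, E.P.d_mul_d]; simp

theorem δ_mul_δ' (n : ℕ) : E.δ n * E.δ' n = 0 := by
  rw [← Matrix.map_mul, E.P.d_mul_pd]; simp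

theorem δ_exact (n : ℕ) (v : E.P.ι (n + 1) → S) :
    v ᵥ* E.δ n = 0 ↔ ∃ w, w ᵥ* E.δ (n + 1) = v :=
  E.vecMul_exact (E.P.exact_succ n) v

theorem evR_mul_u {n : Type*} (F : ℤ × ℤ →₀ (n → R)) :
    (fun i ↦ E.evR F i * E.u) = E.evR ((F.mapRange (fun x i ↦ (E.ω (1, -1)).symm (x i))
      (funext fun _ ↦ map_zero _)).mapDomain (· + (1, -1))) := by
  induction F using Finsupp.induction_linear with
  | zero => simp; rfl
  | add F G hF hG =>
    rw [Finsupp.mapRange_add (fun _ _ ↦ funext fun i ↦ map_add _ _ _), Finsupp.mapDomain_add,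
      map_add, map_add, ← hF, ← hG]
    funext i
    simp [add_mul]
  | single g r =>
    rw [Finsupp.mapRange_single, Finsupp.mapDomain_single, TorusExt.evR_single,
      TorusExt.evR_single]
    funext i
    rw [E.T_add, mul_assoc, mul_assoc, u_mul]

theorem mapDomain_shift_apply {A : Type*} [AddCommMonoid A] (F : ℤ × ℤ →₀ A) (e g : ℤ × ℤ) :
    F.mapDomain (· + e) g = F (g - e) := by
  conv_lhs => rw [← sub_add_cancel g e]
  exact Finsupp.mapDomain_apply (add_left_injective e) F (g - e)

/-- Right multiplication by `u - 1` is injective on the extension of scalars of `X`. -/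
theorem exists_vecMul_δ_of_mul_u_sub_one {v : E.P.ι 1 → S} {w : E.P.ι 0 → S}
    (h : (fun i ↦ w i * (E.u - 1)) = v ᵥ* E.δ 0) : ∃ z, z ᵥ* E.δ 0 = w := by
  -- One denominator has to serve both vectors, so they are cleared as a single vector.
  obtain ⟨c, hc, F, hF⟩ := E.exists_ev_left (Sum.elim w v)
  obtain ⟨F, hF⟩ := hF ▸ E.exists_evR_eq_ev F
  let Fw := F.mapRange (fun x i ↦ x (Sum.inl i)) rfl
  let Fv := F.mapRange (fun x i ↦ x (Sum.inr i)) rfl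
  have key : ∀ {n m : Type} (F : ℤ × ℤ →₀ (n → R)) (f : m → n),
      E.evR (F.mapRange (fun x i ↦ x (f i)) rfl) = fun i ↦ E.evR F (f i) := by
    intro n m F f
    induction F using Finsupp.induction_linear with
    | zero => simp; rfl
    | add F G hF hG =>
      rw [Finsupp.mapRange_add (fun _ _ ↦ rfl), map_add, map_add, hF, hG]; rfl
    | single g r => rw [Finsupp.mapRange_single, TorusExt.evR_single, TorusExt.evR_single]
  have hw : E.evR Fw = fun i ↦ c * w i := by rw [key, hF]; rfl
  have hv : E.evR Fv = fun i ↦ c * v i := by rw [key, hF]; rfl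
  have h1 : E.evR ((Fw.mapRange (fun x i ↦ (E.ω (1, -1)).symm (x i))
      (funext fun _ ↦ map_zero _)).mapDomain (· + (1, -1)) - Fw) =
      E.evR (Fv.mapRange (· ᵥ* E.P.d 0) (zero_vecMul _)) := by
    rw [map_sub, ← evR_mul_u, ← TorusExt.evR_vecMul, hw, hv]
    have : (fun i ↦ c * v i) ᵥ* E.δ 0 = c • (v ᵥ* E.δ 0) := smul_vecMul c v _
    rw [this, ← h]
    funext i
    simp [mul_sub, mul_assoc]
  have h2 := E.evR_injective h1
  -- The coefficient at `g` is the twisted coefficient at `g - (1, -1)` minus a relation, and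
  -- twisting preserves relations. Far enough along the line the coefficient is zero, which starts
  -- the induction.
  have h3 : ∀ g, ∃ z, z ᵥ* E.P.d 0 = Fw g := by
    refine TorusExt.induction_shift Fw (e := (1, -1)) (by simp) ?_ ?_
    · intro g hg
      exact ⟨0, by simp [hg]⟩
    · rintro g ⟨z, hz⟩
      have h4 : (fun i ↦ (E.ω (1, -1)).symm (Fw (g - (1, -1)) i)) - Fw g = Fv g ᵥ* E.P.d 0 := by
        have := DFunLike.congr_fun h2 g
        rw [Finsupp.sub_apply, mapDomain_shift_apply] at this
        exact this
      have h5 : ∃ z', z' ᵥ* E.P.d 0 = fun i ↦ (E.ω (1, -1)).symm (Fw (g - (1, -1)) i) :=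
        (E.P.exact_zero _).1 (E.stable _ ((E.P.exact_zero _).2 ⟨z, hz⟩))
      obtain ⟨z', hz'⟩ := h5
      refine ⟨z' - Fv g, ?_⟩
      rw [sub_vecMul, hz', ← h4]
      exact sub_sub_cancel _ _
  obtain ⟨W, hW⟩ := TorusExt.exists_mapRange_eq (zero_vecMul (E.P.d 0)) Fw h3
  obtain ⟨c, rfl⟩ := E.isUnit c hc
  refine ⟨(↑c⁻¹ : S) • E.evR W, ?_⟩
  rw [smul_vecMul, TorusExt.evR_vecMul, hW, hw]
  funext i
  simp

/-- The differentials of the mapping cone. -/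
def coneD (n : ℕ) : Matrix (E.P.ι (n + 1) ⊕ E.P.ι n) (E.P.ι n ⊕ E.P.pι n) S :=
  fromBlocks (E.δ n) 0 (E.γ n) (-E.δ' n)

theorem vecMul_coneD (n : ℕ) (v : E.P.ι (n + 1) → S) (w : E.P.ι n → S) :
    Sum.elim v w ᵥ* E.coneD n = Sum.elim (v ᵥ* E.δ n + w ᵥ* E.γ n) (-(w ᵥ* E.δ' n)) := by
  rw [coneD, vecMul_fromBlocks]
  simp only [Sum.elim_comp_inl, Sum.elim_comp_inr, vecMul_zero, zero_add, vecMul_neg]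

theorem coneD_mulVec (n : ℕ) (f : E.P.ι n → S) (h : E.P.pι n → S) :
    E.coneD n *ᵥ Sum.elim f h = Sum.elim (E.δ n *ᵥ f) (E.γ n *ᵥ f - E.δ' n *ᵥ h) := by
  rw [coneD, fromBlocks_mulVec]
  simp [neg_mulVec, sub_eq_add_neg]

theorem elim_eq_elim_iff {a b c : Type*} {f f' : a → c} {g g' : b → c} :
    Sum.elim f g = Sum.elim f' g' ↔ f = f' ∧ g = g' :=
  ⟨fun h ↦ ⟨congrArg (· ∘ Sum.inl) h, congrArg (· ∘ Sum.inr) h⟩, by rintro ⟨rfl, rfl⟩; rfl⟩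

theorem sum_pι_zero {A : Type*} [AddCommMonoid A] (f : E.P.pι 0 → A) : ∑ i, f i = 0 :=
  Finset.sum_eq_zero fun e _ ↦ Empty.elim e

/-- The cone is exact because the extended resolution is exact in positive degrees and `u - 1` is
injective on the module it resolves. -/
theorem coneD_exact (n : ℕ) (v : E.P.ι (n + 1) → S) (w : E.P.ι n → S) :
    Sum.elim v w ᵥ* E.coneD n = 0 ↔
      ∃ (y : E.P.ι (n + 2) → S) (z : E.P.ι (n + 1) → S), Sum.elim y z ᵥ* E.coneD (n + 1) =
        Sum.elim v w := by
  have h0 : (0 : E.P.ι n ⊕ E.P.pι n → S) =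
      Sum.elim (0 : E.P.ι n → S) (0 : E.P.pι n → S) := by funext i; cases i <;> rfl
  have e (y : E.P.ι (n + 2) → S) (z : E.P.ι (n + 1) → S) :
      Sum.elim y z ᵥ* E.coneD (n + 1) = Sum.elim v w ↔
        y ᵥ* E.δ (n + 1) + z ᵥ* E.γ (n + 1) = v ∧ -(z ᵥ* E.δ n) = w := by
    rw [vecMul_coneD]
    exact elim_eq_elim_iff
  rw [h0, vecMul_coneD, elim_eq_elim_iff, exists_congr fun y ↦ exists_congr fun z ↦ e y z]
  constructor
  · rintro ⟨h1, h2⟩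
    have hz : ∃ z, z ᵥ* E.δ n = w := by
      cases n with
      | zero =>
        -- In degree zero the equation with `δ'` is empty; the remaining one says that `u - 1` sends
        -- the class of `w` to zero.
        refine E.exists_vecMul_δ_of_mul_u_sub_one (v := -v) ?_
        rw [neg_vecMul, ← sub_eq_zero, sub_neg_eq_add, add_comm, ← h1, γ_zero]
        congr 1
        funext i
        rw [vecMul_diagonal]
      | succ n => exact (E.δ_exact n w).1 (neg_eq_zero.1 h2)
    obtain ⟨z, rfl⟩ := hz
    have h3 : (v + z ᵥ* E.γ (n + 1)) ᵥ* E.δ n = 0 := by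
      rw [add_vecMul, vecMul_vecMul, γ_mul_δ, ← vecMul_vecMul, h1]
    obtain ⟨y, hy⟩ := (E.δ_exact n _).1 h3
    refine ⟨y, -z, ?_, ?_⟩
    · rw [hy, neg_vecMul]; exact add_neg_cancel_right _ _
    · rw [neg_vecMul]; exact neg_neg _
  · rintro ⟨y, z, rfl, rfl⟩
    refine ⟨?_, ?_⟩
    · rw [add_vecMul, vecMul_vecMul, δ_mul_δ, vecMul_zero, zero_add, vecMul_vecMul, γ_mul_δ,
        neg_vecMul, ← vecMul_vecMul]
      exact add_neg_cancel _
    · rw [neg_vecMul, neg_neg]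
      exact (vecMul_vecMul z (E.δ n) (E.δ' n)).trans (by rw [δ_mul_δ', vecMul_zero])

/-- The mapping cone as a resolution of `Y`. -/
def cone : FreeRes S Y where
  ι n := E.P.ι n ⊕ E.P.pι n
  d n := E.coneD n
  ε := Sum.elim E.ε (Empty.elim ·)
  surj y := by
    obtain ⟨v, hv⟩ := E.surj y
    refine ⟨Sum.elim v 0, ?_⟩
    rw [Fintype.sum_sum_type, sum_pι_zero, add_zero]
    exact hv
  exact_zero v := by
    rw [Fintype.sum_sum_type, sum_pι_zero, add_zero]
    refine (E.ker (v ∘ Sum.inl)).trans ⟨?_, ?_⟩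
    · rintro ⟨w, z, h⟩
      refine ⟨Sum.elim w z, (E.vecMul_coneD 0 w z).trans ?_⟩
      funext i
      obtain i | i := i
      · rw [Sum.elim_inl, γ_zero]
        refine .trans ?_ (congrFun h i)
        rw [Pi.add_apply, Pi.add_apply, vecMul_diagonal]
      · exact Empty.elim i
    · rintro ⟨w, rfl⟩
      refine ⟨w ∘ Sum.inl, w ∘ Sum.inr, ?_⟩
      rw [← Sum.elim_comp_inl_inr w]
      refine .trans ?_ (congrArg (· ∘ Sum.inl) (E.vecMul_coneD 0 (w ∘ Sum.inl) (w ∘ Sum.inr))).symm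
      rw [γ_zero]
      funext i
      simp only [Function.comp_apply, Sum.elim_inl, Pi.add_apply]
      rw [vecMul_diagonal]
      rfl
  exact_succ n v := by
    change E.P.ι (n + 1) ⊕ E.P.ι n → S at v
    have key : ∀ {N : ℕ} (v : E.P.ι (N + 1) ⊕ E.P.ι N → S),
        Sum.elim (fun i ↦ v (Sum.inl i)) (fun i ↦ v (Sum.inr i)) = v := fun v ↦ by
      funext i
      cases i <;> rfl
    have := E.coneD_exact n (fun i ↦ v (Sum.inl i)) (fun i ↦ v (Sum.inr i))
    rw [key] at this
    refine this.trans ⟨?_, ?_⟩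
    · rintro ⟨y, z, h⟩
      exact ⟨Sum.elim y z, h⟩
    · rintro ⟨w, h⟩
      exact ⟨fun i ↦ w (Sum.inl i), fun i ↦ w (Sum.inr i),
        (congrArg (· ᵥ* E.coneD (n + 1)) (key (N := n + 1) w)).trans h⟩

end ConeData

end Cone

/-! ### Comparison of `Ext` groups -/

section Comparison

universe u

open Matrix CategoryTheory Abelian

/-- The right action of `R` on `Ext^i(X, R)`. -/
noncomputable def extMul {R : Type u} [Ring R] {M : ModuleCat.{u} R} {i : ℕ}
    (x : Ext M (ModuleCat.of R R) i) (r : R) : Ext M (ModuleCat.of R R) i :=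
  x.comp (Ext.mk₀ (ModuleCat.ofHom (LinearMap.toSpanSingleton R R r))) (add_zero i)

section extMul

variable {R : Type u} [Ring R] {M : ModuleCat.{u} R} {i : ℕ}

theorem add_extMul (x y : Ext M (ModuleCat.of R R) i) (r : R) :
    extMul (x + y) r = extMul x r + extMul y r := by
  simp [extMul]

theorem zero_extMul (r : R) : extMul (0 : Ext M (ModuleCat.of R R) i) r = 0 := by
  simp [extMul]

theorem extMul_add (x : Ext M (ModuleCat.of R R) i) (r s : R) :
    extMul x (r + s) = extMul x r + extMul x s := by
  rw [extMul, extMul, extMul, ← Ext.comp_add, ← Ext.mk₀_add]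
  congr 2
  ext
  simp [LinearMap.toSpanSingleton]

theorem extMul_one (x : Ext M (ModuleCat.of R R) i) : extMul x 1 = x := by
  have : LinearMap.toSpanSingleton R R 1 = LinearMap.id := by ext; simp
  rw [extMul, this]
  exact Ext.comp_mk₀_id x

theorem extMul_mul (x : Ext M (ModuleCat.of R R) i) (r s : R) :
    extMul x (r * s) = extMul (extMul x r) s := by
  rw [extMul, extMul, extMul, Ext.comp_assoc_of_third_deg_zero, Ext.mk₀_comp_mk₀]
  congr 2
  ext
  simp [LinearMap.toSpanSingleton]

end extMul

namespace FreeRes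

variable {R : Type u} [Ring R] {X : Type u} [AddCommGroup X] [Module R X] (P : FreeRes R X)

/-- The group of cocycles. -/
def Z (n : ℕ) : AddSubgroup (P.ι n → R) where
  carrier := {f | P.d n *ᵥ f = 0}
  zero_mem' := mulVec_zero _
  add_mem' {_ _} hf hg := by
    change _ = _ at hf hg ⊢
    rw [mulVec_add, hf, hg, add_zero]
  neg_mem' {f} hf := by
    change _ = _ at hf ⊢
    rw [mulVec_neg, hf, neg_zero]

/-- The classes of cocycles. -/
noncomputable def cl (n : ℕ) : P.Z n →+ Ext (ModuleCat.of R X) (ModuleCat.of R R) n where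
  toFun f := P.cls n f.1 f.2
  map_zero' := (P.cls_eq_zero_iff (mulVec_zero _)).2 ⟨0, mulVec_zero _⟩
  map_add' f g := P.cls_add f.1 g.1 f.2 g.2

theorem cl_surjective (n : ℕ) : Function.Surjective (P.cl n) := fun x ↦ by
  obtain ⟨f, hf, h⟩ := P.cls_surjective x
  exact ⟨⟨f, hf⟩, h⟩

theorem cl_eq_zero_iff {n : ℕ} (f : P.Z n) : P.cl n f = 0 ↔ ∃ h, P.pd n *ᵥ h = f :=
  P.cls_eq_zero_iff f.2

/-- The right action on cocycles. -/
def zMul {n : ℕ} (f : P.Z n) (r : R) : P.Z n :=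
  ⟨fun i ↦ f.1 i * r, by
    change _ = _
    rw [mulVec_mul_right, show P.d n *ᵥ f.1 = 0 from f.2]
    funext i
    exact zero_mul r⟩

theorem cl_zMul {n : ℕ} (f : P.Z n) (r : R) : P.cl n (P.zMul f r) = extMul (P.cl n f) r :=
  (P.cls_comp f.1 f.2 r).symm

end FreeRes

namespace ConeData

variable {R S : Type u} [Ring R] [Ring S] {X Y : Type u} [AddCommGroup X] [Module R X]
    [AddCommGroup Y] [Module S Y] (E : ConeData R S X Y)

/-- Cocycles with coefficients in `S`. -/
def ZS (n : ℕ) : AddSubgroup (E.P.ι n → S) where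
  carrier := {f | E.δ n *ᵥ f = 0}
  zero_mem' := mulVec_zero _
  add_mem' {_ _} hf hg := by
    change _ = _ at hf hg ⊢
    rw [mulVec_add, hf, hg, add_zero]
  neg_mem' {f} hf := by
    change _ = _ at hf ⊢
    rw [mulVec_neg, hf, neg_zero]

theorem elim_zero_mem {n : ℕ} (h : E.ZS n) : (Sum.elim 0 h.1 : E.P.ι (n + 1) ⊕ E.P.ι n → S) ∈
    E.cone.Z (n + 1) := by
  refine (E.coneD_mulVec (n + 1) 0 h.1).trans ?_
  rw [mulVec_zero, mulVec_zero, zero_sub]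
  have : E.δ' (n + 1) *ᵥ h.1 = 0 := h.2
  rw [this, neg_zero]
  funext i
  cases i <;> rfl

/-- A cocycle with coefficients in `S` as a cocycle of the cone. -/
def coneZ (n : ℕ) : E.ZS n →+ E.cone.Z (n + 1) where
  toFun h := ⟨_, E.elim_zero_mem h⟩
  map_zero' := Subtype.ext (funext fun i ↦ by cases i <;> rfl)
  map_add' f g := Subtype.ext (funext fun i ↦ by
    obtain i | i := i
    · exact (add_zero 0).symm
    · rfl)

/-- The connecting map from cocycles with coefficients in `S`. -/
noncomputable def K (n : ℕ) : E.ZS n →+ Ext (ModuleCat.of S Y) (ModuleCat.of S S) (n + 1) :=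
  (E.cone.cl (n + 1)).comp (E.coneZ n)

theorem K_apply {n : ℕ} (h : E.ZS n) : E.K n h = E.cone.cl (n + 1) (E.coneZ n h) := rfl

/-- Coboundaries of the cone with vanishing first component: `K` kills exactly the image of `γ` on
cocycles together with the coboundaries. -/
theorem K_eq_zero_iff {n : ℕ} (h : E.ZS n) : E.K n h = 0 ↔
    ∃ (f : E.P.ι n → S) (k : E.P.pι n → S), E.δ n *ᵥ f = 0 ∧ E.γ n *ᵥ f - E.δ' n *ᵥ k = h := by
  refine (E.cone.cl_eq_zero_iff _).trans ⟨?_, ?_⟩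
  · rintro ⟨f, hf⟩
    change E.P.ι n ⊕ E.P.pι n → S at f
    change E.coneD n *ᵥ f = Sum.elim (0 : E.P.ι (n + 1) → S) h.1 at hf
    rw [← Sum.elim_comp_inl_inr f, coneD_mulVec] at hf
    exact ⟨_, _, elim_eq_elim_iff.1 hf⟩
  · rintro ⟨f, k, h1, h2⟩
    refine ⟨Sum.elim f k, (E.coneD_mulVec n f k).trans ?_⟩
    rw [h1, h2]
    rfl

/-- The right action on cocycles with coefficients in `S`. -/
def zsMul {n : ℕ} (f : E.ZS n) (r : S) : E.ZS n :=
  ⟨fun i ↦ f.1 i * r, by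
    change _ = _
    rw [FreeRes.mulVec_mul_right, show E.δ n *ᵥ f.1 = 0 from f.2]
    funext i
    exact zero_mul r⟩

theorem K_zsMul {n : ℕ} (f : E.ZS n) (r : S) : E.K n (E.zsMul f r) = extMul (E.K n f) r := by
  rw [K_apply, K_apply, ← FreeRes.cl_zMul]
  refine congrArg _ (Subtype.ext (funext fun i ↦ ?_))
  obtain i | i := i
  · exact (zero_mul r).symm
  · rfl

/-- The inclusion of cocycles. -/
def zι (n : ℕ) : E.P.Z n →+ E.ZS n where
  toFun z := ⟨fun i ↦ E.ι (z.1 i), by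
    change _ = _
    have : (fun i ↦ E.ι (z.1 i)) = E.ev (Finsupp.single 0 z.1) := by
      rw [TorusExt.ev_single, E.T_zero]; simp
    rw [this, TorusExt.ev_mulVec, Finsupp.mapRange_single, show E.P.d n *ᵥ z.1 = 0 from z.2]
    simp⟩
  map_zero' := Subtype.ext (funext fun i ↦ map_zero E.ι)
  map_add' _ _ := Subtype.ext (funext fun i ↦ map_add E.ι _ _)

/-- Carrying `u` through a coefficient twists it; the monomials commute with each other, so the
freed `u` adds `(1, -1)` to the exponent. -/
theorem u_mulVec_ev {n : ℕ} (F : ℤ × ℤ →₀ (E.P.ι n → R)) :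
    (E.θ n).map (fun r ↦ E.u * E.ι r) *ᵥ E.ev F =
      E.ev ((F.mapRange (FreeRes.tw (E.ω (1, -1)) (E.θ n)) (FreeRes.tw_zero _ _)).mapDomain
        (· + (1, -1))) := by
  induction F using Finsupp.induction_linear with
  | zero => simp
  | add F G hF hG =>
    rw [Finsupp.mapRange_add (FreeRes.tw_add _ _), Finsupp.mapDomain_add,
      map_add, map_add, mulVec_add, hF, hG]
  | single g r =>
    rw [Finsupp.mapRange_single, Finsupp.mapDomain_single, TorusExt.ev_single,
      TorusExt.ev_single, FreeRes.mulVec_mul_right]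
    funext i
    rw [add_comm g, E.T_add, ← mul_assoc, FreeRes.tw, ← E.T_mul]
    congr 1
    simp only [mulVec, dotProduct, map_apply, map_sum, map_mul, Finset.mul_sum, mul_assoc]

theorem γ_mulVec_ev {n : ℕ} (F : ℤ × ℤ →₀ (E.P.ι n → R)) :
    E.γ n *ᵥ E.ev F =
      E.ev ((F.mapRange (FreeRes.tw (E.ω (1, -1)) (E.θ n)) (FreeRes.tw_zero _ _)).mapDomain
        (· + (1, -1)) - F) := by
  rw [γ, sub_mulVec, u_mulVec_ev, one_mulVec, map_sub]

theorem mulVec_coeff_eq_zero {n : ℕ} {F : ℤ × ℤ →₀ (E.P.ι n → R)} (h : E.δ n *ᵥ E.ev F = 0)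
    (g : ℤ × ℤ) : E.P.d n *ᵥ F g = 0 := by
  rw [TorusExt.ev_mulVec] at h
  exact DFunLike.congr_fun ((injective_iff_map_eq_zero _).1 E.ev_injective _ h) g

theorem coeff_of_γ_mulVec {n : ℕ} {F W : ℤ × ℤ →₀ (E.P.ι n → R)} {H : ℤ × ℤ →₀ (E.P.pι n → R)}
    (h : E.γ n *ᵥ E.ev F - E.δ' n *ᵥ E.ev H = E.ev W) (g : ℤ × ℤ) :
    FreeRes.tw (E.ω (1, -1)) (E.θ n) (F (g - (1, -1))) - F g - E.P.pd n *ᵥ H g = W g := by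
  rw [TorusExt.ev_mulVec, γ_mulVec_ev, ← map_sub] at h
  have := DFunLike.congr_fun (E.ev_injective h) g
  rw [Finsupp.sub_apply, Finsupp.sub_apply, mapDomain_shift_apply] at this
  exact this

/-- Invariant cocycles are coboundaries. -/
theorem exists_δ'_eq {n : ℕ} {F : ℤ × ℤ →₀ (E.P.ι n → R)} {H : ℤ × ℤ →₀ (E.P.pι n → R)}
    (h : E.γ n *ᵥ E.ev F = E.δ' n *ᵥ E.ev H) :
    ∃ Y, E.δ' n *ᵥ E.ev Y = E.ev F := by
  have h1 := E.coeff_of_γ_mulVec (F := F) (H := H) (W := 0) (by rw [h, sub_self, map_zero])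
  have h2 : ∀ g, ∃ y, E.P.pd n *ᵥ y = F g := by
    refine TorusExt.induction_shift F (e := (1, -1)) (by simp) ?_ ?_
    · intro g hg
      exact ⟨0, by rw [hg, mulVec_zero]⟩
    · intro g hg
      obtain ⟨y, hy⟩ := E.P.exists_pd_tw E.θ_succ hg
      refine ⟨y - H g, ?_⟩
      rw [mulVec_sub, hy, ← sub_eq_zero, sub_right_comm]
      exact h1 g
  obtain ⟨Y, hY⟩ := TorusExt.exists_mapRange_eq (mulVec_zero (E.P.pd n)) F h2
  exact ⟨Y, by rw [TorusExt.ev_mulVec, hY]⟩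

theorem exists_ev_pair {n m : Type} [Finite n] [Finite m] (f : n → S) (h : m → S) :
    ∃ c ∈ E.C, ∃ F H, E.ev F = (fun i ↦ f i * c) ∧ E.ev H = fun i ↦ h i * c := by
  obtain ⟨c, hc, F, hF⟩ := E.exists_ev_right (Sum.elim f h)
  have key : ∀ {n m : Type} (F : ℤ × ℤ →₀ (n → R)) (f : m → n),
      E.ev (F.mapRange (fun x i ↦ x (f i)) rfl) = fun i ↦ E.ev F (f i) := by
    intro n m F f
    induction F using Finsupp.induction_linear with
    | zero => simp; rfl
    | add F G hF hG =>
      rw [Finsupp.mapRange_add (fun _ _ ↦ rfl), map_add, map_add, hF, hG]; rfl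
    | single g r => rw [Finsupp.mapRange_single, TorusExt.ev_single, TorusExt.ev_single]
  exact ⟨c, hc, _, _, (key F Sum.inl).trans (by rw [hF]; rfl),
    (key F Sum.inr).trans (by rw [hF]; rfl)⟩

theorem mul_right_cancel_vec {n : Type*} {f : n → S} {c : S} (hc : c ∈ E.C)
    (h : (fun i ↦ f i * c) = 0) : f = 0 :=
  funext fun i ↦ (E.isUnit c hc).mul_left_eq_zero.1 (congrFun h i)

/-- A cocycle of degree zero is invariant under `uθ`. After clearing denominators its finite support
must be invariant under a nontrivial shift up to coboundaries, of which there are none but zero. -/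
theorem ext_zero_eq_zero (E : ConeData R S X Y) (y : Ext (ModuleCat.of S Y) (ModuleCat.of S S) 0) : y = 0 := by
  obtain ⟨⟨v, hv⟩, rfl⟩ := FreeRes.cl_surjective E.cone 0 y
  refine (E.cone.cl_eq_zero_iff _).2 (FreeRes.exists_pd_zero_iff _ |>.2 ?_)
  change E.P.ι 0 ⊕ E.P.pι 0 → S at v
  change E.coneD 0 *ᵥ v = 0 at hv
  rw [← Sum.elim_comp_inl_inr v, coneD_mulVec] at hv
  set f := v ∘ Sum.inl with hf
  have hγ : E.γ 0 *ᵥ f = E.δ' 0 *ᵥ (v ∘ Sum.inr) := sub_eq_zero.1 (congrArg (· ∘ Sum.inr) hv)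
  obtain ⟨c, hc, F, H, hF, hH⟩ := E.exists_ev_pair f (v ∘ Sum.inr)
  obtain ⟨Y, hY⟩ := E.exists_δ'_eq (F := F) (H := H) (by
    rw [hF, hH, FreeRes.mulVec_mul_right, FreeRes.mulVec_mul_right, hγ])
  have hY0 : E.ev Y = 0 := funext fun e ↦ Empty.elim e
  rw [hY0, mulVec_zero, hF] at hY
  have := E.mul_right_cancel_vec hc hY.symm
  funext i
  obtain i | i := i
  · exact congrFun this i
  · exact Empty.elim i

/-- The connecting map. -/
noncomputable def j (n : ℕ) : Ext (ModuleCat.of R X) (ModuleCat.of R R) n →+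
    Ext (ModuleCat.of S Y) (ModuleCat.of S S) (n + 1) :=
  (E.P.cl n).liftOfSurjective (E.P.cl_surjective n) ⟨(E.K n).comp (E.zι n), fun z hz ↦ by
    obtain ⟨h, hh⟩ := (E.P.cl_eq_zero_iff z).1 hz
    refine (E.K_eq_zero_iff _).2 ⟨0, fun i ↦ -E.ι (h i), mulVec_zero _, ?_⟩
    have h1 : (fun i ↦ -E.ι (h i)) = E.ev (Finsupp.single 0 (-h)) := by
      rw [TorusExt.ev_single, E.T_zero]; simp
    rw [mulVec_zero, zero_sub, h1, TorusExt.ev_mulVec, Finsupp.mapRange_single, mulVec_neg, hh,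
      TorusExt.ev_single, E.T_zero]
    funext i
    simp [zι]⟩

theorem j_cl {n : ℕ} (z : E.P.Z n) : E.j n (E.P.cl n z) = E.K n (E.zι n z) :=
  AddMonoidHom.liftOfRightInverse_comp_apply _ _ _ _ _

theorem j_extMul {n : ℕ} (x : Ext (ModuleCat.of R X) (ModuleCat.of R R) n) (r : R) :
    E.j n (extMul x r) = extMul (E.j n x) (E.ι r) := by
  obtain ⟨z, rfl⟩ := E.P.cl_surjective n x
  rw [← FreeRes.cl_zMul, j_cl, j_cl, ← K_zsMul]
  congr 1
  exact Subtype.ext (funext fun i ↦ map_mul E.ι _ _)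

/-- The action of the automorphism on cocycles. -/
def zTw (n : ℕ) : E.P.Z n →+ E.P.Z n where
  toFun z := ⟨FreeRes.tw (E.ω (1, -1)) (E.θ n) z.1, by
    change _ = _
    rw [E.P.d_mulVec_tw E.θ_succ, show E.P.d n *ᵥ z.1 = 0 from z.2, FreeRes.tw_zero]⟩
  map_zero' := Subtype.ext (FreeRes.tw_zero _ _)
  map_add' _ _ := Subtype.ext (FreeRes.tw_add _ _ _ _)

/-- The automorphism of `Ext`, as a homomorphism. -/
noncomputable def φ (n : ℕ) : Ext (ModuleCat.of R X) (ModuleCat.of R R) n →+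
    Ext (ModuleCat.of R X) (ModuleCat.of R R) n :=
  (E.P.cl n).liftOfSurjective (E.P.cl_surjective n) ⟨(E.P.cl n).comp (E.zTw n), fun z hz ↦
    (E.P.cl_eq_zero_iff _).2 (E.P.exists_pd_tw E.θ_succ ((E.P.cl_eq_zero_iff z).1 hz))⟩

theorem φ_cl {n : ℕ} (z : E.P.Z n) : E.φ n (E.P.cl n z) = E.P.cl n (E.zTw n z) :=
  AddMonoidHom.liftOfRightInverse_comp_apply _ _ _ _ _

/-- The semilinear map built from `θ'` is an inverse up to coboundaries. -/
theorem φ_bijective (n : ℕ) : Function.Bijective (E.φ n) := by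
  constructor
  · rw [injective_iff_map_eq_zero]
    intro x hx
    obtain ⟨z, rfl⟩ := E.P.cl_surjective n x
    rw [φ_cl, FreeRes.cl_eq_zero_iff] at hx
    have h1 := E.P.exists_pd_tw (ω := (E.ω (1, -1)).symm) (θ := E.θ') E.θ'_succ hx
    obtain ⟨y, hy⟩ := h1
    obtain ⟨y', hy'⟩ := E.P.exists_pd_tw_tw E.θ_zero E.θ_succ E.θ'_zero E.θ'_succ z.2
    refine (E.P.cl_eq_zero_iff z).2 ⟨y - y', ?_⟩
    rw [mulVec_sub, hy, hy']
    exact sub_sub_cancel _ _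
  · intro x
    obtain ⟨z, rfl⟩ := E.P.cl_surjective n x
    let z' : E.P.Z n := ⟨FreeRes.tw (E.ω (1, -1)).symm (E.θ' n) z.1, by
      change _ = _
      rw [E.P.d_mulVec_tw (ω := (E.ω (1, -1)).symm) E.θ'_succ, show E.P.d n *ᵥ z.1 = 0 from z.2,
        FreeRes.tw_zero]⟩
    refine ⟨E.P.cl n z', ?_⟩
    rw [φ_cl, ← sub_eq_zero, ← map_sub]
    exact (E.P.cl_eq_zero_iff _).2 (E.P.exists_pd_tw_tw (ω := (E.ω (1, -1)).symm) E.θ'_zero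
      E.θ'_succ E.θ_zero E.θ_succ z.2)

/-- For a cocycle `z` over `R`, the difference of the two representing cocycles is `γ` applied to
`z`, which the cone turns into a coboundary. -/
theorem extMul_j_φ {n : ℕ} (x : Ext (ModuleCat.of R X) (ModuleCat.of R R) n) :
    extMul (E.j n (E.φ n x)) E.u = E.j n x := by
  obtain ⟨z, rfl⟩ := E.P.cl_surjective n x
  rw [φ_cl, j_cl, j_cl, ← K_zsMul, ← sub_eq_zero, ← map_sub, K_eq_zero_iff]
  refine ⟨E.ev (Finsupp.single 0 z.1), 0, ?_, ?_⟩
  · rw [TorusExt.ev_mulVec, Finsupp.mapRange_single, show E.P.d n *ᵥ z.1 = 0 from z.2]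
    simp
  · rw [γ_mulVec_ev, mulVec_zero, sub_zero, Finsupp.mapRange_single, Finsupp.mapDomain_single,
      map_sub, TorusExt.ev_single, TorusExt.ev_single, zero_add, E.T_zero]
    simp only [mul_one]
    rfl

end ConeData

end Comparison

/-! ### `Ext` of the cone as a localized sum of translates -/

section Comparison

universe u

open Matrix CategoryTheory Abelian

namespace ConeData

variable {R S : Type u} [Ring R] [Ring S] {X Y : Type u} [AddCommGroup X] [Module R X]
    [AddCommGroup Y] [Module S Y] (E : ConeData R S X Y)

theorem K_ev {n : ℕ} (z : ℤ × ℤ →₀ E.P.Z n) :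
    ∃ h : E.ZS n, h.1 = E.ev (z.mapRange (fun x ↦ x.1) rfl) ∧
      E.K n h = z.sum fun g x ↦ extMul (E.j n (E.P.cl n x)) (E.T g) := by
  induction z using Finsupp.induction_linear with
  | zero => exact ⟨0, by simp, by simp⟩
  | add F G hF hG =>
    obtain ⟨h, h1, h2⟩ := hF
    obtain ⟨k, k1, k2⟩ := hG
    refine ⟨h + k, ?_, ?_⟩
    · rw [Finsupp.mapRange_add (fun _ _ ↦ rfl), map_add, ← h1, ← k1]; rfl
    · rw [map_add, h2, k2, Finsupp.sum_add_index (by simp [zero_extMul])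
        (by simp [add_extMul])]
  | single g x =>
    refine ⟨E.zsMul (E.zι n x) (E.T g), ?_, ?_⟩
    · rw [Finsupp.mapRange_single, TorusExt.ev_single]; rfl
    · rw [Finsupp.sum_single_index (by simp [zero_extMul]), K_zsMul, j_cl]

/-- Once denominators are cleared, the first component of a cocycle of the cone is invariant up to
coboundaries, hence a coboundary. Subtracting a coboundary of the cone leaves only a second
component, all of whose coefficients are cocycles over `R`. -/
theorem exists_extMul_eq_sum_pairs {n : ℕ} (y : Ext (ModuleCat.of S Y) (ModuleCat.of S S) (n + 1)) :
    ∃ c ∈ E.C, ∃ f : ℤ × ℤ →₀ Ext (ModuleCat.of R X) (ModuleCat.of R R) n,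
      extMul y c = f.sum fun g x ↦ extMul (E.j n x) (E.T g) := by
  obtain ⟨⟨v, hv⟩, rfl⟩ := FreeRes.cl_surjective E.cone (n + 1) y
  change E.P.ι (n + 1) ⊕ E.P.ι n → S at v
  have hv' : E.coneD (n + 1) *ᵥ Sum.elim (v ∘ Sum.inl) (v ∘ Sum.inr) = 0 := by
    refine (congrArg (E.coneD (n + 1) *ᵥ ·) ?_).trans hv
    funext i
    cases i <;> rfl
  have h0 := (E.coneD_mulVec (n + 1) _ _).symm.trans hv'
  have hγ : E.γ (n + 1) *ᵥ (v ∘ Sum.inl) = E.δ n *ᵥ (v ∘ Sum.inr) :=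
    sub_eq_zero.1 (congrArg (· ∘ Sum.inr) h0)
  obtain ⟨c, hc, F, H, hF, hH⟩ := E.exists_ev_pair (v ∘ Sum.inl) (v ∘ Sum.inr)
  obtain ⟨Y, hY⟩ := E.exists_δ'_eq (F := F) (H := H) (by
    rw [hF, FreeRes.mulVec_mul_right, hγ]
    refine .trans ?_ (congrArg (E.δ n *ᵥ ·) hH).symm
    exact (FreeRes.mulVec_mul_right _ _ _).symm)
  change ℤ × ℤ →₀ (E.P.ι n → R) at Y
  change E.δ n *ᵥ E.ev Y = _ at hY
  -- What remains of the second component after subtracting the cone coboundary of `(Y, 0)`, whose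
  -- second component is `γ Y`.
  let H' := H - ((Y.mapRange (FreeRes.tw (E.ω (1, -1)) (E.θ n)) (FreeRes.tw_zero _ _)).mapDomain
        (· + (1, -1)) - Y)
  have hH' : E.ev H' = (fun i ↦ v (Sum.inr i) * c) - E.γ n *ᵥ E.ev Y := by
    rw [map_sub, ← γ_mulVec_ev, hH]; rfl
  have hδ : E.δ n *ᵥ E.ev H' = 0 := by
    rw [hH', mulVec_sub, mulVec_mulVec, ← γ_mul_δ, ← mulVec_mulVec, hY, hF,
      FreeRes.mulVec_mul_right, FreeRes.mulVec_mul_right, hγ]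
    exact sub_self _
  obtain ⟨z, hz⟩ := TorusExt.exists_mapRange_eq (φ := fun x : E.P.Z n ↦ x.1) rfl H' fun g ↦
    ⟨⟨H' g, E.mulVec_coeff_eq_zero hδ g⟩, rfl⟩
  obtain ⟨h, h1, h2⟩ := E.K_ev z
  refine ⟨c, hc, z.mapRange (E.P.cl n) (map_zero _), ?_⟩
  rw [Finsupp.sum_mapRange_index (by simp [zero_extMul]), ← h2, ← FreeRes.cl_zMul, K_apply,
    ← sub_eq_zero, ← map_sub]
  refine (FreeRes.cl_eq_zero_iff _ _).2 ⟨Sum.elim (E.ev Y) (0 : E.P.pι n → S), ?_⟩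
  refine (E.coneD_mulVec n _ _).trans ?_
  rw [hY, mulVec_zero, sub_zero]
  funext i
  obtain i | i := i
  · rw [hF]
    exact (sub_zero _).symm
  · change (E.γ n *ᵥ E.ev Y) i = v (Sum.inr i) * c - h.1 i
    rw [h1, hz, hH']
    exact (sub_sub_cancel _ _).symm

/-- A power of `u` acts on the image of `j` through a power of `φ` or its inverse. -/
theorem exists_extMul_j_zsmul {n : ℕ} (a : ℤ) (x : Ext (ModuleCat.of R X) (ModuleCat.of R R) n) :
    ∃ x', extMul (E.j n x) (E.T (a • (1, -1))) = E.j n x' := by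
  induction a using Int.induction_on generalizing x with
  | zero => exact ⟨x, by rw [zero_smul, E.T_zero, extMul_one]⟩
  | succ a ih =>
    obtain ⟨x', rfl⟩ := (E.φ_bijective n).2 x
    obtain ⟨y, hy⟩ := ih x'
    refine ⟨y, ?_⟩
    rw [add_smul, one_smul, add_comm (_ • _) (1, -1), E.T_add, extMul_mul, extMul_j_φ, hy]
  | pred a ih =>
    obtain ⟨y, hy⟩ := ih (E.φ n x)
    refine ⟨y, ?_⟩
    rw [← hy, ← E.extMul_j_φ x, ← extMul_mul, ← E.T_add, sub_smul, one_smul, add_sub_cancel]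

theorem exists_extMul_eq_sum {n : ℕ} (y : Ext (ModuleCat.of S Y) (ModuleCat.of S S) (n + 1)) :
    ∃ c ∈ E.C, ∃ f : ℤ →₀ Ext (ModuleCat.of R X) (ModuleCat.of R R) n,
      extMul y c = f.sum fun a x ↦ extMul (E.j n x) (E.T (0, a)) := by
  obtain ⟨c, hc, f, hf⟩ := E.exists_extMul_eq_sum_pairs y
  refine ⟨c, hc, ?_⟩
  rw [hf]
  clear hf
  induction f using Finsupp.induction_linear with
  | zero => exact ⟨0, by simp⟩
  | add F G hF hG =>
    obtain ⟨f, hf⟩ := hF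
    obtain ⟨g, hg⟩ := hG
    refine ⟨f + g, ?_⟩
    rw [Finsupp.sum_add_index (by simp [zero_extMul]) (by simp [add_extMul]), hf, hg,
      Finsupp.sum_add_index (by simp [zero_extMul]) (by simp [add_extMul])]
  | single g x =>
    obtain ⟨x', hx'⟩ := E.exists_extMul_j_zsmul g.1 x
    -- Here `g = g.1 • (1, -1) + (0, g.1 + g.2)`, and the first summand is absorbed into the class.
    refine ⟨Finsupp.single (g.1 + g.2) x', ?_⟩
    rw [Finsupp.sum_single_index (by simp [zero_extMul]),
      Finsupp.sum_single_index (by simp [zero_extMul]), ← hx', ← extMul_mul, ← E.T_add]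
    congr 2
    ext <;> simp

/-- The equations between coefficients that express the vanishing of a sum of classes. -/
theorem exists_coeff_of_sum_eq_zero {n : ℕ}
    {f : ℤ →₀ Ext (ModuleCat.of R X) (ModuleCat.of R R) n}
    (hf : (f.sum fun a x ↦ extMul (E.j n x) (E.T (0, a))) = 0) :
    ∃ (p : ℤ × ℤ →₀ R) (g₀ : ℤ × ℤ)
      (x : ℤ × ℤ →₀ Ext (ModuleCat.of R X) (ModuleCat.of R R) n),
      p g₀ = 1 ∧ (∀ g, p g ≠ 0 → g ≤ g₀) ∧
      ∀ g, E.φ n (x (g - (1, -1))) - x g =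
        f.sum fun a y ↦ extMul y (E.ω (0, a) (p (g - (0, a)))) := by
  classical
  obtain ⟨z, rfl⟩ : ∃ z : ℤ →₀ E.P.Z n, z.mapRange (E.P.cl n) (map_zero _) = f :=
    Finsupp.mapRange_surjective _ (map_zero _) (E.P.cl_surjective n) f
  rw [Finsupp.sum_mapRange_index (by simp [zero_extMul])] at hf
  obtain ⟨h, h1, h2⟩ := E.K_ev (z.mapDomain fun a ↦ (0, a))
  rw [Finsupp.sum_mapDomain_index (by simp [zero_extMul]) (by simp [add_extMul]), hf,
    K_eq_zero_iff] at h2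
  obtain ⟨f, k, hf, hk⟩ := h2
  obtain ⟨c, hc, F, H, hF, hH⟩ := E.exists_ev_pair f k
  obtain ⟨p, g₀, hp, hp1, hp2⟩ := E.monic c hc
  -- The expansion of `h * c`: the coefficients of `c` are moved to the left across the monomials of
  -- `h`.
  let W : ℤ × ℤ →₀ E.P.Z n := z.sum fun a x ↦ p.sum fun g r ↦
    Finsupp.single ((0, a) + g) (E.P.zMul x (E.ω (0, a) r))
  have hW : E.ev (W.mapRange (fun x ↦ x.1) rfl) = fun i ↦ h.1 i * c := by
    let ev' : (ℤ × ℤ →₀ E.P.Z n) →+ (E.P.ι n → S) :=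
      E.ev.comp (Finsupp.mapRange.addMonoidHom (E.P.Z n).subtype)
    let ev'' : (E.P.ι n → S) →+ (E.P.ι n → S) :=
      { toFun := fun v i ↦ v i * c
        map_zero' := by funext i; simp
        map_add' := fun v w ↦ by funext i; simp [add_mul] }
    change ev' W = ev'' h.1
    have h1' : h.1 = ev' (z.mapDomain fun a ↦ (0, a)) := h1
    rw [h1', Finsupp.mapDomain]
    rw [map_finsuppSum, map_finsuppSum, map_finsuppSum]
    refine Finsupp.sum_congr fun a _ ↦ ?_
    rw [map_finsuppSum]
    have e1 : ∀ g x, ev' (Finsupp.single g x) = fun i ↦ E.ι (x.1 i) * E.T g := by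
      intro g x
      change E.ev (Finsupp.mapRange _ (map_zero (E.P.Z n).subtype) _) = _
      rw [Finsupp.mapRange_single, TorusExt.ev_single]
      rfl
    simp only [e1]
    funext i
    change _ = _ * c
    rw [← hp, Finsupp.mul_sum, Finsupp.sum, Finset.sum_apply]
    refine Finset.sum_congr rfl fun g _ ↦ ?_
    change E.ι (_ * _) * _ = E.ι _ * E.T (0, a) * (E.ι _ * E.T g)
    rw [E.T_add, map_mul, mul_assoc, mul_assoc, ← mul_assoc _ (E.T (0, a)), ← E.T_mul,
      ← mul_assoc (E.T _)]
  have hγ := E.coeff_of_γ_mulVec (F := F) (W := W.mapRange (fun x ↦ x.1) rfl) (H := H) (by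
    rw [hF, hH, hW, FreeRes.mulVec_mul_right, FreeRes.mulVec_mul_right, ← hk]
    funext i
    exact (sub_mul _ _ _).symm)
  have hF0 : E.δ n *ᵥ E.ev F = 0 := by
    rw [hF, FreeRes.mulVec_mul_right, hf]
    funext i
    exact zero_mul c
  obtain ⟨x, rfl⟩ := TorusExt.exists_mapRange_eq (φ := fun x : E.P.Z n ↦ x.1) rfl F fun g ↦
    ⟨⟨F g, E.mulVec_coeff_eq_zero hF0 g⟩, rfl⟩
  refine ⟨p, g₀, x.mapRange (E.P.cl n) (map_zero _), hp1, hp2, fun g ↦ ?_⟩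
  have h3 : E.P.cl n (E.zTw n (x (g - (1, -1))) - x g - W g) = 0 :=
    (E.P.cl_eq_zero_iff _).2 ⟨H g, by
      have := hγ g
      rw [sub_eq_iff_eq_add, add_comm, ← sub_eq_iff_eq_add] at this
      exact this.symm⟩
  rw [map_sub, sub_eq_zero, map_sub, ← φ_cl] at h3
  refine h3.trans ?_
  rw [Finsupp.sum_mapRange_index (by simp [zero_extMul])]
  have e2 : E.P.cl n (W g) = ((E.P.cl n).comp (Finsupp.applyAddHom g)) W := rfl
  rw [e2, map_finsuppSum]
  refine Finsupp.sum_congr fun a _ ↦ ?_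
  rw [map_finsuppSum, ← FreeRes.cl_zMul]
  change (p.sum fun g' r ↦ E.P.cl n (Finsupp.single ((0, a) + g') _ g)) = _
  have e3 : ∀ (s : Finset (ℤ × ℤ)), (∀ g ∉ s, p g = 0) → ∀ g, ∑ g' ∈ s,
      E.P.cl n (Finsupp.single ((0, a) + g') (E.P.zMul (z a) (E.ω (0, a) (p g'))) g) =
      E.P.cl n (E.P.zMul (z a) (E.ω (0, a) (p (g - (0, a))))) := by
    intro s hs g
    rw [Finset.sum_eq_single (g - (0, a))]
    · rw [add_sub_cancel, Finsupp.single_eq_same]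
    · intro g' _ hg'
      rw [Finsupp.single_eq_of_ne, map_zero]
      rintro rfl
      exact hg' (by simp)
    · intro hg'
      rw [add_sub_cancel, Finsupp.single_eq_same, hs _ hg', map_zero, FreeRes.cl_zMul]
      simp [extMul]
  exact e3 p.support (fun g hg ↦ Finsupp.notMem_support_iff.1 hg) g

/-- Let `a₀` be the largest exponent of `f` and `g₀` the leading exponent of the monic denominator.
On the line through `g₀ + (0, a₀)` in direction `(1, -1)` the right side of the coefficient
equations is `f a₀` at one point and zero elsewhere. The unknown `x` has finite support, so the
recursion makes it vanish from both ends, and `f a₀ = 0` follows. -/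
theorem eq_zero_of_sum_eq_zero {n : ℕ}
    {f : ℤ →₀ Ext (ModuleCat.of R X) (ModuleCat.of R R) n}
    (hf : (f.sum fun a x ↦ extMul (E.j n x) (E.T (0, a))) = 0) : f = 0 := by
  classical
  by_contra hne
  obtain ⟨p, g₀, x, hp1, hp2, hx⟩ := E.exists_coeff_of_sum_eq_zero hf
  have hsupp : f.support.Nonempty := Finsupp.support_nonempty_iff.2 hne
  set a₀ := f.support.max' hsupp with ha₀
  -- Only the leading coefficient of the denominator can contribute: it dominates in both
  -- coordinates, and any move along `(1, -1)` raises one of them.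
  have key : ∀ m : ℤ, E.φ n (x (g₀ + (0, a₀) + m • (1, -1) - (1, -1))) -
      x (g₀ + (0, a₀) + m • (1, -1)) = if m = 0 then f a₀ else 0 := by
    intro m
    rw [hx, Finsupp.sum, Finset.sum_eq_single a₀]
    · split_ifs with hm
      · rw [hm, zero_smul, add_zero, add_sub_cancel_right, hp1, map_one, extMul_one]
      · have : p (g₀ + (0, a₀) + m • (1, -1) - (0, a₀)) = 0 := by
          by_contra hp
          have := hp2 _ hp
          simp only [Prod.le_def, Prod.fst_sub, Prod.snd_sub, Prod.fst_add, Prod.snd_add,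
            Prod.smul_fst, Prod.smul_snd, smul_eq_mul] at this
          omega
        rw [this, map_zero]
        simp [extMul]
    · intro a ha hne
      have hle : a ≤ a₀ := Finset.le_max' _ _ ha
      have : p (g₀ + (0, a₀) + m • (1, -1) - (0, a)) = 0 := by
        by_contra hp
        have := hp2 _ hp
        simp only [Prod.le_def, Prod.fst_sub, Prod.snd_sub, Prod.fst_add, Prod.snd_add,
          Prod.smul_fst, Prod.smul_snd, smul_eq_mul] at this
        omega
      rw [this, map_zero]
      simp [extMul]
    · intro h
      rw [Finsupp.notMem_support_iff.1 h, zero_extMul]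
  -- Vanishing spreads in direction `(1, -1)`, since `φ` maps zero to zero.
  have hz : ∀ m : ℤ, m < 0 → x (g₀ + (0, a₀) + m • (1, -1)) = 0 := by
    have step : ∀ (N : ℕ) (m : ℤ), m < 0 → x (g₀ + (0, a₀) + m • (1, -1) - N • (1, -1)) = 0 →
        x (g₀ + (0, a₀) + m • (1, -1)) = 0 := by
      intro N
      induction N with
      | zero => intro m _ h; simpa using h
      | succ N ih =>
        intro m hm h
        have h1 := ih (m - 1) (by omega) (by
          rw [← h, succ_nsmul', sub_smul, one_smul]; congr 1; abel)
        have h2 := key m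
        rw [if_neg hm.ne, show g₀ + (0, a₀) + m • (1, -1) - (1, -1) =
          g₀ + (0, a₀) + (m - 1) • (1, -1) by rw [sub_smul, one_smul]; abel, h1, map_zero,
          zero_sub, neg_eq_zero] at h2
        exact h2
    intro m hm
    obtain ⟨N, hN⟩ := TorusExt.exists_shift_eq_zero x (e := (1, -1)) (by simp)
      (g₀ + (0, a₀) + m • (1, -1))
    exact step N m hm hN
  -- From the other end vanishing spreads backwards, by injectivity of `φ`.
  have h0 : x (g₀ + (0, a₀)) = 0 := by
    obtain ⟨N, hN⟩ := TorusExt.exists_shift_eq_zero x (e := -(1, -1)) (by simp) (g₀ + (0, a₀))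
    rw [smul_neg, sub_neg_eq_add] at hN
    induction N with
    | zero => simpa using hN
    | succ N ih =>
      apply ih
      have h2 := key (N + 1)
      have e1 : g₀ + (0, a₀) + ((N : ℤ) + 1) • (1, -1) = g₀ + (0, a₀) + (N + 1) • (1, -1) := by
        rw [add_smul, add_smul, one_smul, one_smul, natCast_zsmul]
      have e2 : g₀ + (0, a₀) + (N + 1) • (1, -1) - (1, -1) = g₀ + (0, a₀) + N • (1, -1) := by
        rw [add_smul, one_smul]; abel
      rw [if_neg (by omega), e1, e2, hN, sub_zero] at h2
      exact (injective_iff_map_eq_zero _).1 (E.φ_bijective n).1 _ h2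
  have h1 := key 0
  rw [if_pos rfl, zero_smul, add_zero, h0, sub_zero, show g₀ + (0, a₀) - (1, -1) =
    g₀ + (0, a₀) + (-1 : ℤ) • (1, -1) by rw [neg_one_smul, sub_eq_add_neg],
    hz _ (by omega), map_zero] at h1
  exact Finsupp.mem_support_iff.1 (Finset.max'_mem _ hsupp) h1.symm

end ConeData

end Comparison

/-! ### Extensions of algebras by one unit -/

section SkewExtension

universe v u

open TensorProduct MulOpposite

/-- `A` is an Ore localization of the skew Laurent extension of the `k`-algebra `D` by the unit `t`,
which normalizes `D`; `C` is a set of denominators, whose elements are monic polynomials. -/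
structure SkewExt (k : Type v) (D A : Type u) [Field k] [Ring D] [Algebra k D] [Ring A]
    [Algebra k A] where
  /-- the inclusion -/
  ι : D →ₐ[k] A
  /-- the automorphism induced by `t` -/
  α : D ≃ₐ[k] D
  /-- the variable -/
  t : Aˣ
  /-- the denominators -/
  C : Submonoid A
  t_mul : ∀ d, t * ι d = ι (α d) * t
  indep : ∀ f : ℤ →₀ D, (f.sum fun a d ↦ ι d * (t ^ a : Aˣ)) = 0 → f = 0
  isUnit : ∀ c ∈ C, IsUnit c
  monic : ∀ c ∈ C, ∃ (f : ℤ →₀ D) (a₀ : ℤ), (f.sum fun a d ↦ ι d * (t ^ a : Aˣ)) = c ∧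
    f a₀ = 1 ∧ ∀ a, f a ≠ 0 → a ≤ a₀
  den_left : ∀ x, ∃ c ∈ C, ∃ f : ℤ →₀ D, (f.sum fun a d ↦ ι d * (t ^ a : Aˣ)) = c * x
  den_right : ∀ x, ∃ c ∈ C, ∃ f : ℤ →₀ D, (f.sum fun a d ↦ ι d * (t ^ a : Aˣ)) = x * c

namespace SkewExt

variable {k : Type v} {D A : Type u} [Field k] [Ring D] [Algebra k D] [Ring A] [Algebra k A]
  (E : SkewExt k D A)

theorem zpow_mul (a : ℤ) (d : D) : (E.t ^ a : Aˣ) * E.ι d = E.ι ((E.α ^ a) d) * (E.t ^ a : Aˣ) := by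
  induction a using Int.induction_on generalizing d with
  | zero => simp
  | succ n ih =>
    rw [zpow_add_one, zpow_add_one, Units.val_mul, mul_assoc, E.t_mul, ← mul_assoc, ih,
      mul_assoc]
    rfl
  | pred n ih =>
    have h : (↑E.t⁻¹ : A) * E.ι d = E.ι (E.α⁻¹ d) * ↑E.t⁻¹ := by
      rw [Units.inv_mul_eq_iff_eq_mul, ← mul_assoc, E.t_mul, mul_assoc, Units.mul_inv, mul_one]
      exact congrArg E.ι (E.α.apply_symm_apply d).symm
    rw [zpow_sub_one, zpow_sub_one, Units.val_mul, mul_assoc, h, ← mul_assoc, ih, mul_assoc]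
    rfl

theorem mul_zpow (a : ℤ) (d : D) :
    E.ι d * (E.t ^ a : Aˣ) = (E.t ^ a : Aˣ) * E.ι ((E.α ^ (-a)) d) := by
  rw [zpow_mul, ← AlgEquiv.mul_apply, ← zpow_add, add_neg_cancel, zpow_zero]; rfl

/-- The evaluation of skew Laurent polynomials. -/
noncomputable def lin : (ℤ →₀ D) →ₗ[k] A :=
  Finsupp.lsum k fun a ↦ (LinearMap.mulRight k ((E.t ^ a : Aˣ) : A)).comp E.ι.toLinearMap

theorem lin_apply (f : ℤ →₀ D) : E.lin f = f.sum fun a d ↦ E.ι d * (E.t ^ a : Aˣ) := rfl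

@[simp]
theorem lin_single (a : ℤ) (d : D) : E.lin (Finsupp.single a d) = E.ι d * (E.t ^ a : Aˣ) := by
  rw [lin_apply, Finsupp.sum_single_index (by simp)]

theorem lin_injective : Function.Injective E.lin :=
  (injective_iff_map_eq_zero _).2 E.indep

/-- The evaluation of skew Laurent polynomials in the opposite ring. -/
noncomputable def linOp : (ℤ →₀ Dᵐᵒᵖ) →ₗ[k] Aᵐᵒᵖ :=
  Finsupp.lsum k fun a ↦ (LinearMap.mulRight k (op ((E.t ^ a : Aˣ) : A))).comp
    (AlgHom.op E.ι).toLinearMap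

@[simp]
theorem linOp_single (a : ℤ) (d : Dᵐᵒᵖ) :
    E.linOp (Finsupp.single a d) = op ((E.t ^ a : Aˣ) * E.ι d.unop) := by
  rw [linOp, Finsupp.lsum_single]; rfl

/-- Moving coefficients between the two sides. -/
noncomputable def toOp : (ℤ →₀ D) →+ (ℤ →₀ Dᵐᵒᵖ) :=
  Finsupp.liftAddHom fun a ↦ (Finsupp.singleAddHom a).comp
    (opAddEquiv.toAddMonoidHom.comp (E.α ^ (-a)).toRingEquiv.toAddMonoidHom)

theorem toOp_single (a : ℤ) (d : D) :
    E.toOp (Finsupp.single a d) = Finsupp.single a (op ((E.α ^ (-a)) d)) :=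
  Finsupp.liftAddHom_apply_single _ _ _

theorem toOp_apply (f : ℤ →₀ D) (a : ℤ) : E.toOp f a = op ((E.α ^ (-a)) (f a)) := by
  classical
  induction f using Finsupp.induction_linear with
  | zero => simp
  | add F G hF hG => rw [map_add, Finsupp.add_apply, hF, hG]; simp
  | single h r =>
    rw [toOp_single, Finsupp.single_apply, Finsupp.single_apply]
    split_ifs with hh
    · rw [hh]
    · simp

theorem linOp_toOp (f : ℤ →₀ D) : E.linOp (E.toOp f) = op (E.lin f) := by
  induction f using Finsupp.induction_linear with
  | zero => simp
  | add F G hF hG => rw [map_add, map_add, hF, hG, map_add]; rfl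
  | single a d => rw [toOp_single, linOp_single, lin_single, unop_op, ← mul_zpow]

theorem toOp_surjective : Function.Surjective E.toOp := fun f ↦ by
  induction f using Finsupp.induction_linear with
  | zero => exact ⟨0, map_zero _⟩
  | add F G hF hG =>
    obtain ⟨F, rfl⟩ := hF
    obtain ⟨G, rfl⟩ := hG
    exact ⟨F + G, map_add _ _ _⟩
  | single a d =>
    refine ⟨Finsupp.single a ((E.α ^ a) d.unop), ?_⟩
    rw [toOp_single, ← AlgEquiv.mul_apply, ← zpow_add, neg_add_cancel, zpow_zero]; rfl

theorem linOp_injective : Function.Injective E.linOp := by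
  rw [injective_iff_map_eq_zero]
  intro f hf
  obtain ⟨f, rfl⟩ := E.toOp_surjective f
  rw [linOp_toOp, op_eq_zero_iff] at hf
  rw [E.indep f hf, map_zero]

theorem exists_lin_eq_mul (f g : ℤ →₀ D) : ∃ h, E.lin h = E.lin f * E.lin g := by
  induction f using Finsupp.induction_linear with
  | zero => exact ⟨0, by simp⟩
  | add F G hF hG =>
    obtain ⟨h, hF⟩ := hF
    obtain ⟨h', hG⟩ := hG
    exact ⟨h + h', by rw [map_add, hF, hG, map_add, add_mul]⟩
  | single a d =>
    induction g using Finsupp.induction_linear with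
    | zero => exact ⟨0, by simp⟩
    | add F G hF hG =>
      obtain ⟨h, hF⟩ := hF
      obtain ⟨h', hG⟩ := hG
      exact ⟨h + h', by rw [map_add, hF, hG, map_add, mul_add]⟩
    | single b e =>
      refine ⟨Finsupp.single (a + b) (d * (E.α ^ a) e), ?_⟩
      rw [lin_single, lin_single, lin_single, zpow_add, Units.val_mul, map_mul, mul_assoc,
        mul_assoc, ← mul_assoc _ (E.ι e), zpow_mul, mul_assoc]

/-- The evaluation of polynomials in two variables with coefficients in the enveloping algebra. -/
noncomputable def linEnv : (ℤ × ℤ →₀ EnvAlg k D) →ₗ[k] EnvAlg k A :=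
  (TensorProduct.map E.lin E.linOp).comp
    (finsuppTensorFinsupp k k D Dᵐᵒᵖ ℤ ℤ).symm.toLinearMap

/-- Over a field all modules are flat, so the tensor product of the two injective evaluation maps is
injective. -/
theorem linEnv_injective : Function.Injective E.linEnv :=
  (TensorProduct.map_injective_of_flat_flat _ _ E.lin_injective E.linOp_injective).comp
    (LinearEquiv.injective _)

/-- The inclusion of enveloping algebras. -/
noncomputable def ιEnv : EnvAlg k D →ₐ[k] EnvAlg k A :=
  Algebra.TensorProduct.map E.ι (AlgHom.op E.ι)

/-- The monomials of the enveloping algebra. -/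
def TEnv (g : ℤ × ℤ) : EnvAlg k A := ((E.t ^ g.1 : Aˣ) : A) ⊗ₜ op ((E.t ^ g.2 : Aˣ) : A)

theorem linEnv_apply (f : ℤ × ℤ →₀ EnvAlg k D) :
    E.linEnv f = f.sum fun g r ↦ E.ιEnv r * E.TEnv g := by
  induction f using Finsupp.induction_linear with
  | zero => simp
  | add F G hF hG => rw [map_add, hF, hG, Finsupp.sum_add_index (by simp) (by simp [add_mul])]
  | single g r =>
    rw [Finsupp.sum_single_index (by simp)]
    induction r using TensorProduct.induction_on with
    | zero => simp
    | add x y hx hy => rw [Finsupp.single_add, map_add, hx, hy, map_add, add_mul]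
    | tmul d e =>
      rw [linEnv, LinearMap.comp_apply, LinearEquiv.coe_coe, finsuppTensorFinsupp_symm_single,
        TensorProduct.map_tmul, lin_single, linOp_single, ιEnv, Algebra.TensorProduct.map_tmul,
        TEnv, Algebra.TensorProduct.tmul_mul_tmul]
      rfl

theorem linEnv_tmul (f : ℤ →₀ D) (g : ℤ →₀ Dᵐᵒᵖ) :
    E.linEnv (finsuppTensorFinsupp k k D Dᵐᵒᵖ ℤ ℤ (f ⊗ₜ g)) = E.lin f ⊗ₜ E.linOp g := by
  rw [linEnv, LinearMap.comp_apply, LinearEquiv.coe_coe, LinearEquiv.symm_apply_apply,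
    TensorProduct.map_tmul]

theorem exists_linEnv_eq_tmul (f g : ℤ →₀ D) : ∃ h, E.linEnv h = E.lin f ⊗ₜ op (E.lin g) :=
  ⟨_, (E.linEnv_tmul f (E.toOp g)).trans (by rw [linOp_toOp])⟩

/-- The denominators of the enveloping algebra. -/
def CEnv : Submonoid (EnvAlg k A) where
  carrier := {x | ∃ c ∈ E.C, ∃ c' ∈ E.C, c ⊗ₜ op c' = x}
  one_mem' := ⟨1, one_mem _, 1, one_mem _, rfl⟩
  mul_mem' := by
    rintro _ _ ⟨c, hc, c', hc', rfl⟩ ⟨d, hd, d', hd', rfl⟩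
    exact ⟨c * d, mul_mem hc hd, d' * c', mul_mem hd' hc',
      (Algebra.TensorProduct.tmul_mul_tmul _ _ _ _).symm⟩

theorem exists_lin_eq {c : A} (hc : c ∈ E.C) : ∃ f, E.lin f = c :=
  let ⟨f, _, hf, _⟩ := E.monic c hc
  ⟨f, hf⟩

theorem exists_linEnv_eq_mul {c : EnvAlg k A} (hc : c ∈ E.CEnv) (f : ℤ × ℤ →₀ EnvAlg k D) :
    (∃ h, E.linEnv h = c * E.linEnv f) ∧ ∃ h, E.linEnv h = E.linEnv f * c := by
  obtain ⟨c, hc, c', hc', rfl⟩ := hc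
  obtain ⟨p, rfl⟩ := E.exists_lin_eq hc
  obtain ⟨q, rfl⟩ := E.exists_lin_eq hc'
  obtain ⟨f, rfl⟩ := (finsuppTensorFinsupp k k D Dᵐᵒᵖ ℤ ℤ).surjective f
  induction f using TensorProduct.induction_on with
  | zero => exact ⟨⟨0, by simp⟩, ⟨0, by simp⟩⟩
  | add x y hx hy =>
    obtain ⟨⟨h1, e1⟩, h2, e2⟩ := hx
    obtain ⟨⟨h3, e3⟩, h4, e4⟩ := hy
    exact ⟨⟨h1 + h3, by rw [map_add, e1, e3, map_add, map_add, mul_add]⟩,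
      ⟨h2 + h4, by rw [map_add, e2, e4, map_add, map_add, add_mul]⟩⟩
  | tmul f g =>
    obtain ⟨g, rfl⟩ := E.toOp_surjective g
    rw [linEnv_tmul, linOp_toOp, Algebra.TensorProduct.tmul_mul_tmul,
      Algebra.TensorProduct.tmul_mul_tmul, ← op_mul, ← op_mul]
    obtain ⟨x, hx⟩ := E.exists_lin_eq_mul p f
    obtain ⟨y, hy⟩ := E.exists_lin_eq_mul f p
    obtain ⟨z, hz⟩ := E.exists_lin_eq_mul g q
    obtain ⟨w, hw⟩ := E.exists_lin_eq_mul q g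
    rw [← hx, ← hy, ← hz, ← hw]
    exact ⟨E.exists_linEnv_eq_tmul _ _, E.exists_linEnv_eq_tmul _ _⟩

/-- The prescribed factor `s` is what makes induction over sums possible: the denominator of the
second summand is sought after multiplication by that of the first. -/
theorem exists_linEnv_left (x s : EnvAlg k A) (hs : s ∈ E.CEnv) :
    ∃ c ∈ E.CEnv, ∃ f, E.linEnv f = c * s * x := by
  induction x using TensorProduct.induction_on generalizing s with
  | zero => exact ⟨1, one_mem _, 0, by simp⟩
  | add x y hx hy =>
    obtain ⟨c, hc, f, hf⟩ := hx s hs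
    obtain ⟨c', hc', f', hf'⟩ := hy _ (mul_mem hc hs)
    obtain ⟨h, hh⟩ := (E.exists_linEnv_eq_mul hc' f).1
    refine ⟨c' * c, mul_mem hc' hc, h + f', ?_⟩
    rw [map_add, hh, hf, hf']
    simp only [mul_assoc, mul_add]
  | tmul a b =>
    obtain ⟨d, hd, d', hd', rfl⟩ := hs
    -- In the opposite factor the order is reversed, so a left denominator of the tensor needs a
    -- left one of `a` and a right one of `b`.
    obtain ⟨c, hc, f, hf⟩ := E.den_left (d * a)
    obtain ⟨c', hc', f', hf'⟩ := E.den_right (b.unop * d')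
    obtain ⟨h, hh⟩ := E.exists_linEnv_eq_tmul f f'
    refine ⟨c ⊗ₜ op c', ⟨c, hc, c', hc', rfl⟩, h, ?_⟩
    rw [hh, lin_apply, lin_apply, hf, hf', Algebra.TensorProduct.tmul_mul_tmul,
      Algebra.TensorProduct.tmul_mul_tmul, op_mul, op_mul, op_unop]
    simp only [mul_assoc]

theorem exists_linEnv_right (x s : EnvAlg k A) (hs : s ∈ E.CEnv) :
    ∃ c ∈ E.CEnv, ∃ f, E.linEnv f = x * (s * c) := by
  induction x using TensorProduct.induction_on generalizing s with
  | zero => exact ⟨1, one_mem _, 0, by simp⟩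
  | add x y hx hy =>
    obtain ⟨c, hc, f, hf⟩ := hx s hs
    obtain ⟨c', hc', f', hf'⟩ := hy _ (mul_mem hs hc)
    obtain ⟨h, hh⟩ := (E.exists_linEnv_eq_mul hc' f).2
    refine ⟨c * c', mul_mem hc hc', h + f', ?_⟩
    rw [map_add, hh, hf, hf']
    simp only [mul_assoc, add_mul]
  | tmul a b =>
    obtain ⟨d, hd, d', hd', rfl⟩ := hs
    obtain ⟨c, hc, f, hf⟩ := E.den_right (a * d)
    obtain ⟨c', hc', f', hf'⟩ := E.den_left (d' * b.unop)
    obtain ⟨h, hh⟩ := E.exists_linEnv_eq_tmul f f'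
    refine ⟨c ⊗ₜ op c', ⟨c, hc, c', hc', rfl⟩, h, ?_⟩
    rw [hh, lin_apply, lin_apply, hf, hf', Algebra.TensorProduct.tmul_mul_tmul,
      Algebra.TensorProduct.tmul_mul_tmul, op_mul, op_mul, op_unop]
    simp only [mul_assoc]

/-- The automorphisms induced by the monomials. -/
noncomputable def ωEnv (g : ℤ × ℤ) : EnvAlg k D ≃ₐ[k] EnvAlg k D :=
  Algebra.TensorProduct.congr (E.α ^ g.1) (AlgEquiv.op (E.α ^ (-g.2)))

/-- The extension of enveloping algebras. -/
noncomputable def env : TorusExt (EnvAlg k D) (EnvAlg k A) where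
  ι := E.ιEnv
  T := E.TEnv
  ω g := (E.ωEnv g).toRingEquiv
  C := E.CEnv
  T_zero := by simp [TEnv, Algebra.TensorProduct.one_def]
  T_add g h := by
    simp only [TEnv, Algebra.TensorProduct.tmul_mul_tmul, Prod.fst_add, Prod.snd_add, zpow_add,
      Units.val_mul, ← op_mul]
    rw [← Units.val_mul, ← Units.val_mul, ← Units.val_mul, ← zpow_add, ← zpow_add, ← zpow_add,
      add_comm g.2]
  T_mul g r := by
    change E.TEnv g * E.ιEnv r = E.ιEnv (E.ωEnv g r) * E.TEnv g
    induction r using TensorProduct.induction_on with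
    | zero => simp
    | add x y hx hy => rw [map_add, mul_add, hx, hy, map_add, map_add, add_mul]
    | tmul d e =>
      rw [ωEnv, Algebra.TensorProduct.congr_apply, Algebra.TensorProduct.map_tmul, ιEnv,
        Algebra.TensorProduct.map_tmul, Algebra.TensorProduct.map_tmul, TEnv,
        Algebra.TensorProduct.tmul_mul_tmul, Algebra.TensorProduct.tmul_mul_tmul]
      congr 1
      · exact E.zpow_mul _ _
      · exact congrArg op (E.mul_zpow g.2 e.unop)
  indep f hf := (injective_iff_map_eq_zero _).1 E.linEnv_injective f ((E.linEnv_apply f).trans hf)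
  isUnit := by
    rintro _ ⟨c, hc, c', hc', rfl⟩
    obtain ⟨c, rfl⟩ := E.isUnit c hc
    obtain ⟨c', rfl⟩ := E.isUnit c' hc'
    refine ⟨⟨(c : A) ⊗ₜ op (c' : A), (↑c⁻¹ : A) ⊗ₜ op (↑c'⁻¹ : A), ?_, ?_⟩, rfl⟩ <;>
    · rw [Algebra.TensorProduct.tmul_mul_tmul, ← op_mul]
      simp only [Units.mul_inv, Units.inv_mul]
      rfl
  monic := by
    rintro _ ⟨c, hc, c', hc', rfl⟩
    obtain ⟨f, a, hf, ha, ha'⟩ := E.monic c hc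
    obtain ⟨g, b, hg, hb, hb'⟩ := E.monic c' hc'
    refine ⟨finsuppTensorFinsupp k k D Dᵐᵒᵖ ℤ ℤ (f ⊗ₜ E.toOp g), (a, b), ?_, ?_, ?_⟩
    · rw [← hf, ← hg]
      refine (E.linEnv_apply _).symm.trans ?_
      rw [linEnv_tmul, linOp_toOp]
      rfl
    · rw [finsuppTensorFinsupp_apply, ha, toOp_apply, hb, map_one]
      rfl
    · rintro ⟨a', b'⟩ h
      rw [finsuppTensorFinsupp_apply, toOp_apply] at h
      refine ⟨ha' _ fun h' ↦ h ?_, hb' _ fun h' ↦ h ?_⟩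
      · rw [h', zero_tmul]
      · rw [h', map_zero, op_zero, tmul_zero]
  den_left x := by
    obtain ⟨c, hc, f, hf⟩ := E.exists_linEnv_left x 1 (one_mem _)
    exact ⟨c, hc, f, (E.linEnv_apply f).symm.trans (by rw [hf, mul_one])⟩
  den_right x := by
    obtain ⟨c, hc, f, hf⟩ := E.exists_linEnv_right x 1 (one_mem _)
    exact ⟨c, hc, f, (E.linEnv_apply f).symm.trans (by rw [hf, one_mul])⟩

end SkewExt

end SkewExtension

/-! ### The cone data of an extension of algebras -/

section EnvCone

universe v u

open TensorProduct MulOpposite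
open Matrix (vecMul smul_vecMul add_vecMul map_apply single_one_vecMul)
open scoped Matrix

/-- A cyclic module over a noetherian ring has a resolution by finite free modules that starts with
the given generator. -/
theorem FreeRes.exists_of_isNoetherianRing {R X : Type u} [Ring R] [IsNoetherianRing R]
    [AddCommGroup X] [Module R X] (x : X) (hx : ∀ y, ∃ r : R, r • x = y) :
    ∃ P : FreeRes R X, Nonempty (Unique (P.ι 0)) ∧ ∀ i, P.ε i = x := by
  -- A stage of the construction: a finite free module with the submodule of relations that the next
  -- differential has to generate.
  let St : Type u := Σ n : ℕ, Submodule R (Fin n → R)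
  have key : ∀ s : St, ∃ (m : ℕ) (M : Matrix (Fin m) (Fin s.1) R), ∀ v, v ∈ s.2 ↔
      ∃ w, w ᵥ* M = v := by
    rintro ⟨n, K⟩
    obtain ⟨m, M, hM⟩ := Submodule.fg_iff_exists_fin_generating_family.1
      (IsNoetherian.noetherian K)
    refine ⟨m, M, fun v ↦ ?_⟩
    rw [← hM, Submodule.mem_span_range_iff_exists_fun]
    refine exists_congr fun w ↦ ?_
    exact (Eq.congr_left (Matrix.vecMul_eq_sum w (Matrix.of M)).symm)
  choose m M hM using key
  let s : ℕ → St := fun n ↦ Nat.rec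
    (⟨1, LinearMap.ker ((LinearMap.toSpanSingleton R X x).comp (LinearMap.proj 0))⟩ : St)
    (fun _ s ↦ ⟨m s, LinearMap.ker (M s).vecMulLinear⟩) n
  have h0 : ∀ v : Fin 1 → R, ∑ i, v i • x = v 0 • x := fun v ↦ Fin.sum_univ_one _
  exact ⟨{
    ι := fun n ↦ Fin (s n).1
    d := fun n ↦ M (s n)
    ε := fun _ ↦ x
    surj := fun y ↦ by
      obtain ⟨r, rfl⟩ := hx y
      exact ⟨fun _ ↦ r, h0 _⟩
    exact_zero := fun v ↦ (Eq.congr_left (h0 v)).trans (hM (s 0) v)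
    exact_succ := fun n v ↦ hM (s (n + 1)) v }, ⟨(inferInstance : Unique (Fin 1))⟩, fun _ ↦ rfl⟩

/-- An element of `A` as an element of the `Aᵉ`-module `A`. -/
noncomputable def toEnvSelf (k : Type v) (A : Type u) [Field k] [Ring A] [Algebra k A] :
    A ≃+ envSelf k A :=
  AddEquiv.refl A

theorem tmul_smul_toEnvSelf {k : Type v} {A : Type u} [Field k] [Ring A] [Algebra k A] (a : A)
    (b : Aᵐᵒᵖ) (x : A) : (a ⊗ₜ[k] b) • toEnvSelf k A x = toEnvSelf k A (a * x * b.unop) :=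
  (TensorProduct.Algebra.smul_def a b x).trans (mul_assoc _ _ _).symm

namespace SkewExt

variable {k : Type v} {D A : Type u} [Field k] [Ring D] [Algebra k D] [Ring A] [Algebra k A]
  (E : SkewExt k D A)

/-- Conjugation by `t ⊗ t⁻¹` applies `α` to both tensor factors, hence to their product. -/
theorem ωEnv_smul (r : EnvAlg k D) (x : D) (hx : r • toEnvSelf k D 1 = toEnvSelf k D x) :
    E.ωEnv (1, -1) r • toEnvSelf k D 1 = toEnvSelf k D (E.α x) := by
  obtain rfl := (toEnvSelf k D).symm_apply_eq.2 hx
  clear hx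
  induction r using TensorProduct.induction_on with
  | zero =>
    rw [map_zero]
    refine (zero_smul (EnvAlg k D) (toEnvSelf k D 1)).trans (.symm ?_)
    refine (congrArg (fun y ↦ toEnvSelf k D (E.α ((toEnvSelf k D).symm y)))
      (zero_smul (EnvAlg k D) (toEnvSelf k D 1))).trans ?_
    rw [map_zero, map_zero, map_zero]
  | add r s hr hs => simp only [map_add, add_smul, hr, hs]
  | tmul d e =>
    rw [ωEnv, Algebra.TensorProduct.congr_apply, Algebra.TensorProduct.map_tmul,
      tmul_smul_toEnvSelf, tmul_smul_toEnvSelf, AddEquiv.symm_apply_apply]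
    simp

theorem ωEnv_smul_eq_zero_iff (r : EnvAlg k D) :
    E.ωEnv (1, -1) r • toEnvSelf k D 1 = 0 ↔ r • toEnvSelf k D 1 = 0 := by
  rw [E.ωEnv_smul r _ ((toEnvSelf k D).apply_symm_apply _).symm]
  simp

theorem ιEnv_smul (r : EnvAlg k D) (x : D) (hx : r • toEnvSelf k D 1 = toEnvSelf k D x) :
    E.ιEnv r • toEnvSelf k A 1 = toEnvSelf k A (E.ι x) := by
  obtain rfl := (toEnvSelf k D).symm_apply_eq.2 hx
  clear hx
  induction r using TensorProduct.induction_on with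
  | zero =>
    rw [map_zero]
    refine (zero_smul (EnvAlg k A) (toEnvSelf k A 1)).trans (.symm ?_)
    refine (congrArg (fun y ↦ toEnvSelf k A (E.ι ((toEnvSelf k D).symm y)))
      (zero_smul (EnvAlg k D) (toEnvSelf k D 1))).trans ?_
    rw [map_zero, map_zero, map_zero]
  | add r s hr hs => simp only [map_add, add_smul, hr, hs]
  | tmul d e =>
    rw [ιEnv, Algebra.TensorProduct.map_tmul,
      tmul_smul_toEnvSelf, tmul_smul_toEnvSelf, AddEquiv.symm_apply_apply]
    simp

/-- The left ideal generated by the relations of `D` and by `u - 1`. -/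
def relIdeal : Submodule (EnvAlg k A) (EnvAlg k A) :=
  Submodule.span (EnvAlg k A) ({s | ∃ r, r • toEnvSelf k D 1 = 0 ∧ E.ιEnv r = s} ∪
    {E.TEnv (1, -1) - 1})

/-- The elements whose left and right multiplications agree modulo the relations. -/
def central : Subring A where
  carrier := {a | a ⊗ₜ[k] (1 : Aᵐᵒᵖ) - (1 : A) ⊗ₜ[k] op a ∈ E.relIdeal}
  zero_mem' := by simp
  one_mem' := by
    change (1 : A) ⊗ₜ[k] (1 : Aᵐᵒᵖ) - (1 : A) ⊗ₜ[k] op 1 ∈ E.relIdeal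
    rw [op_one, sub_self]
    exact zero_mem _
  add_mem' {a b} ha hb := by
    have := E.relIdeal.add_mem ha hb
    change _ ∈ E.relIdeal
    rw [add_tmul, op_add, tmul_add]
    convert this using 1
    abel
  neg_mem' {a} ha := by
    have := E.relIdeal.neg_mem ha
    change _ ∈ E.relIdeal
    rw [neg_tmul, op_neg, tmul_neg]
    convert this using 1
    abel
  mul_mem' {a b} ha hb := by
    have := add_mem (E.relIdeal.smul_mem (a ⊗ₜ (1 : Aᵐᵒᵖ)) hb) (E.relIdeal.smul_mem ((1 : A) ⊗ₜ op b) ha)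
    change _ ∈ E.relIdeal
    convert this using 1
    simp only [smul_eq_mul, mul_sub, Algebra.TensorProduct.tmul_mul_tmul, one_mul, mul_one,
      ← op_mul]
    abel

/-- Multiply the relation for `a` by `-(a⁻¹ ⊗ a⁻¹)`. Closure under inverses is what lets the
argument pass to the localization. -/
theorem inv_mem_central (a : Aˣ) (ha : (a : A) ∈ E.central) : (↑a⁻¹ : A) ∈ E.central := by
  have := E.relIdeal.neg_mem (E.relIdeal.smul_mem ((↑a⁻¹ : A) ⊗ₜ op (↑a⁻¹ : A)) ha)
  change _ ∈ E.relIdeal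
  convert this using 1
  simp only [smul_eq_mul, mul_sub, Algebra.TensorProduct.tmul_mul_tmul, mul_one,
      ← op_mul, Units.inv_mul, Units.mul_inv, op_one, neg_sub]

theorem ι_mem_central (d : D) : E.ι d ∈ E.central := by
  refine Submodule.subset_span (.inl ⟨d ⊗ₜ 1 - 1 ⊗ₜ op d, ?_, ?_⟩)
  · rw [sub_smul, tmul_smul_toEnvSelf, tmul_smul_toEnvSelf]
    simp
  · rw [map_sub, ιEnv, Algebra.TensorProduct.map_tmul, Algebra.TensorProduct.map_tmul]
    simp

/-- The relation is `(1 ⊗ t) * (u - 1) = t ⊗ 1 - 1 ⊗ t`. -/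
theorem t_mem_central : (E.t : A) ∈ E.central := by
  have : ((1 : A) ⊗ₜ[k] op (E.t : A)) • (E.TEnv (1, -1) - 1) ∈ E.relIdeal :=
    E.relIdeal.smul_mem _ (Submodule.subset_span (.inr rfl))
  change _ ∈ E.relIdeal
  convert this using 1
  simp only [TEnv, smul_eq_mul, mul_sub, Algebra.TensorProduct.tmul_mul_tmul, one_mul, mul_one,
      ← op_mul, zpow_neg, zpow_one, Units.inv_mul, op_one]

theorem zpow_mem_central (a : ℤ) : ((E.t ^ a : Aˣ) : A) ∈ E.central := by
  induction a using Int.induction_on with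
  | zero => rw [zpow_zero, Units.val_one]; exact one_mem _
  | succ n ih =>
    rw [zpow_add_one, Units.val_mul]
    exact mul_mem ih E.t_mem_central
  | pred n ih =>
    rw [zpow_sub_one, Units.val_mul]
    exact mul_mem ih (E.inv_mem_central _ E.t_mem_central)

theorem lin_mem_central (f : ℤ →₀ D) : E.lin f ∈ E.central := by
  rw [lin_apply]
  exact sum_mem fun a _ ↦ mul_mem (E.ι_mem_central _) (E.zpow_mem_central _)

theorem mem_central (x : A) : x ∈ E.central := by
  obtain ⟨c, hc, f, hf⟩ := E.den_left x
  obtain ⟨g, rfl⟩ := E.exists_lin_eq hc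
  obtain ⟨c, hc⟩ := E.isUnit _ hc
  rw [← hc] at hf
  have h := mul_mem (E.inv_mem_central c (hc ▸ E.lin_mem_central g)) (E.lin_mem_central f)
  rwa [lin_apply, hf, Units.inv_mul_cancel_left] at h

/-- Modulo the relations every right factor can be moved to the left, so `s` is congruent to `(s •
1) ⊗ 1`. -/
theorem mem_relIdeal {s : EnvAlg k A} (hs : s • toEnvSelf k A 1 = 0) : s ∈ E.relIdeal := by
  suffices h : s - ((toEnvSelf k A).symm (s • toEnvSelf k A 1)) ⊗ₜ 1 ∈ E.relIdeal by
    rwa [hs, map_zero, zero_tmul, sub_zero] at h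
  clear hs
  induction s using TensorProduct.induction_on with
  | zero =>
    rw [zero_sub, neg_mem_iff]
    have h := congrArg (fun y ↦ ((toEnvSelf k A).symm y ⊗ₜ[k] (1 : Aᵐᵒᵖ)))
      (zero_smul (EnvAlg k A) (toEnvSelf k A 1))
    simp only [map_zero, zero_tmul] at h
    exact Set.mem_of_eq_of_mem h (zero_mem E.relIdeal)
  | add r s hr hs =>
    convert add_mem hr hs using 1
    rw [add_smul, map_add, add_tmul]
    abel
  | tmul a b =>
    rw [tmul_smul_toEnvSelf, AddEquiv.symm_apply_apply, mul_one, ← neg_mem_iff]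
    have := E.relIdeal.smul_mem (a ⊗ₜ 1) (E.mem_central b.unop)
    rw [smul_eq_mul, mul_sub, Algebra.TensorProduct.tmul_mul_tmul,
      Algebra.TensorProduct.tmul_mul_tmul] at this
    simpa using this

theorem TEnv_smul : E.TEnv (1, -1) • toEnvSelf k A 1 = toEnvSelf k A 1 := by
  rw [TEnv, tmul_smul_toEnvSelf]
  simp

/-- The cone data of the extension of enveloping algebras. -/
theorem exists_coneData (hD : IsDoublyNoetherian k D) :
    ∃ F : ConeData (EnvAlg k D) (EnvAlg k A) (envSelf k D) (envSelf k A),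
      F.toTorusExt = E.env := by
  have : IsNoetherianRing (EnvAlg k D) := hD
  have hsurj : ∀ (B : Type u) [Ring B] [Algebra k B] (y : envSelf k B),
      ∃ r : EnvAlg k B, r • toEnvSelf k B 1 = y := fun B _ _ y ↦
    ⟨(toEnvSelf k B).symm y ⊗ₜ 1, by rw [tmul_smul_toEnvSelf]; simp⟩
  obtain ⟨P, ⟨hu⟩, hε⟩ := FreeRes.exists_of_isNoetherianRing (toEnvSelf k D 1) (hsurj D)
  have hsum : ∀ {B M : Type u} [Ring B] [AddCommGroup M] [Module B M] (v : P.ι 0 → B) (x : M),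
      ∑ i, v i • x = v default • x := fun v x ↦ Fintype.sum_unique _
  have e : ∀ v : P.ι 0 → EnvAlg k D, ∑ i, v i • P.ε i = v default • toEnvSelf k D 1 := by
    intro v
    rw [← hsum]
    simp only [hε]
  have h1 : ∀ v : P.ι 0 → EnvAlg k D, ∑ i, v i • P.ε i = 0 →
      ∑ i, E.env.ω (1, -1) (v i) • P.ε i = 0 := by
    intro v
    rw [e, e fun i ↦ E.env.ω (1, -1) (v i)]
    exact (E.ωEnv_smul_eq_zero_iff _).2
  have h2 : ∀ v : P.ι 0 → EnvAlg k D, ∑ i, v i • P.ε i = 0 →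
      ∑ i, (E.env.ω (1, -1)).symm (v i) • P.ε i = 0 := by
    intro v hv
    rw [e fun i ↦ (E.env.ω (1, -1)).symm (v i)]
    rw [e] at hv
    refine (E.ωEnv_smul_eq_zero_iff _).1 ?_
    change E.env.ω (1, -1) _ • _ = _
    rwa [RingEquiv.apply_symm_apply]
  obtain ⟨θ, hθ, hθ'⟩ := P.exists_lift (E.env.ω (1, -1)).symm h2
  obtain ⟨χ, hχ, hχ'⟩ := P.exists_lift (E.env.ω (1, -1)) h1
  refine ⟨{ E.env with
    P := P
    θ := θ
    θ' := χ
    θ_zero := hθ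
    θ'_zero := hχ
    θ_succ := hθ'
    θ'_succ := hχ'
    ε := fun _ ↦ toEnvSelf k A 1
    stable := h2
    surj := fun y ↦ by
      obtain ⟨r, hr⟩ := hsurj A y
      exact ⟨fun _ ↦ r, (hsum _ _).trans hr⟩
    ker := fun v ↦ ?_ }, rfl⟩
  rw [hsum]
  change _ ↔ ∃ (w : P.ι 1 → EnvAlg k A) (z : P.ι 0 → EnvAlg k A), w ᵥ* (P.d 0).map E.ιEnv + (fun i ↦ z i * (E.TEnv (1, -1) - 1)) = v
  constructor
  · intro hv
    -- The kernel of `Aᵉ → A` is `relIdeal`, and it is enough to follow its generators and the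
    -- module operations.
    suffices h : ∀ s ∈ E.relIdeal, ∃ (w : P.ι 1 → EnvAlg k A) (z : P.ι 0 → EnvAlg k A),
        w ᵥ* (P.d 0).map E.ιEnv + (fun i ↦ z i * (E.TEnv (1, -1) - 1)) = fun _ ↦ s by
      obtain ⟨w, z, h⟩ := h _ (E.mem_relIdeal hv)
      refine ⟨w, z, h.trans ?_⟩
      funext i
      rw [Unique.eq_default i]
    intro s hs
    induction hs using Submodule.span_induction with
    | mem s hs =>
      obtain ⟨r, hr, rfl⟩ | rfl := hs
      · obtain ⟨w, hw⟩ := (P.exact_zero fun _ ↦ r).1 ((e _).trans hr)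
        refine ⟨fun i ↦ E.ιEnv (w i), 0, ?_⟩
        funext i
        have := congrArg E.ιEnv (congrFun hw i)
        simpa [vecMul, dotProduct] using this
      · exact ⟨0, fun _ ↦ 1, by funext i; simp⟩
    | zero => exact ⟨0, 0, by funext i; simp⟩
    | add x y _ _ hx hy =>
      obtain ⟨w, z, h⟩ := hx
      obtain ⟨w', z', h'⟩ := hy
      refine ⟨w + w', z + z', ?_⟩
      funext i
      rw [← congrFun h i, ← congrFun h' i, add_vecMul]
      simp only [Pi.add_apply, add_mul]
      abel
    | smul a x _ hx =>
      obtain ⟨w, z, h⟩ := hx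
      refine ⟨a • w, a • z, ?_⟩
      funext i
      rw [smul_eq_mul, ← congrFun h i, smul_vecMul]
      simp [mul_add, mul_assoc]
  · rintro ⟨w, z, rfl⟩
    have h3 : ∀ j, E.ιEnv (P.d 0 j default) • toEnvSelf k A 1 = 0 := by
      intro j
      have h4 := (e (P.d 0 j)).symm.trans
        ((P.exact_zero _).2 ⟨Pi.single j 1, single_one_vecMul j _⟩)
      rw [E.ιEnv_smul _ 0 (h4.trans (map_zero _).symm), map_zero, map_zero]
    rw [Pi.add_apply, add_smul, mul_smul, sub_smul, TEnv_smul, one_smul, sub_self, smul_zero,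
      add_zero, vecMul, dotProduct, Finset.sum_smul]
    refine Finset.sum_eq_zero fun j _ ↦ ?_
    rw [map_apply, mul_smul, h3, smul_zero]

end SkewExt

end EnvCone

/-! ### Lengths of modules -/

section Lengths

variable {K : Type*} [Ring K] {M N : Type*} [AddCommGroup M] [Module K M] [AddCommGroup N]
  [Module K N]

/-- A semilinear bijection induces an isomorphism of the lattices of submodules. -/
theorem Module.length_eq_of_semilinear {M' : Type*} [AddCommGroup M'] [Module K M'] (σ : K ≃+* K)
    (e : M ≃+ M') (h : ∀ (r : K) x, e (r • x) = σ r • e x) :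
    Module.length K M = Module.length K M' := by
  have := RingHomInvPair.of_ringEquiv σ
  have := RingHomInvPair.of_ringEquiv_symm σ
  let e' : M ≃ₛₗ[(σ : K →+* K)] M' := { e with map_smul' := h }
  rw [← WithBot.coe_inj, Module.coe_length, Module.coe_length]
  exact Order.krullDim_eq_of_orderIso (Submodule.orderIsoMapComap e')

/-- The image of a submodule under a semilinear bijection. -/
def Submodule.mapSemilinear (σ : K ≃+* K) (e : M ≃+ M) (h : ∀ (r : K) x, e (r • x) = σ r • e x)
    (P : Submodule K M) : Submodule K M where
  carrier := {x | e.symm x ∈ P}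
  zero_mem' := by simp
  add_mem' {x y} hx hy := by
    change e.symm (x + y) ∈ P
    rw [map_add]
    exact P.add_mem hx hy
  smul_mem' r x hx := by
    have := P.smul_mem (σ.symm r) hx
    rwa [← e.symm_apply_apply (_ • _), h, σ.apply_symm_apply, e.apply_symm_apply] at this

theorem Submodule.length_mapSemilinear (σ : K ≃+* K) (e : M ≃+ M)
    (h : ∀ (r : K) x, e (r • x) = σ r • e x) (P : Submodule K M) :
    Module.length K (P.mapSemilinear σ e h) = Module.length K P :=
  (Module.length_eq_of_semilinear σ
    { toFun := fun x ↦ ⟨e x.1, by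
        change e.symm (e x.1) ∈ P
        rw [e.symm_apply_apply]
        exact x.2⟩
      invFun := fun x ↦ ⟨e.symm x.1, x.2⟩
      left_inv := fun x ↦ Subtype.ext (e.symm_apply_apply x.1)
      right_inv := fun x ↦ Subtype.ext (e.apply_symm_apply x.1)
      map_add' := fun x y ↦ Subtype.ext (map_add e x.1 y.1) }
    fun r x ↦ Subtype.ext (h r x.1)).symm

theorem Submodule.isFiniteLength_of_length_le (P : Submodule K M) {n : ℕ}
    (h : Module.length K P ≤ n) : IsFiniteLength K P :=
  Module.length_ne_top_iff.1 (h.trans_lt (ENat.natCast_lt_top n)).ne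

theorem Submodule.length_lt_of_lt {P Q : Submodule K M} (h : P < Q) {n : ℕ}
    (hQ : Module.length K Q ≤ n) : Module.length K P < Module.length K Q := by
  obtain ⟨_, _⟩ := isFiniteLength_iff_isNoetherian_isArtinian.1 (Q.isFiniteLength_of_length_le hQ)
  have := Submodule.length_lt (N := P.submoduleOf Q) fun h' ↦ h.not_ge (submoduleOf_eq_top.1 h')
  rwa [(submoduleOfEquivOfLe h.le).length_eq] at this

/-- A bound on the lengths of the finitely generated submodules is a bound on the length. -/
theorem Module.length_le_of_forall_fg {n : ℕ}
    (h : ∀ P : Submodule K M, P.FG → Module.length K P ≤ n) : Module.length K M ≤ n := by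
  classical
  let A (m : ℕ) : Prop := ∃ P : Submodule K M, P.FG ∧ (m : ℕ∞) ≤ Module.length K P
  have hA : ∀ m, A m → m ≤ n := fun m ⟨P, hP, hm⟩ ↦ by exact_mod_cast hm.trans (h P hP)
  have h0 : A 0 := ⟨⊥, Submodule.fg_bot, zero_le⟩
  -- A finitely generated submodule of greatest length is everything, as adjoining another element
  -- would lengthen it.
  obtain ⟨P, hP, hm⟩ : A (Nat.findGreatest A n) := Nat.findGreatest_spec n.zero_le h0
  have htop : P = ⊤ := by
    by_contra hne
    obtain ⟨x, hx⟩ : ∃ x, x ∉ P := by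
      by_contra! hall
      exact hne (eq_top_iff.2 fun x _ ↦ hall x)
    have hQ : (P ⊔ Submodule.span K {x}).FG := hP.sup (Submodule.fg_span_singleton x)
    have hlt : P < P ⊔ Submodule.span K {x} :=
      left_lt_sup.2 fun h' ↦ hx (h' (Submodule.mem_span_singleton_self x))
    have h1 := Order.add_one_le_of_lt (hm.trans_lt (Submodule.length_lt_of_lt hlt (h _ hQ)))
    have hA' : A (Nat.findGreatest A n + 1) := ⟨_, hQ, by push_cast; exact h1⟩
    exact absurd (Nat.le_findGreatest (hA _ hA') hA') (Nat.not_succ_le_self _)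
  have := h P hP
  rw [htop] at this
  rwa [Module.length_top] at this

theorem Submodule.length_iSup_range_le {ι : Type*} (s : Finset ι) (f : ι → M →ₗ[K] N) :
    Module.length K (⨆ i ∈ s, LinearMap.range (f i) : Submodule K N) ≤
      s.card * Module.length K M := by
  classical
  have h : Module.length K (LinearMap.range (∑ i : s, (f i).comp (LinearMap.proj (R := K)
      (φ := fun _ : s ↦ M) i))) ≤ s.card * Module.length K M := by
    refine (Module.length_le_of_surjective _ (LinearMap.surjective_rangeRestrict _)).trans_eq ?_
    rw [Module.length_pi_of_fintype, Finset.sum_const, Finset.card_univ, Fintype.card_coe,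
      nsmul_eq_mul]
  refine (Module.length_le_of_injective (Submodule.inclusion ?_)
    (Submodule.inclusion_injective _)).trans h
  refine iSup₂_le fun i hi ↦ ?_
  rintro _ ⟨x, rfl⟩
  refine ⟨Pi.single ⟨i, hi⟩ x, ?_⟩
  rw [LinearMap.sum_apply, Finset.sum_eq_single ⟨i, hi⟩]
  · simp
  · intro j _ hj
    simp [hj]
  · simp

/-- Comparison of the growth of two families of submodules that are indexed by the integers. -/
theorem Module.length_le_of_growth {F : ℤ → Type*} [∀ a, AddCommGroup (F a)] [∀ a, Module K (F a)]
    (g : ∀ a, F a →ₗ[K] N) (h : ℤ → M →ₗ[K] N) {e : ℕ∞} {n : ℕ}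
    (he : ∀ a, e ≤ Module.length K (F a)) (hn : Module.length K M ≤ n)
    (hg : ∀ (s : Finset ℤ) (x : ∀ a, F a), ∑ a ∈ s, g a (x a) = 0 → ∀ a ∈ s, x a = 0) (w : ℕ)
    (hgh : ∀ (a : ℤ) x, g a x ∈ ⨆ b ∈ Finset.Icc (a - w) (a + w), LinearMap.range (h b)) : e ≤ n := by
  classical
  -- The exponents `0, …, m - 1` give `m` independent pieces inside the sum of the `m + 2 * w`
  -- ranges with exponents from `-w` to `m - 1 + w`.
  have key : ∀ m : ℕ, m * e ≤ (m + 2 * w) * n := by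
    intro m
    let s := Finset.Ico (0 : ℤ) m
    let s' := Finset.Icc (-w : ℤ) (m - 1 + w)
    let G := ∑ a : s, (g a).comp (LinearMap.proj (R := K) (φ := fun a : s ↦ F a) a)
    have hG : ∀ x, G x ∈ (⨆ b ∈ s', LinearMap.range (h b) : Submodule K N) := by
      intro x
      rw [LinearMap.sum_apply]
      refine Submodule.sum_mem _ fun a _ ↦ ?_
      refine (iSup₂_le fun b hb ↦ ?_ : (_ : Submodule K N) ≤ _) (hgh a (x a))
      refine le_iSup₂_of_le b ?_ le_rfl
      have := Finset.mem_Ico.1 a.2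
      rw [Finset.mem_Icc] at hb ⊢
      omega
    have hinj : Function.Injective (G.codRestrict _ hG) := by
      rw [← LinearMap.ker_eq_bot, LinearMap.ker_codRestrict, LinearMap.ker_eq_bot']
      intro x hx
      have := hg s (fun a ↦ if ha : a ∈ s then x ⟨a, ha⟩ else 0) (by
        rw [← hx, LinearMap.sum_apply, ← Finset.sum_attach]
        refine Finset.sum_congr rfl fun a _ ↦ ?_
        rw [dif_pos a.2]
        rfl)
      funext a
      have := this a a.2
      rwa [dif_pos a.2] at this
    have h1 := (Module.length_le_of_injective _ hinj).trans (Submodule.length_iSup_range_le s' h)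
    rw [Module.length_pi_of_fintype] at h1
    have h2 : m * e ≤ ∑ a : s, Module.length K (F a) := by
      calc m * e = ∑ a : s, e := by simp [s]
        _ ≤ _ := Finset.sum_le_sum fun a _ ↦ he a
    refine (h2.trans h1).trans ?_
    have hc : s'.card ≤ m + 2 * w := by
      rw [Int.card_Icc]
      omega
    calc (s'.card : ℕ∞) * Module.length K M ≤ ((m + 2 * w : ℕ) : ℕ∞) * n := by gcongr
      _ = _ := by push_cast; rfl
  by_contra! hlt
  have h1 : ((n + 1 : ℕ) : ℕ∞) ≤ e := by push_cast; exact Order.add_one_le_of_lt hlt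
  -- If `n + 1 ≤ e`, then `key m` gives `m ≤ 2 * w * n`; this is the first `m` to violate it.
  have h2 := key (2 * w * n + 1)
  have h3 : ((2 * w * n + 1 : ℕ) : ℕ∞) * ((n + 1 : ℕ) : ℕ∞) ≤
      ((2 * w * n + 1 + 2 * w : ℕ) : ℕ∞) * n := by
    calc _ ≤ ((2 * w * n + 1 : ℕ) : ℕ∞) * e := by gcongr
      _ ≤ _ := by rw [Nat.cast_add (2 * w * n + 1)]; push_cast at h2 ⊢; exact h2
  have h4 : (2 * w * n + 1) * (n + 1) ≤ (2 * w * n + 1 + 2 * w) * n := by exact_mod_cast h3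
  nlinarith

/-- Modules over a simple Artinian ring are determined by their length. -/
theorem IsSimpleRing.nonempty_linearEquiv_of_length_eq [IsSimpleRing K] [IsArtinianRing K]
    (h : Module.length K M = Module.length K K) : Nonempty (K ≃ₗ[K] M) := by
  have hKtop : Module.length K K ≠ ⊤ := Module.length_ne_top
  obtain ⟨_, _⟩ := isFiniteLength_iff_isNoetherian_isArtinian.1
    (Module.length_ne_top_iff.1 (h.trans_ne hKtop))
  have : Nontrivial M := Module.length_pos_iff.1 (Module.length_pos.trans_eq h.symm)
  obtain ⟨n, S, hS, ⟨e⟩⟩ : ∃ n : ℕ, ∃ S : Submodule K M, IsSimpleModule K S ∧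
      Nonempty (M ≃ₗ[K] (Fin n → S)) := by
    obtain ⟨n, _, S, hS, e⟩ := (IsSimpleRing.isIsotypic K M).linearEquiv_fun
    exact ⟨n, S, hS, e⟩
  obtain ⟨m, T, hT, ⟨f⟩⟩ : ∃ n : ℕ, ∃ S : Submodule K K, IsSimpleModule K S ∧
      Nonempty (K ≃ₗ[K] (Fin n → S)) := by
    obtain ⟨n, _, S, hS, e⟩ := (IsSimpleRing.isIsotypic K K).linearEquiv_fun
    exact ⟨n, S, hS, e⟩
  have hnm : n = m := by
    rw [e.length_eq, f.length_eq, Module.length_pi_of_fintype, Module.length_pi_of_fintype] at h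
    simpa [Module.length_eq_one] using h
  subst hnm
  -- The simple modules lie in different modules; inside `M × K`, which is isotypic, they can be
  -- compared.
  obtain ⟨g⟩ : Nonempty (T ≃ₗ[K] S) := by
    have e₁ := S.equivMapOfInjective (LinearMap.inl K M K) LinearMap.inl_injective
    have e₂ := T.equivMapOfInjective (LinearMap.inr K M K) LinearMap.inr_injective
    have := IsSimpleModule.congr e₁.symm
    have := IsSimpleModule.congr e₂.symm
    obtain ⟨g⟩ := IsSimpleRing.isIsotypic K (M × K) (S.map (LinearMap.inl K M K))
      (T.map (LinearMap.inr K M K))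
    exact ⟨e₂.trans (g.trans e₁.symm)⟩
  exact ⟨f.trans ((LinearEquiv.piCongrRight fun _ ↦ g).trans e.symm)⟩

end Lengths

/-! ### Bimodules over an extension -/

section Bimodules

universe v u

open MulOpposite

/-- Families of additive maps, applied to the coefficients of a finitely supported function. -/
noncomputable def Finsupp.diagMap {B B' : Type*} [AddCommGroup B] [AddCommGroup B']
    (h : ℤ → B →+ B') : (ℤ →₀ B) →+ (ℤ →₀ B') :=
  Finsupp.liftAddHom fun a ↦ (Finsupp.singleAddHom a).comp (h a)

theorem Finsupp.diagMap_single {B B' : Type*} [AddCommGroup B] [AddCommGroup B'] (h : ℤ → B →+ B')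
    (a : ℤ) (x : B) : Finsupp.diagMap h (Finsupp.single a x) = Finsupp.single a (h a x) :=
  Finsupp.liftAddHom_apply_single _ _ _

theorem Finsupp.diagMap_apply {B B' : Type*} [AddCommGroup B] [AddCommGroup B'] (h : ℤ → B →+ B')
    (f : ℤ →₀ B) (a : ℤ) : Finsupp.diagMap h f a = h a (f a) := by
  classical
  induction f using Finsupp.induction_linear with
  | zero => simp
  | add F G hF hG => rw [map_add, Finsupp.add_apply, hF, hG, Finsupp.add_apply, map_add]
  | single b r =>
    rw [diagMap_single, Finsupp.single_apply, Finsupp.single_apply]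
    split_ifs with hh
    · rw [hh]
    · simp

/-- `m` generates the bimodule `M` freely from the left and from the right. -/
def IsBiGen (A : Type*) {M : Type*} [Ring A] [AddCommGroup M] [Module A M] [Module Aᵐᵒᵖ M]
    (m : M) : Prop :=
  Function.Bijective (fun a : A ↦ a • m) ∧ Function.Bijective (fun a : A ↦ op a • m)

variable {k : Type v} {D A : Type u} [Field k] [Ring D] [Algebra k D] [Ring A] [Algebra k A]

/-- A `D`-bimodule `M` and an `A`-bimodule `N` that is a localization of the sum of the translates
of `M` by the powers of the variable. -/
structure BimodExt (E : SkewExt k D A) (M N : Type*) [AddCommGroup M] [AddCommGroup N] [Module D M]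
    [Module Dᵐᵒᵖ M] [Module A N] [Module Aᵐᵒᵖ N] where
  /-- the inclusion -/
  j : M →+ N
  /-- the automorphism induced by the variable -/
  φ : M → M
  φ_surjective : Function.Surjective φ
  j_smul : ∀ (d : D) x, j (d • x) = E.ι d • j x
  j_op_smul : ∀ (d : D) x, j (op d • x) = op (E.ι d) • j x
  t_smul : ∀ x, (E.t : A) • j x = op (E.t : A) • j (φ x)
  exists_sum : ∀ y, ∃ c ∈ E.C, ∃ c' ∈ E.C, ∃ f : ℤ →₀ M,
    c • op c' • y = f.sum fun a x ↦ ((E.t ^ a : Aˣ) : A) • j x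
  eq_zero_of_sum : ∀ f : ℤ →₀ M, (f.sum fun a x ↦ ((E.t ^ a : Aˣ) : A) • j x) = 0 → f = 0

namespace BimodExt

variable {E : SkewExt k D A} {M N : Type*} [AddCommGroup M] [AddCommGroup N] [Module D M]
    [Module Dᵐᵒᵖ M] [Module A N] [Module Aᵐᵒᵖ N]
    (F : BimodExt E M N)

/-- Sums of translates of elements of `M`. -/
noncomputable def W : (ℤ →₀ M) →+ N :=
  Finsupp.liftAddHom fun a ↦ (DistribSMul.toAddMonoidHom N ((E.t ^ a : Aˣ) : A)).comp F.j

theorem W_single (a : ℤ) (x : M) : F.W (Finsupp.single a x) = ((E.t ^ a : Aˣ) : A) • F.j x :=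
  Finsupp.liftAddHom_apply_single _ _ _

theorem W_injective : Function.Injective F.W :=
  (injective_iff_map_eq_zero _).2 F.eq_zero_of_sum

theorem j_injective : Function.Injective F.j := by
  rw [injective_iff_map_eq_zero]
  intro x hx
  have := F.W_injective (a₁ := Finsupp.single 0 x) (a₂ := 0) (by rw [W_single, hx]; simp)
  simpa using this

theorem zpow_smul_cancel {a : ℤ} {x y : M}
    (h : ((E.t ^ a : Aˣ) : A) • F.j x = ((E.t ^ a : Aˣ) : A) • F.j y) : x = y :=
  F.j_injective ((E.t ^ a).isUnit.smul_left_cancel.1 h)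

theorem op_zpow_smul_cancel {a : ℤ} {x y : M}
    (h : op ((E.t ^ a : Aˣ) : A) • F.j x = op ((E.t ^ a : Aˣ) : A) • F.j y) : x = y :=
  F.j_injective ((E.t ^ a).isUnit.op.smul_left_cancel.1 h)

theorem lin_smul_j (f : ℤ →₀ D) (m : M) : E.lin f • F.j m =
    F.W (Finsupp.diagMap (fun a ↦ (AddMonoidHom.flip (smulAddHom D M) m).comp
      (E.α ^ (-a)).toRingEquiv.toAddMonoidHom) f) := by
  induction f using Finsupp.induction_linear with
  | zero => simp
  | add f g hf hg => rw [map_add, add_smul, hf, hg, map_add, map_add]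
  | single a d =>
    rw [SkewExt.lin_single, Finsupp.diagMap_single, W_single, E.mul_zpow, mul_smul, ← j_smul]
    rfl

theorem exists_lin_smul {m : M} (hm : IsBiGen D m) (g : ℤ →₀ M) :
    ∃ f, E.lin f • F.j m = F.W g := by
  induction g using Finsupp.induction_linear with
  | zero => exact ⟨0, by simp⟩
  | add f g hf hg =>
    obtain ⟨f', hf⟩ := hf
    obtain ⟨g', hg⟩ := hg
    exact ⟨f' + g', by rw [map_add, add_smul, hf, hg, map_add]⟩
  | single a x =>
    obtain ⟨d, rfl⟩ := hm.1.2 x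
    exact ⟨Finsupp.single a ((E.α ^ a) d), by
      rw [SkewExt.lin_single, ← E.zpow_mul, mul_smul, ← j_smul, W_single]⟩

theorem eq_zero_of_lin_smul {m : M} (hm : IsBiGen D m) {f : ℤ →₀ D}
    (h : E.lin f • F.j m = 0) : f = 0 := by
  rw [lin_smul_j] at h
  have h1 := F.W_injective (h.trans (map_zero _).symm)
  ext a
  have h2 : (E.α ^ (-a)) (f a) • m = 0 := by
    have := DFunLike.congr_fun h1 a
    rwa [Finsupp.diagMap_apply] at this
  have h3 := hm.1.1 (h2.trans (zero_smul D m).symm)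
  simpa using h3

variable [SMulCommClass A Aᵐᵒᵖ N]

/-- Both halves are needed to invert the passage from left to right powers. For positive powers the
second half uses surjectivity of `φ`, for negative ones the first. -/
theorem exists_zpow_smul (a : ℤ) :
    (∀ x, ∃ y, ((E.t ^ a : Aˣ) : A) • F.j x = op ((E.t ^ a : Aˣ) : A) • F.j y) ∧
      ∀ y, ∃ x, ((E.t ^ a : Aˣ) : A) • F.j x = op ((E.t ^ a : Aˣ) : A) • F.j y := by
  induction a using Int.induction_on with
  | zero => exact ⟨fun x ↦ ⟨x, by simp⟩, fun x ↦ ⟨x, by simp⟩⟩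
  | succ n ih =>
    have key : ∀ x y, ((E.t ^ (n : ℤ) : Aˣ) : A) • F.j (F.φ x) =
        op ((E.t ^ (n : ℤ) : Aˣ) : A) • F.j y →
        ((E.t ^ ((n : ℤ) + 1) : Aˣ) : A) • F.j x =
          op ((E.t ^ ((n : ℤ) + 1) : Aˣ) : A) • F.j y := by
      intro x y h
      rw [zpow_add_one, Units.val_mul, mul_smul, t_smul, smul_comm, h, op_mul, mul_smul]
    refine ⟨fun x ↦ ?_, fun y ↦ ?_⟩
    · obtain ⟨y, hy⟩ := ih.1 (F.φ x)
      exact ⟨y, key x y hy⟩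
    · obtain ⟨x, hx⟩ := ih.2 y
      obtain ⟨x, rfl⟩ := F.φ_surjective x
      exact ⟨x, key x y hx⟩
  | pred n ih =>
    have key : ∀ x y, ((E.t ^ (-n : ℤ) : Aˣ) : A) • F.j x =
        op ((E.t ^ (-n : ℤ) : Aˣ) : A) • F.j y →
        ((E.t ^ ((-n : ℤ) - 1) : Aˣ) : A) • F.j (F.φ x) =
          op ((E.t ^ ((-n : ℤ) - 1) : Aˣ) : A) • F.j y := by
      intro x y h
      have h0 : (↑E.t⁻¹ : A) • F.j (F.φ x) = op (↑E.t⁻¹ : A) • F.j x := by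
        rw [← E.t.isUnit.smul_left_cancel, ← E.t.isUnit.op.smul_left_cancel, smul_smul,
          Units.mul_inv, one_smul, smul_comm (E.t : A), smul_smul, ← op_mul, Units.inv_mul,
          op_one, one_smul, t_smul]
      rw [zpow_sub_one, Units.val_mul, op_mul, mul_smul, mul_smul, ← h, h0, smul_comm]
    refine ⟨fun x ↦ ?_, fun y ↦ ?_⟩
    · obtain ⟨x, rfl⟩ := F.φ_surjective x
      obtain ⟨y, hy⟩ := ih.1 x
      exact ⟨y, key x y hy⟩
    · obtain ⟨x, hx⟩ := ih.2 y
      exact ⟨_, key x y hx⟩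

/-- Moving powers of the variable from the left to the right. -/
noncomputable def θ (a : ℤ) : M ≃+ M where
  toFun x := ((F.exists_zpow_smul a).1 x).choose
  invFun y := ((F.exists_zpow_smul a).2 y).choose
  left_inv x := F.zpow_smul_cancel (((F.exists_zpow_smul a).2 _).choose_spec.trans
    ((F.exists_zpow_smul a).1 x).choose_spec.symm)
  right_inv y := F.op_zpow_smul_cancel (((F.exists_zpow_smul a).1 _).choose_spec.symm.trans
    ((F.exists_zpow_smul a).2 y).choose_spec)
  map_add' x y := F.op_zpow_smul_cancel (by
    refine ((F.exists_zpow_smul a).1 (x + y)).choose_spec.symm.trans ?_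
    rw [map_add, smul_add, map_add, smul_add]
    exact congrArg₂ _ ((F.exists_zpow_smul a).1 x).choose_spec
      ((F.exists_zpow_smul a).1 y).choose_spec)

theorem zpow_smul_j (a : ℤ) (x : M) :
    ((E.t ^ a : Aˣ) : A) • F.j x = op ((E.t ^ a : Aˣ) : A) • F.j (F.θ a x) :=
  ((F.exists_zpow_smul a).1 x).choose_spec

theorem op_zpow_smul_j (a : ℤ) (x : M) :
    op ((E.t ^ a : Aˣ) : A) • F.j x = ((E.t ^ a : Aˣ) : A) • F.j ((F.θ a).symm x) := by
  rw [zpow_smul_j, AddEquiv.apply_symm_apply]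

theorem θ_smul (a : ℤ) (d : D) (x : M) : F.θ a (d • x) = (E.α ^ a) d • F.θ a x :=
  F.op_zpow_smul_cancel (by
    rw [← zpow_smul_j, j_smul, j_smul, smul_smul, E.zpow_mul, mul_smul, zpow_smul_j, smul_comm])

theorem θ_op_smul (a : ℤ) (d : D) (x : M) : F.θ a (op d • x) = op ((E.α ^ a) d) • F.θ a x :=
  F.op_zpow_smul_cancel (by
    rw [← zpow_smul_j, j_op_smul, j_op_smul, smul_smul, ← op_mul, ← E.zpow_mul, op_mul, mul_smul,
      smul_comm, zpow_smul_j])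

theorem op_lin_smul_j (f : ℤ →₀ D) (m : M) : op (E.lin f) • F.j m =
    F.W (Finsupp.diagMap (fun a ↦ (F.θ a).symm.toAddMonoidHom.comp
      ((AddMonoidHom.flip (smulAddHom Dᵐᵒᵖ M) m).comp opAddEquiv.toAddMonoidHom)) f) := by
  induction f using Finsupp.induction_linear with
  | zero => simp
  | add f g hf hg => rw [map_add, op_add, add_smul, hf, hg, map_add, map_add]
  | single a d =>
    rw [SkewExt.lin_single, Finsupp.diagMap_single, W_single, op_mul, mul_smul, ← j_op_smul,
      op_zpow_smul_j]
    rfl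

/-! ### Ascent of two-sided generators -/

section Forward

variable {m : M} (hm : IsBiGen D m)
include hm

theorem eq_zero_of_op_lin_smul {f : ℤ →₀ D} (h : op (E.lin f) • F.j m = 0) : f = 0 := by
  rw [op_lin_smul_j] at h
  have h1 := F.W_injective (h.trans (map_zero _).symm)
  ext a
  have h2 : (F.θ a).symm (op (f a) • m) = 0 := by
    have := DFunLike.congr_fun h1 a
    rwa [Finsupp.diagMap_apply] at this
  rw [map_eq_zero_iff _ (F.θ a).symm.injective] at h2
  exact hm.2.1 (h2.trans (zero_smul Dᵐᵒᵖ m).symm)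

theorem exists_op_lin_smul (g : ℤ →₀ M) : ∃ f, op (E.lin f) • F.j m = F.W g := by
  induction g using Finsupp.induction_linear with
  | zero => exact ⟨0, by simp⟩
  | add f g hf hg =>
    obtain ⟨f', hf⟩ := hf
    obtain ⟨g', hg⟩ := hg
    exact ⟨f' + g', by rw [map_add, op_add, add_smul, hf, hg, map_add]⟩
  | single a x =>
    obtain ⟨d, hd⟩ := hm.2.2 (F.θ a x)
    exact ⟨Finsupp.single a d, by
      rw [SkewExt.lin_single, op_mul, mul_smul, ← j_op_smul, W_single, zpow_smul_j, ← hd]⟩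

/-- The equation `m c = f m` makes `f` as regular as the unit `c`. If `f g = 0`, write `g m = m g'`;
then `m (c g') = f g m = 0`, so `g' = 0` and `g = 0`. If `g f = 0`, then `(g m) c = 0` and again `g
= 0`. -/
theorem isUnit_of_op_smul (hreg : ∀ f, (∀ g, E.lin f * E.lin g = 0 → E.lin g = 0) →
    (∀ g, E.lin g * E.lin f = 0 → E.lin g = 0) → IsUnit (E.lin f)) {c : A} (hc : c ∈ E.C)
    {f : ℤ →₀ D} (h : op c • F.j m = E.lin f • F.j m) : IsUnit (E.lin f) := by
  have hcu := E.isUnit c hc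
  refine hreg f (fun g hg ↦ ?_) fun g hg ↦ ?_
  · obtain ⟨g', hg'⟩ := F.exists_op_lin_smul hm (Finsupp.diagMap (fun a ↦
      (AddMonoidHom.flip (smulAddHom D M) m).comp (E.α ^ (-a)).toRingEquiv.toAddMonoidHom) g)
    rw [← lin_smul_j] at hg'
    obtain ⟨p, rfl⟩ := E.exists_lin_eq hc
    obtain ⟨q, hq⟩ := E.exists_lin_eq_mul p g'
    have h1 : op (E.lin q) • F.j m = 0 := by
      rw [hq, op_mul, mul_smul, h, ← smul_comm, hg', smul_smul, hg, zero_smul]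
    have h2 := F.eq_zero_of_op_lin_smul hm h1
    rw [h2, map_zero, eq_comm, hcu.mul_right_eq_zero] at hq
    rw [hq, op_zero, zero_smul] at hg'
    rw [F.eq_zero_of_lin_smul hm hg'.symm, map_zero]
  · have h1 : op c • E.lin g • F.j m = 0 := by
      rw [← smul_comm, h, smul_smul, hg, zero_smul]
    rw [hcu.op.smul_eq_zero] at h1
    rw [F.eq_zero_of_lin_smul hm h1, map_zero]

theorem isUnit_of_smul (hreg : ∀ f, (∀ g, E.lin f * E.lin g = 0 → E.lin g = 0) →
    (∀ g, E.lin g * E.lin f = 0 → E.lin g = 0) → IsUnit (E.lin f)) {c : A} (hc : c ∈ E.C)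
    {f : ℤ →₀ D} (h : c • F.j m = op (E.lin f) • F.j m) : IsUnit (E.lin f) := by
  have hcu := E.isUnit c hc
  refine hreg f (fun g hg ↦ ?_) fun g hg ↦ ?_
  · have h1 : c • op (E.lin g) • F.j m = 0 := by
      rw [smul_comm, h, smul_smul, ← op_mul, hg, op_zero, zero_smul]
    rw [hcu.smul_eq_zero] at h1
    rw [F.eq_zero_of_op_lin_smul hm h1, map_zero]
  · obtain ⟨g', hg'⟩ := F.exists_lin_smul hm (Finsupp.diagMap (fun a ↦
      (F.θ a).symm.toAddMonoidHom.comp ((AddMonoidHom.flip (smulAddHom Dᵐᵒᵖ M) m).comp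
        opAddEquiv.toAddMonoidHom)) g)
    rw [← op_lin_smul_j] at hg'
    obtain ⟨p, rfl⟩ := E.exists_lin_eq hc
    obtain ⟨q, hq⟩ := E.exists_lin_eq_mul g' p
    have h1 : E.lin q • F.j m = 0 := by
      rw [hq, mul_smul, h, smul_comm, hg', smul_smul, ← op_mul, hg, op_zero, zero_smul]
    have h2 := F.eq_zero_of_lin_smul hm h1
    rw [h2, map_zero, eq_comm, hcu.mul_left_eq_zero] at hq
    rw [hq, zero_smul] at hg'
    rw [F.eq_zero_of_op_lin_smul hm hg'.symm, map_zero]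

theorem isBiGen_j (hreg : ∀ f, (∀ g, E.lin f * E.lin g = 0 → E.lin g = 0) →
    (∀ g, E.lin g * E.lin f = 0 → E.lin g = 0) → IsUnit (E.lin f)) : IsBiGen A (F.j m) := by
  refine ⟨⟨fun a b hab ↦ ?_, fun y ↦ ?_⟩, ⟨fun a b hab ↦ ?_, fun y ↦ ?_⟩⟩
  · obtain ⟨c, hc, f, hf⟩ := E.den_left (a - b)
    have h : E.lin f • F.j m = 0 := by
      rw [E.lin_apply, hf, mul_smul, sub_smul, sub_eq_zero.2 hab, smul_zero]
    rw [← E.lin_apply, F.eq_zero_of_lin_smul hm h, map_zero, eq_comm,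
      (E.isUnit c hc).mul_right_eq_zero, sub_eq_zero] at hf
    exact hf
  · obtain ⟨c, hc, c', hc', g, hg⟩ := F.exists_sum y
    obtain ⟨f, hf⟩ := F.exists_lin_smul hm g
    obtain ⟨p, hp⟩ := E.exists_lin_eq hc'
    obtain ⟨f', hf'⟩ := F.exists_lin_smul hm (Finsupp.diagMap (fun a ↦
      (F.θ a).symm.toAddMonoidHom.comp ((AddMonoidHom.flip (smulAddHom Dᵐᵒᵖ M) m).comp
        opAddEquiv.toAddMonoidHom)) p)
    rw [← op_lin_smul_j, hp] at hf'
    -- The right denominator `c'` acts on the generator as the left unit `U`, so `y` becomes a left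
    -- multiple of it.
    obtain ⟨U, hU⟩ := F.isUnit_of_op_smul hm hreg hc' hf'.symm
    obtain ⟨V, rfl⟩ := E.isUnit c hc
    refine ⟨↑V⁻¹ * E.lin f * ↑U⁻¹, ?_⟩
    rw [← (E.isUnit c' hc').op.smul_left_cancel, ← V.isUnit.smul_left_cancel, hg]
    refine .trans ?_ hf
    change _ • op c' • _ • F.j m = _
    rw [← smul_comm _ (op c'), ← hf', ← hU, smul_smul, smul_smul, mul_assoc, mul_assoc,
      Units.inv_mul, mul_one, Units.mul_inv_cancel_left]
  · obtain ⟨c, hc, f, hf⟩ := E.den_right (a - b)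
    have h : op (E.lin f) • F.j m = 0 := by
      rw [E.lin_apply, hf, op_mul, mul_smul, op_sub, sub_smul, sub_eq_zero.2 hab, smul_zero]
    rw [← E.lin_apply, F.eq_zero_of_op_lin_smul hm h, map_zero, eq_comm,
      (E.isUnit c hc).mul_left_eq_zero, sub_eq_zero] at hf
    exact hf
  · obtain ⟨c, hc, c', hc', g, hg⟩ := F.exists_sum y
    obtain ⟨f, hf⟩ := F.exists_op_lin_smul hm g
    obtain ⟨p, hp⟩ := E.exists_lin_eq hc
    obtain ⟨f', hf'⟩ := F.exists_op_lin_smul hm (Finsupp.diagMap (fun a ↦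
      (AddMonoidHom.flip (smulAddHom D M) m).comp (E.α ^ (-a)).toRingEquiv.toAddMonoidHom) p)
    rw [← lin_smul_j, hp] at hf'
    obtain ⟨U, hU⟩ := F.isUnit_of_smul hm hreg hc hf'.symm
    obtain ⟨V, rfl⟩ := E.isUnit c' hc'
    refine ⟨↑U⁻¹ * E.lin f * ↑V⁻¹, ?_⟩
    rw [← V.isUnit.op.smul_left_cancel, ← (E.isUnit c hc).smul_left_cancel, hg]
    refine .trans ?_ hf
    change c • _ • op _ • F.j m = _
    rw [smul_smul, smul_comm, ← hf', ← hU, smul_smul, ← op_mul, ← op_mul,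
      Units.inv_mul_cancel_right, Units.mul_inv_cancel_left]

end Forward

end BimodExt

end Bimodules

/-! ### Descent of generators -/

section Descent

universe v u

open MulOpposite

/-- A bound for the length of `M` by comparison of the translates of the finitely generated
submodules of `M` with those of a cyclic module. -/
theorem Module.length_le_of_translates {K : Type*} [Ring K] {M N : Type*} [AddCommGroup M]
    [Module K M] [AddCommGroup N] [Module K N] {n : ℕ} (hn : Module.length K K ≤ n)
    (σ : ℤ → K ≃+* K) (θ : ℤ → M ≃+ M) (hθ : ∀ a (r : K) x, θ a (r • x) = σ a r • θ a x)
    (g : ℤ → M →ₗ[K] N)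
    (hg : ∀ (s : Finset ℤ) (x : ℤ → M), ∑ a ∈ s, g a (x a) = 0 → ∀ a ∈ s, x a = 0)
    (h : ∀ S : Finset M, ∃ (h : ℤ → K →ₗ[K] N) (w : ℕ), ∀ x ∈ S, ∀ a : ℤ,
      g a (θ a x) ∈ ⨆ b ∈ Finset.Icc (a - w) (a + w), LinearMap.range (h b)) :
    Module.length K M ≤ n := by
  refine Module.length_le_of_forall_fg fun P hP ↦ ?_
  obtain ⟨S, rfl⟩ := hP
  obtain ⟨h, w, hw⟩ := h S
  refine Module.length_le_of_growth
    (F := fun a ↦ (Submodule.span K (S : Set M)).mapSemilinear (σ a) (θ a) (hθ a))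
    (fun a ↦ (g a).comp (Submodule.subtype _)) h
    (fun a ↦ (Submodule.length_mapSemilinear (σ a) (θ a) (hθ a) _).ge) hn
    (fun s x hx a ha ↦ Subtype.ext (hg s (fun a ↦ (x a).1) hx a ha)) w ?_
  rintro a ⟨x, hx⟩
  obtain ⟨y, rfl⟩ := (θ a).surjective x
  change (θ a).symm (θ a y) ∈ Submodule.span K (S : Set M) at hx
  change g a (θ a y) ∈ _
  have hy : y ∈ Submodule.span K (S : Set M) := by rwa [AddEquiv.symm_apply_apply] at hx
  clear hx
  induction hy using Submodule.span_induction with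
  | mem x hx => exact hw x hx a
  | zero => simp
  | add x y _ _ hx hy => rw [map_add, map_add]; exact add_mem hx hy
  | smul r x _ hx => rw [hθ, map_smul]; exact Submodule.smul_mem _ _ hx

variable {k : Type v} {D A : Type u} [Field k] [Ring D] [Algebra k D] [Ring A] [Algebra k A]

theorem SkewExt.exists_common_right (E : SkewExt k D A) {ι : Type*} (S : Finset ι) (q : ι → A) :
    ∃ c ∈ E.C, ∀ l ∈ S, ∃ f, E.lin f = q l * c := by
  classical
  induction S using Finset.induction_on with
  | empty => exact ⟨1, one_mem _, by simp⟩
  | insert i S hi ih =>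
    obtain ⟨c, hc, h⟩ := ih
    obtain ⟨c', hc', f, hf⟩ := E.den_right (q i * c)
    obtain ⟨p, hp⟩ := E.exists_lin_eq hc'
    refine ⟨c * c', mul_mem hc hc', fun l hl ↦ ?_⟩
    obtain rfl | hl := Finset.mem_insert.1 hl
    · exact ⟨f, hf.trans (mul_assoc _ _ _)⟩
    · obtain ⟨f, hf⟩ := h l hl
      obtain ⟨g, hg⟩ := E.exists_lin_eq_mul f p
      exact ⟨g, by rw [hg, hf, hp, mul_assoc]⟩

theorem SkewExt.exists_common_left (E : SkewExt k D A) {ι : Type*} (S : Finset ι) (q : ι → A) :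
    ∃ c ∈ E.C, ∀ l ∈ S, ∃ f, E.lin f = c * q l := by
  classical
  induction S using Finset.induction_on with
  | empty => exact ⟨1, one_mem _, by simp⟩
  | insert i S hi ih =>
    obtain ⟨c, hc, h⟩ := ih
    obtain ⟨c', hc', f, hf⟩ := E.den_left (c * q i)
    obtain ⟨p, hp⟩ := E.exists_lin_eq hc'
    refine ⟨c' * c, mul_mem hc' hc, fun l hl ↦ ?_⟩
    obtain rfl | hl := Finset.mem_insert.1 hl
    · exact ⟨f, hf.trans (mul_assoc _ _ _).symm⟩
    · obtain ⟨f, hf⟩ := h l hl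
      obtain ⟨g, hg⟩ := E.exists_lin_eq_mul p f
      exact ⟨g, by rw [hg, hf, hp, mul_assoc]⟩

theorem Finsupp.exists_bound {B : Type*} [Zero B] (f : ℤ →₀ B) :
    ∃ w : ℕ, ∀ b ∈ f.support, -(w : ℤ) ≤ b ∧ b ≤ w :=
  ⟨f.support.sup Int.natAbs, fun b hb ↦ by
    have := Finset.le_sup (f := Int.natAbs) hb
    omega⟩

theorem Finset.exists_bound {ι B : Type*} [Zero B] (S : Finset ι) (f : ι → ℤ →₀ B) :
    ∃ w : ℕ, ∀ l ∈ S, ∀ b ∈ (f l).support, -(w : ℤ) ≤ b ∧ b ≤ w := by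
  choose w hw using fun l ↦ Finsupp.exists_bound (f l)
  refine ⟨S.sup w, fun l hl b hb ↦ ?_⟩
  have := Finset.le_sup (f := w) hl
  have := hw l b hb
  omega

namespace BimodExt

variable {E : SkewExt k D A} {M N : Type*} [AddCommGroup M] [AddCommGroup N] [Module D M]
    [Module Dᵐᵒᵖ M] [Module A N] [Module Aᵐᵒᵖ N]
    (F : BimodExt E M N)

theorem eq_zero_of_sum_zpow_smul {s : Finset ℤ} {x : ℤ → M}
    (h : ∑ a ∈ s, ((E.t ^ a : Aˣ) : A) • F.j (x a) = 0) : ∀ a ∈ s, x a = 0 := by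
  classical
  have h1 : F.W (∑ a ∈ s, Finsupp.single a (x a)) = 0 := by
    rw [map_sum, ← h]
    exact Finset.sum_congr rfl fun a _ ↦ F.W_single a _
  intro a ha
  have h2 := DFunLike.congr_fun (F.W_injective (h1.trans (map_zero _).symm)) a
  rw [Finsupp.finsetSum_apply, Finset.sum_eq_single a] at h2
  · simpa using h2
  · intro b _ hb
    exact Finsupp.single_eq_of_ne hb.symm
  · exact fun h ↦ absurd ha h

variable [SMulCommClass A Aᵐᵒᵖ N]

/-- Finitely many elements of `M` are left multiples of `n₀` with a common denominator `V` on the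
right, so they are left Laurent combinations of `V⁻¹ n₀` with exponents in a window. Their
translates by `tᵃ` are combinations with exponents in the window moved by `a`, and growth bounds the
length. -/
theorem length_left_le (F : BimodExt E M N) {n₀ : N} (hn₀ : IsBiGen A n₀) {n : ℕ} (hn : Module.length D D ≤ n) :
    Module.length D M ≤ n := by
  let _ : Module D N := Module.compHom N E.ι.toRingHom
  have hsmul : ∀ (d : D) (y : N), d • y = E.ι d • y := fun _ _ ↦ rfl
  refine Module.length_le_of_translates (N := N) hn (fun a ↦ (E.α ^ a).toRingEquiv) F.θ
    F.θ_smul (fun a ↦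
      { toFun := fun x ↦ op ((E.t ^ a : Aˣ) : A) • F.j x
        map_add' := fun x y ↦ by rw [map_add, smul_add]
        map_smul' := fun d x ↦ by
          rw [j_smul, ← smul_comm, RingHom.id_apply, hsmul] }) ?_ ?_
  · intro s x hx a ha
    have := F.eq_zero_of_sum_zpow_smul (s := s) (x := fun a ↦ (F.θ a).symm (x a)) (by
      rw [← hx]
      exact Finset.sum_congr rfl fun a _ ↦ (F.op_zpow_smul_j a _).symm) a ha
    simpa using this
  · intro S
    choose q hq using fun x ↦ hn₀.1.2 (F.j x)
    obtain ⟨c, hc, hf⟩ := E.exists_common_right S q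
    obtain ⟨V, rfl⟩ := E.isUnit c hc
    choose! f hf using hf
    obtain ⟨w, hw⟩ := S.exists_bound f
    refine ⟨fun b ↦ LinearMap.toSpanSingleton D N (((E.t ^ b : Aˣ) : A) • (↑V⁻¹ : A) • n₀), w,
      fun x hx a ↦ ?_⟩
    change op ((E.t ^ a : Aˣ) : A) • F.j _ ∈ _
    -- The translate is left `D`-linear with `tᵃ` on the right, but the exponents are counted with
    -- `tᵃ` on the left; `θ` mediates between them.
    rw [← zpow_smul_j, ← hq]
    have e1 : q x • n₀ = E.lin (f x) • (↑V⁻¹ : A) • n₀ := by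
      rw [hf x hx, smul_smul, mul_assoc, Units.mul_inv, mul_one]
    change _ • q x • n₀ ∈ _
    rw [e1, E.lin_apply, Finsupp.sum, Finset.sum_smul, Finset.smul_sum]
    refine Submodule.sum_mem _ fun b hb ↦ ?_
    have := hw x hx b hb
    refine Submodule.mem_iSup_of_mem (a + b) (Submodule.mem_iSup_of_mem
      (Finset.mem_Icc.2 (by omega)) ⟨(E.α ^ a) (f x b), ?_⟩)
    rw [LinearMap.toSpanSingleton_apply, hsmul, smul_smul, smul_smul, smul_smul, smul_smul,
      zpow_add, Units.val_mul, ← mul_assoc, ← mul_assoc, ← E.zpow_mul]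

theorem length_right_le (F : BimodExt E M N) {n₀ : N} (hn₀ : IsBiGen A n₀) {n : ℕ}
    (hn : Module.length Dᵐᵒᵖ Dᵐᵒᵖ ≤ n) : Module.length Dᵐᵒᵖ M ≤ n := by
  let _ : Module Dᵐᵒᵖ N := Module.compHom N (AlgHom.op E.ι).toRingHom
  have hsmul : ∀ (d : Dᵐᵒᵖ) (y : N), d • y = op (E.ι d.unop) • y := fun _ _ ↦ rfl
  refine Module.length_le_of_translates (N := N) hn
    (fun a ↦ (AlgEquiv.op (E.α ^ (-a))).toRingEquiv) (fun a ↦ (F.θ a).symm) ?_ (fun a ↦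
      { toFun := fun x ↦ ((E.t ^ a : Aˣ) : A) • F.j x
        map_add' := fun x y ↦ by rw [map_add, smul_add]
        map_smul' := fun d x ↦ by
          rw [← op_unop d, j_op_smul, smul_comm, RingHom.id_apply, hsmul, unop_op] }) ?_ ?_
  · intro a d x
    rw [AddEquiv.symm_apply_eq]
    change _ = F.θ a (op ((E.α ^ (-a)) d.unop) • _)
    rw [θ_op_smul, AddEquiv.apply_symm_apply, ← AlgEquiv.mul_apply, ← zpow_add, add_neg_cancel,
      zpow_zero]
    rfl
  · exact fun s x hx ↦ F.eq_zero_of_sum_zpow_smul hx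
  · intro S
    choose q hq using fun x ↦ hn₀.2.2 (F.j x)
    obtain ⟨c, hc, hf⟩ := E.exists_common_left S q
    obtain ⟨V, rfl⟩ := E.isUnit c hc
    choose! f hf using hf
    obtain ⟨w, hw⟩ := S.exists_bound f
    refine ⟨fun b ↦ LinearMap.toSpanSingleton Dᵐᵒᵖ N
      (op ((E.t ^ b : Aˣ) : A) • op (↑V⁻¹ : A) • n₀), w, fun x hx a ↦ ?_⟩
    change ((E.t ^ a : Aˣ) : A) • F.j _ ∈ _
    rw [← op_zpow_smul_j, ← hq]
    have e1 : op (q x) • n₀ = op (E.lin (f x)) • op (↑V⁻¹ : A) • n₀ := by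
      rw [hf x hx, smul_smul, ← op_mul, Units.inv_mul_cancel_left]
    change _ • op (q x) • n₀ ∈ _
    rw [e1, E.lin_apply, Finsupp.sum, Finset.op_sum, Finset.sum_smul, Finset.smul_sum]
    refine Submodule.sum_mem _ fun b hb ↦ ?_
    have := hw x hx b hb
    refine Submodule.mem_iSup_of_mem (b + a) (Submodule.mem_iSup_of_mem
      (Finset.mem_Icc.2 (by omega)) ⟨op ((E.α ^ (-(b + a))) (f x b)), ?_⟩)
    rw [LinearMap.toSpanSingleton_apply, hsmul, unop_op]
    simp only [smul_smul, ← op_mul]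
    rw [mul_assoc (↑V⁻¹ : A), ← E.mul_zpow, zpow_add, Units.val_mul]
    simp only [mul_assoc]

/-- The roles are exchanged: the translates of `c n₀ c'` generate independent free right `D`-modules
of rank one, and each lies in the sum of the translates of `M` over a window of fixed width. -/
theorem le_length_right (F : BimodExt E M N) {n₀ : N} (hn₀ : IsBiGen A n₀) {n : ℕ}
    (hn : Module.length Dᵐᵒᵖ M ≤ n) : Module.length Dᵐᵒᵖ Dᵐᵒᵖ ≤ n := by
  let _ : Module Dᵐᵒᵖ N := Module.compHom N (AlgHom.op E.ι).toRingHom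
  have hsmul : ∀ (d : Dᵐᵒᵖ) (y : N), d • y = op (E.ι d.unop) • y := fun _ _ ↦ rfl
  obtain ⟨c, hc, c', hc', f, hf⟩ := F.exists_sum n₀
  obtain ⟨w, hw⟩ := Finsupp.exists_bound f
  refine Module.length_le_of_growth (N := N) (F := fun _ ↦ Dᵐᵒᵖ) (M := M)
    (fun a ↦ LinearMap.toSpanSingleton Dᵐᵒᵖ N (op ((E.t ^ a : Aˣ) : A) • c • op c' • n₀))
    (fun a ↦
      { toFun := fun x ↦ ((E.t ^ a : Aˣ) : A) • F.j x
        map_add' := fun x y ↦ by rw [map_add, smul_add]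
        map_smul' := fun d x ↦ by
          rw [← op_unop d, j_op_smul, smul_comm, RingHom.id_apply, hsmul, unop_op] })
    (fun _ ↦ le_rfl) hn ?_ w ?_
  · intro s x hx a ha
    classical
    have h1 : c • op (c' * E.lin (∑ a ∈ s, Finsupp.single a ((E.α ^ a) (x a).unop))) • n₀ = 0 := by
      rw [← hx, map_sum, Finset.mul_sum, Finset.op_sum, Finset.sum_smul, Finset.smul_sum]
      refine Finset.sum_congr rfl fun a _ ↦ ?_
      rw [LinearMap.toSpanSingleton_apply, hsmul, SkewExt.lin_single, ← E.zpow_mul, op_mul,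
        op_mul, mul_smul, mul_smul, smul_comm c, smul_comm c]
    rw [(E.isUnit c hc).smul_eq_zero] at h1
    have h2 := hn₀.2.1 (h1.trans (by simp) :
      (fun a : A ↦ op a • n₀) _ = (fun a : A ↦ op a • n₀) 0)
    rw [(E.isUnit c' hc').mul_right_eq_zero] at h2
    have h3 := DFunLike.congr_fun (E.lin_injective (h2.trans (map_zero _).symm)) a
    rw [Finsupp.finsetSum_apply, Finset.sum_eq_single a] at h3
    · simpa using h3
    · intro b _ hb
      exact Finsupp.single_eq_of_ne hb.symm
    · exact fun h ↦ absurd ha h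
  · intro a d
    rw [LinearMap.toSpanSingleton_apply, hf]
    refine Submodule.smul_mem _ _ ?_
    rw [Finsupp.sum, Finset.smul_sum]
    refine Submodule.sum_mem _ fun b hb ↦ ?_
    have := hw b hb
    refine Submodule.mem_iSup_of_mem (b + a) (Submodule.mem_iSup_of_mem
      (Finset.mem_Icc.2 (by omega)) ⟨(F.θ a).symm (f b), ?_⟩)
    change ((E.t ^ (b + a) : Aˣ) : A) • F.j _ = _
    rw [← smul_comm, op_zpow_smul_j, smul_smul, zpow_add, Units.val_mul]

/-- The right length of `M` is that of `D`, so `M` is free of rank one on the right. On its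
generator left multiplication is right multiplication through an endomorphism of `D`. That
endomorphism is injective as `D` is simple, and the bound on left lengths gives surjectivity of the
left orbit map. -/
theorem exists_isBiGen (F : BimodExt E M N) [SMulCommClass D Dᵐᵒᵖ M] [IsSimpleRing D] [IsArtinianRing D] {n₀ : N}
    (hn₀ : IsBiGen A n₀) : ∃ m : M, IsBiGen D m := by
  have hℓ : Module.length D D ≠ ⊤ := Module.length_ne_top
  have hℓ' : Module.length Dᵐᵒᵖ Dᵐᵒᵖ ≠ ⊤ := Module.length_ne_top
  obtain ⟨ℓ, hℓ⟩ := ENat.ne_top_iff_exists.1 hℓ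
  obtain ⟨ℓ', hℓ'⟩ := ENat.ne_top_iff_exists.1 hℓ'
  have hL := F.length_left_le hn₀ hℓ.ge
  have hR := F.length_right_le hn₀ hℓ'.ge
  have hR' : Module.length Dᵐᵒᵖ M = Module.length Dᵐᵒᵖ Dᵐᵒᵖ := by
    refine le_antisymm (hR.trans hℓ'.le) ?_
    obtain ⟨r, hr⟩ := ENat.ne_top_iff_exists.1 (hR.trans_lt (ENat.natCast_lt_top ℓ')).ne
    exact (F.le_length_right hn₀ hr.ge).trans hr.le
  obtain ⟨e⟩ := IsSimpleRing.nonempty_linearEquiv_of_length_eq hR'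
  have he : ∀ d, d • e 1 = e d := fun d ↦ by rw [← map_smul, smul_eq_mul, mul_one]
  have hbij : Function.Bijective (fun d : D ↦ op d • e 1) := by
    simp only [he]
    exact e.bijective.comp opEquiv.bijective
  refine ⟨e 1, ?_, hbij⟩
  choose ρ hρ using fun d : D ↦ hbij.2 (d • e 1)
  let ρ' : D →+* D :=
    { toFun := ρ
      map_one' := hbij.1 ((hρ 1).trans (by simp))
      map_zero' := hbij.1 ((hρ 0).trans (by simp))
      map_add' := fun a b ↦ hbij.1 ((hρ _).trans (by
        change _ = op (ρ a + ρ b) • e 1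
        rw [add_smul, op_add, add_smul]
        exact congrArg₂ _ (hρ a).symm (hρ b).symm))
      map_mul' := fun a b ↦ hbij.1 ((hρ _).trans (by
        change _ = op (ρ a * ρ b) • e 1
        rw [mul_smul, op_mul, mul_smul, show op (ρ a) • e 1 = _ from hρ a, ← smul_comm a (op (ρ b)),
          show op (ρ b) • e 1 = _ from hρ b])) }
  have hinj : Function.Injective (LinearMap.toSpanSingleton D M (e 1)) := by
    intro a b hab
    refine ρ'.injective (hbij.1 ((hρ a).trans (Eq.trans ?_ (hρ b).symm)))
    exact hab
  have hrange : LinearMap.range (LinearMap.toSpanSingleton D M (e 1)) = ⊤ := ?_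
  · exact ⟨hinj, LinearMap.range_eq_top.1 hrange⟩
  by_contra hne
  obtain ⟨_, _⟩ := isFiniteLength_iff_isNoetherian_isArtinian.1
    (Module.length_ne_top_iff.1 (hL.trans_lt (ENat.natCast_lt_top ℓ)).ne)
  -- The orbit is isomorphic to `D` on the left, so a proper orbit would be shorter than the bound
  -- allows.
  have h1 := Submodule.length_lt hne
  rw [← (LinearEquiv.ofInjective _ hinj).length_eq] at h1
  exact absurd (h1.trans_le (hL.trans hℓ.le)) (lt_irrefl _)

end BimodExt

end Descent

/-! ### Bimodule cohomology of extensions -/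

section ExtBimodules

universe v u

open MulOpposite TensorProduct CategoryTheory Abelian

/-- `Ext^i_{Aᵉ}(A, Aᵉ)` as an `A`-bimodule. -/
def ExtBimod (k : Type v) (A : Type u) [Field k] [Ring A] [Algebra k A] (i : ℕ) : Type u :=
  EnvExt k A i

namespace ExtBimod

variable {k : Type v} {A : Type u} [Field k] [Ring A] [Algebra k A] {i : ℕ}

noncomputable instance : AddCommGroup (ExtBimod k A i) := inferInstanceAs (AddCommGroup (EnvExt k A i))

/-- The right action of the enveloping algebra. -/
noncomputable def act (x : ExtBimod k A i) (r : EnvAlg k A) : ExtBimod k A i := extMul x r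

theorem add_act (x y : ExtBimod k A i) (r : EnvAlg k A) : (x + y).act r = x.act r + y.act r :=
  add_extMul _ _ _

theorem zero_act (r : EnvAlg k A) : (0 : ExtBimod k A i).act r = 0 := zero_extMul _

theorem act_add (x : ExtBimod k A i) (r s : EnvAlg k A) : x.act (r + s) = x.act r + x.act s :=
  extMul_add _ _ _

theorem act_zero (x : ExtBimod k A i) : x.act 0 = 0 := by
  have := x.act_add 0 0
  simpa using this

theorem act_one (x : ExtBimod k A i) : x.act 1 = x := extMul_one _

theorem act_mul (x : ExtBimod k A i) (r s : EnvAlg k A) : x.act (r * s) = (x.act r).act s :=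
  extMul_mul _ _ _

noncomputable instance : Module A (ExtBimod k A i) where
  smul a x := x.act (1 ⊗ₜ op a)
  one_smul x := x.act_one
  mul_smul a b x := by
    change x.act _ = (x.act _).act _
    rw [← act_mul, Algebra.TensorProduct.tmul_mul_tmul, one_mul, op_mul]
  smul_zero a := zero_act _
  smul_add a x y := add_act _ _ _
  add_smul a b x := by
    change x.act _ = x.act _ + x.act _
    rw [← act_add, ← tmul_add, MulOpposite.op_add]
  zero_smul x := by
    change x.act _ = _
    rw [op_zero, tmul_zero, act_zero]

noncomputable instance : Module Aᵐᵒᵖ (ExtBimod k A i) where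
  smul a x := x.act (a.unop ⊗ₜ 1)
  one_smul x := x.act_one
  mul_smul a b x := by
    change x.act _ = (x.act _).act _
    rw [← act_mul, Algebra.TensorProduct.tmul_mul_tmul, one_mul, unop_mul]
  smul_zero a := zero_act _
  smul_add a x y := add_act _ _ _
  add_smul a b x := by
    change x.act _ = x.act _ + x.act _
    rw [← act_add, ← add_tmul, MulOpposite.unop_add]
  zero_smul x := by
    change x.act _ = _
    rw [unop_zero, zero_tmul, act_zero]

theorem smul_def (a : A) (x : ExtBimod k A i) : a • x = x.act (1 ⊗ₜ op a) := rfl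

theorem op_smul_def (a : A) (x : ExtBimod k A i) : op a • x = x.act (a ⊗ₜ 1) := rfl

theorem smul_op_smul (a b : A) (x : ExtBimod k A i) : a • op b • x = x.act (b ⊗ₜ op a) := by
  rw [smul_def, op_smul_def, ← act_mul, Algebra.TensorProduct.tmul_mul_tmul, one_mul, mul_one]

instance : SMulCommClass A Aᵐᵒᵖ (ExtBimod k A i) where
  smul_comm a b x := by
    rw [← op_unop b, smul_op_smul, smul_def, op_smul_def, ← act_mul,
      Algebra.TensorProduct.tmul_mul_tmul, one_mul, mul_one]

theorem algebraMap_smul (c : k) (x : ExtBimod k A i) :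
    algebraMap k A c • x = op (algebraMap k A c) • x := by
  rw [smul_def, op_smul_def, Algebra.algebraMap_eq_smul_one, op_smul, tmul_smul, smul_tmul',
    op_one]

end ExtBimod

/-- The generator corresponds to `1 ∈ A^σ`. Conversely `σ` is defined by `m b = σ(b) m`; it is
`k`-linear because the two actions of `k` on `Ext` agree. -/
theorem isRigid_iff (k : Type v) (A : Type u) [Field k] [Ring A] [Algebra k A] :
    IsRigid k A ↔ ∃ n, (∃ m : ExtBimod k A n, IsBiGen A m) ∧
      ∀ i ≠ n, Subsingleton (ExtBimod k A i) := by
  refine exists_congr fun n ↦ ⟨?_, ?_⟩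
  · rintro ⟨σ, ⟨e', he⟩, h⟩
    let e : ExtBimod k A n ≃+ A := e'
    replace he : ∀ (a b : A) (x : ExtBimod k A n), e (a • op b • x) = a * e x * σ b :=
      fun a b x ↦ (congrArg e (x.smul_op_smul a b)).trans (he a b x)
    have h1 : (fun a : A ↦ a • e.symm 1) = fun a ↦ e.symm a := funext fun a ↦ by
      refine e.injective (Eq.trans ?_ ((he a 1 (e.symm 1)).trans ?_))
      · rw [op_one, one_smul]
      · simp
    have h2 : (fun a : A ↦ op a • e.symm 1) = fun a ↦ e.symm (σ a) := funext fun a ↦ by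
      refine e.injective (Eq.trans ?_ ((he 1 a (e.symm 1)).trans ?_))
      · rw [one_smul]
      · simp
    refine ⟨⟨e.symm 1, ?_, ?_⟩, h⟩
    · rw [h1]
      exact e.symm.bijective
    · rw [h2]
      exact e.symm.bijective.comp σ.bijective
  · rintro ⟨⟨m, hm⟩, h⟩
    let f : A ≃+ ExtBimod k A n := AddEquiv.ofBijective
      ({ toFun := fun a ↦ a • m
         map_zero' := zero_smul _ _
         map_add' := fun a b ↦ add_smul a b m } : A →+ ExtBimod k A n) hm.1
    let g : A ≃+ ExtBimod k A n := AddEquiv.ofBijective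
      ({ toFun := fun a ↦ op a • m
         map_zero' := zero_smul Aᵐᵒᵖ _
         map_add' := fun a b ↦ add_smul (op a) (op b) m } : A →+ ExtBimod k A n) hm.2
    have hfg : ∀ a, f.symm (g a) • m = op a • m := fun a ↦ f.apply_symm_apply (g a)
    let σ : A ≃ₐ[k] A := AlgEquiv.ofRingEquiv (f := { g.trans f.symm with
        map_mul' := fun a b ↦ hm.1.1 (by
          change f.symm (g (a * b)) • m = (f.symm (g a) * f.symm (g b)) • m
          rw [hfg, mul_smul, hfg b, smul_comm, hfg, op_mul, mul_smul]) })
      fun c ↦ hm.1.1 ((hfg _).trans (ExtBimod.algebraMap_smul c m).symm)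
    refine ⟨σ, ⟨f.symm, fun a b x ↦ ?_⟩, h⟩
    obtain ⟨x, rfl⟩ := f.surjective x
    change f.symm (ExtBimod.act (f x) (b ⊗ₜ op a)) = a * f.symm (f x) * σ b
    rw [f.symm_apply_apply, f.symm_apply_eq]
    change ExtBimod.act (x • m) _ = (a * x * f.symm (g b)) • m
    rw [← ExtBimod.smul_op_smul, mul_smul, hfg, mul_smul, smul_comm x (op b)]

/-- Values are discrete below `⊤`, so a finite supremum is attained; the supremum `⊤` is approached
by elements exceeding any bound below it. -/
theorem sSup_succ (S : Set (WithBot ℕ∞)) : sSup ((· + 1) '' S) = sSup S + 1 := by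
  refine le_antisymm (sSup_le ?_) ?_
  · rintro _ ⟨d, hd, rfl⟩
    exact add_le_add_left (le_sSup hd) 1
  have hb : ∀ d ∈ S, d + 1 ≤ sSup ((· + 1) '' S) := fun d hd ↦ le_sSup ⟨d, hd, rfl⟩
  generalize sSup ((· + 1) '' S) = b at hb
  have key : ∀ p, p < sSup S → ∃ d ∈ S, p < d := fun p hp ↦ lt_sSup_iff.1 hp
  generalize sSup S = s at key
  have hle : ∀ p : WithBot ℕ∞, ∀ d, p < d → p + 1 ≤ d := fun p d h ↦ by
    cases d with
    | bot => exact absurd h not_lt_bot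
    | coe d =>
      cases p with
      | bot => simp
      | coe p => exact_mod_cast Order.add_one_le_of_lt (WithBot.coe_lt_coe.1 h)
  cases s with
  | bot => simp
  | coe s =>
    cases s with
    | top =>
      by_contra! hlt
      obtain ⟨d, hd, h⟩ := key b (hlt.trans_le le_top)
      have h1 := hle _ _ h
      have h2 := hb d hd
      cases b with
      | bot => simp at h2; simp [h2] at h
      | coe b =>
        cases d with
        | bot => exact absurd h not_lt_bot
        | coe d =>
          have h3 : d + 1 ≤ b := by exact_mod_cast h2
          have h4 : b < d := by exact_mod_cast h
          exact absurd (h4.trans_le (le_self_add.trans h3)) (lt_irrefl _)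
    | coe s =>
      cases s with
      | zero =>
        obtain ⟨d, hd, h⟩ := key ⊥ (WithBot.bot_lt_coe _)
        refine le_trans (add_le_add_left ?_ 1) (hb d hd)
        cases d with
        | bot => exact absurd h (lt_irrefl _)
        | coe d => simp
      | succ s =>
        obtain ⟨d, hd, h⟩ := key (s : ℕ∞) (by norm_cast; omega)
        refine le_trans (add_le_add_left ?_ 1) (hb d hd)
        have := hle _ _ h
        push_cast at this ⊢
        exact this

namespace SkewExt

variable {k : Type v} {D A : Type u} [Field k] [Ring D] [Algebra k D] [Ring A] [Algebra k A]
  (E : SkewExt k D A)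

/-- In the bimodule convention `T (0, a) = 1 ⊗ tᵃ` is left multiplication by `tᵃ`, so the cone
computation is exactly the sum of left translates. -/
theorem nonempty_bimodExt (hD : IsDoublyNoetherian k D) (n : ℕ) :
    Nonempty (BimodExt E (ExtBimod k D n) (ExtBimod k A (n + 1))) := by
  obtain ⟨F, hF⟩ := E.exists_coneData hD
  have hι : ∀ r, F.ι r = E.ιEnv r := fun r ↦ by rw [hF]; rfl
  have hT : ∀ g, F.T g = E.TEnv g := fun g ↦ by rw [hF]; rfl
  have hC : F.C = E.CEnv := by rw [hF]; rfl
  let j : ExtBimod k D n →+ ExtBimod k A (n + 1) := F.j n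
  have hj : ∀ x r, j (x.act r) = (j x).act (E.ιEnv r) := fun x r ↦
    (F.j_extMul x r).trans (by rw [hι]; rfl)
  have hsum : ∀ f : ℤ →₀ ExtBimod k D n,
      (f.sum fun a x ↦ extMul (F.j n x) (F.T (0, a))) =
        f.sum fun a x ↦ ((E.t ^ a : Aˣ) : A) • j x := fun f ↦ by
    refine Finsupp.sum_congr fun a _ ↦ ?_
    rw [hT]
    change (j _).act _ = _
    rw [ExtBimod.smul_def, TEnv, zpow_zero, Units.val_one]
  refine ⟨{
    j := j
    φ := F.φ n
    φ_surjective := (F.φ_bijective n).2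
    j_smul := fun d x ↦ ?_
    j_op_smul := fun d x ↦ ?_
    t_smul := fun x ↦ ?_
    exists_sum := fun y ↦ ?_
    eq_zero_of_sum := fun f hf ↦ F.eq_zero_of_sum_eq_zero ((hsum f).trans hf) }⟩
  · rw [ExtBimod.smul_def, ExtBimod.smul_def, hj, ιEnv, Algebra.TensorProduct.map_tmul, map_one]
    rfl
  · rw [ExtBimod.op_smul_def, ExtBimod.op_smul_def, hj, ιEnv, Algebra.TensorProduct.map_tmul,
      map_one]
  · have h1 : (↑E.t⁻¹ : A) • op (E.t : A) • j (F.φ n x) = j x := by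
      rw [ExtBimod.smul_op_smul]
      refine Eq.trans ?_ (F.extMul_j_φ x)
      rw [ConeData.u, hT, TEnv]
      simp only [zpow_one, zpow_neg]
      rfl
    rw [← h1, smul_smul, Units.mul_inv, one_smul]
  · obtain ⟨c, hc, f, hf⟩ := F.exists_extMul_eq_sum y
    rw [hC] at hc
    obtain ⟨c, hc, c', hc', rfl⟩ := hc
    -- The factors trade places: `c ⊗ c'` acts as `c'` on the left and `c` on the right.
    exact ⟨c', hc', c, hc, f, (y.smul_op_smul c' c).trans (hf.trans (hsum f))⟩

theorem subsingleton_ext_zero (E : SkewExt k D A) (hD : IsDoublyNoetherian k D) : Subsingleton (EnvExt k A 0) := by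
  obtain ⟨F, -⟩ := E.exists_coneData hD
  exact ⟨fun x y ↦ (F.ext_zero_eq_zero x).trans (F.ext_zero_eq_zero y).symm⟩

theorem nontrivial_ext_succ_iff (E : SkewExt k D A) (hD : IsDoublyNoetherian k D) (n : ℕ) :
    Nontrivial (EnvExt k A (n + 1)) ↔ Nontrivial (EnvExt k D n) := by
  obtain ⟨F⟩ := E.nonempty_bimodExt hD n
  refine ⟨fun h ↦ ?_, fun (h : Nontrivial (ExtBimod k D n)) ↦
    (F.j_injective.nontrivial : Nontrivial (ExtBimod k A (n + 1)))⟩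
  by_contra hn
  rw [not_nontrivial_iff_subsingleton] at hn
  have hn' : Subsingleton (ExtBimod k D n) := hn
  have h' : Nontrivial (ExtBimod k A (n + 1)) := h
  refine not_subsingleton (ExtBimod k A (n + 1)) ⟨fun x y ↦ ?_⟩
  have key : ∀ x : ExtBimod k A (n + 1), x = 0 := fun x ↦ by
    obtain ⟨c, hc, c', hc', f, hf⟩ := F.exists_sum x
    rw [Subsingleton.elim f 0, Finsupp.sum_zero_index, (E.isUnit c hc).smul_eq_zero,
      (E.isUnit c' hc').op.smul_eq_zero] at hf
    exact hf
  rw [key x, key y]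

theorem fhtr_eq (E : SkewExt k D A) (hD : IsDoublyNoetherian k D) : fhtr k A = fhtr k D + 1 := by
  rw [fhtr, fhtr, ← sSup_succ]
  congr 1
  ext d
  constructor
  · rintro ⟨i, hi, rfl⟩
    cases i with
    | zero => exact absurd (E.subsingleton_ext_zero hD) (not_subsingleton_iff_nontrivial.2 hi)
    | succ i => exact ⟨i, ⟨i, (E.nontrivial_ext_succ_iff hD i).1 hi, rfl⟩, by push_cast; rfl⟩
  · rintro ⟨_, ⟨i, hi, rfl⟩, rfl⟩
    exact ⟨i + 1, (E.nontrivial_ext_succ_iff hD i).2 hi, by push_cast; rfl⟩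

/-- The surviving degree moves by one. A rigid `A` cannot have degree zero, where `Ext` vanishes
while `A` does not. -/
theorem isRigid_iff [IsSimpleRing D] [IsArtinianRing D] (hD : IsDoublyNoetherian k D)
    (hreg : ∀ f, (∀ g, E.lin f * E.lin g = 0 → E.lin g = 0) →
      (∀ g, E.lin g * E.lin f = 0 → E.lin g = 0) → IsUnit (E.lin f)) [Nontrivial A] :
    IsRigid k D ↔ IsRigid k A := by
  have hsub : ∀ i, Subsingleton (ExtBimod k A (i + 1)) ↔ Subsingleton (ExtBimod k D i) := fun i ↦ by
    rw [← not_nontrivial_iff_subsingleton, ← not_nontrivial_iff_subsingleton]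
    exact not_congr (E.nontrivial_ext_succ_iff hD i)
  have h0 : Subsingleton (ExtBimod k A 0) := E.subsingleton_ext_zero hD
  rw [_root_.isRigid_iff, _root_.isRigid_iff]
  constructor
  · rintro ⟨n, ⟨m, hm⟩, h⟩
    obtain ⟨F⟩ := E.nonempty_bimodExt hD n
    refine ⟨n + 1, ⟨_, F.isBiGen_j hm hreg⟩, fun i hi ↦ ?_⟩
    cases i with
    | zero => exact h0
    | succ i => exact (hsub i).2 (h i (by omega))
  · rintro ⟨n, ⟨m, hm⟩, h⟩
    cases n with
    | zero =>
      exact absurd (hm.1.1 (Subsingleton.elim _ _ : (1 : A) • m = (0 : A) • m)) one_ne_zero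
    | succ n =>
      obtain ⟨F⟩ := E.nonempty_bimodExt hD n
      exact ⟨n, F.exists_isBiGen hm, fun i hi ↦ (hsub i).1 (h (i + 1) (by omega))⟩

end SkewExt

end ExtBimodules

/-! ### Skew Laurent polynomials -/

section SkewLaurent

universe v u

open SkewMonoidAlgebra Multiplicative

variable {k : Type v} {D : Type u} [Field k] [Ring D] [Algebra k D] (α : D ≃ₐ[k] D)

/-- The identity, as a map to the ring with the action of the automorphism. -/
def toTwist : D ≃+* Twist α := RingEquiv.refl D

theorem ofAdd_smul_toTwist (a : ℤ) (d : D) : ofAdd a • toTwist α d = toTwist α ((α ^ a) d) := rfl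

namespace SkewLaurentRing

/-- The inclusion of the coefficients. -/
noncomputable def incl : D →ₐ[k] SkewLaurentRing α where
  __ := (singleOneRingHom : Twist α →+* SkewLaurentRing α)
  commutes' _ := rfl

theorem incl_apply (d : D) : incl α d = single (1 : Multiplicative ℤ) (toTwist α d) := rfl

/-- The variable. -/
noncomputable def var : (SkewLaurentRing α)ˣ where
  val := single (ofAdd 1) 1
  inv := single (ofAdd (-1)) 1
  val_inv := by rw [single_mul_single, smul_one, one_mul]; rfl
  inv_val := by rw [single_mul_single, smul_one, one_mul]; rfl

theorem var_zpow (a : ℤ) : ((var α ^ a : (SkewLaurentRing α)ˣ) : SkewLaurentRing α) =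
    single (ofAdd a) 1 := by
  induction a using Int.induction_on with
  | zero => rfl
  | succ n ih =>
    rw [zpow_add_one, Units.val_mul, ih, var, single_mul_single, smul_one, one_mul]; rfl
  | pred n ih =>
    rw [zpow_sub_one, Units.val_mul, ih]
    change single (ofAdd (-(n : ℤ))) (1 : Twist α) * single (ofAdd (-1)) 1 = _
    rw [single_mul_single, smul_one, one_mul]; rfl

theorem incl_mul_var_zpow (a : ℤ) (d : D) :
    incl α d * (var α ^ a : (SkewLaurentRing α)ˣ) = single (ofAdd a) (toTwist α d) := by
  rw [var_zpow, incl_apply, single_mul_single, smul_one, mul_one, one_mul]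

theorem sum_incl_mul_var (f : ℤ →₀ D) :
    (f.sum fun a d ↦ incl α d * (var α ^ a : (SkewLaurentRing α)ˣ)) =
      (⟨(show Multiplicative ℤ →₀ Twist α from f)⟩ : SkewLaurentRing α) := by
  simp only [incl_mul_var_zpow]
  exact sum_single (⟨(show Multiplicative ℤ →₀ Twist α from f)⟩ : SkewLaurentRing α)

/-- Skew Laurent polynomials, without denominators. -/
noncomputable def skewExt : SkewExt k D (SkewLaurentRing α) where
  ι := incl α
  α := α
  t := var α
  C := ⊥
  t_mul d := by
    rw [incl_apply, incl_apply]
    change single (ofAdd 1) (1 : Twist α) * _ = _ * single (ofAdd 1) (1 : Twist α)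
    rw [single_mul_single, single_mul_single, smul_one, ofAdd_smul_toTwist, zpow_one]
    simp only [one_mul, mul_one]
  indep f hf := by
    rw [sum_incl_mul_var] at hf
    exact congrArg coeff hf
  isUnit c hc := by
    rw [Submonoid.mem_bot.1 hc]
    exact isUnit_one
  monic c hc := by
    refine ⟨Finsupp.single 0 1, 0, ?_, by simp, fun a ha ↦ ?_⟩
    · rw [Submonoid.mem_bot.1 hc, Finsupp.sum_single_index (by simp)]
      simp
    · by_contra h
      exact ha (Finsupp.single_eq_of_ne (by omega))
  den_left x := ⟨1, one_mem _, x.coeff, (sum_incl_mul_var α x.coeff).trans (one_mul x).symm⟩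
  den_right x := ⟨1, one_mem _, x.coeff, (sum_incl_mul_var α x.coeff).trans (mul_one x).symm⟩

end SkewLaurentRing

end SkewLaurent

/-! ### Monic multipliers -/

section MonicMultiplier

universe u w

variable {R : Type u} {M : Type w} [Ring R] [AddCommGroup M] [Module R M]

/-- The span of the first `m` vectors of a sequence. -/
def initialSpan (R : Type u) {M : Type w} [Ring R] [AddCommGroup M] [Module R M] (e : ℕ → M)
    (m : ℕ) : Submodule R M :=
  Submodule.span R (Set.range fun i : Fin m ↦ e i)

theorem mem_initialSpan (e : ℕ → M) {i m : ℕ} (h : i < m) : e i ∈ initialSpan R e m :=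
  Submodule.subset_span ⟨⟨i, h⟩, rfl⟩

theorem initialSpan_mono (e : ℕ → M) {m n : ℕ} (h : m ≤ n) :
    initialSpan R e m ≤ initialSpan R e n :=
  Submodule.span_le.2 (by rintro _ ⟨i, rfl⟩; exact mem_initialSpan e (i.2.trans_le h))

theorem length_initialSpan {e : ℕ → M} (he : LinearIndependent R e) (m : ℕ) :
    Module.length R (initialSpan R e m) = m * Module.length R R := by
  have h := he.comp (fun i : Fin m ↦ (i : ℕ)) Fin.val_injective
  rw [show initialSpan R e m = Submodule.span R (Set.range (e ∘ fun i : Fin m ↦ (i : ℕ))) from rfl,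
    (Module.Basis.span h).equivFun.length_eq]
  simp [Module.length_pi_of_fintype]

/-- A filtered map `φ` of free modules of countable rank, which is injective, has a cokernel of
finite length; so some monic vector is mapped into the image of `φ` by any filtered map `ψ`. -/
theorem exists_sub_mem_range [IsArtinianRing R] {e : ℕ → M} (he : LinearIndependent R e) {φ ψ : M →ₗ[R] M} {d d' : ℕ}
    (hφ : Function.Injective φ) (hφd : ∀ m, ∀ x ∈ initialSpan R e m, φ x ∈ initialSpan R e (m + d))
    (hψd : ∀ m, ∀ x ∈ initialSpan R e m, ψ x ∈ initialSpan R e (m + d')) :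
    ∃ m, ∃ c ∈ initialSpan R e m, ψ (e m - c) ∈ LinearMap.range φ := by
  let N := LinearMap.range φ
  let ℓ := Module.length R R
  have hℓ : ℓ ≠ ⊤ := Module.length_ne_top
  let K : ℕ → Submodule R (M ⧸ N) := fun m ↦ (initialSpan R e m).map N.mkQ
  -- Inside a free module of rank `m + d` the image of `φ` contains a copy of one of rank `m`.
  have hK : ∀ m, Module.length R (K (m + d)) ≤ d * ℓ := by
    intro m
    let γ := N.mkQ.comp (initialSpan R e (m + d)).subtype
    have h1 := SkewOre.length_range_add_ker γ
    have h2 : Module.length R (initialSpan R e m) ≤ Module.length R (LinearMap.ker γ) := by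
      refine Module.length_le_of_injective (LinearMap.codRestrict (LinearMap.ker γ)
        ((φ.comp (initialSpan R e m).subtype).codRestrict _ fun x ↦ hφd m x x.2) fun x ↦ ?_) ?_
      · rw [LinearMap.mem_ker]
        exact (Submodule.Quotient.mk_eq_zero N).2 ⟨x, rfl⟩
      · intro x y h
        exact Subtype.ext (hφ (congrArg (fun z : LinearMap.ker γ ↦ (z.1.1 : M)) h))
    have h3 : LinearMap.range γ = K (m + d) := by
      rw [LinearMap.range_comp, Submodule.range_subtype]
    rw [length_initialSpan he] at h1 h2
    rw [h3] at h1
    have h5 : (m : ℕ∞) * ℓ + Module.length R (K (m + d)) ≤ (m : ℕ∞) * ℓ + d * ℓ := by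
      calc _ ≤ Module.length R (LinearMap.ker γ) + Module.length R (K (m + d)) := by gcongr
        _ = _ := by rw [← h1]; push_cast; ring
    exact (ENat.add_le_add_iff_left (WithTop.mul_ne_top (ENat.natCast_ne_top m) hℓ)).1 h5
  let K' : ℕ → Submodule R (M ⧸ N) := fun m ↦ (initialSpan R e m).map (N.mkQ.comp ψ)
  have hK'K : ∀ m, K' m ≤ K (m + d' + d) := by
    rintro m _ ⟨x, hx, rfl⟩
    exact ⟨ψ x, initialSpan_mono e (Nat.le_add_right _ _) (hψd m x hx), rfl⟩
  have hK' : ∀ m, Module.length R (K' m) ≤ d * ℓ := fun m ↦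
    (Module.length_le_of_injective (Submodule.inclusion (hK'K m))
      (Submodule.inclusion_injective _)).trans (hK _)
  have hmono : ∀ m, K' m ≤ K' (m + 1) := fun m ↦
    Submodule.map_mono (initialSpan_mono e (Nat.le_succ m))
  have hstab : ∃ m, K' (m + 1) ≤ K' m := by
    by_contra! hcon
    have hlow : ∀ m : ℕ, (m : ℕ∞) ≤ Module.length R (K' m) := by
      intro m
      induction m with
      | zero => simp
      | succ m ih =>
        have hlt : Module.length R (K' m) < Module.length R (K' (m + 1)) := by
          have hx : Module.length R ((K' m).submoduleOf (K' (m + 1))) <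
              Module.length R (K' (m + 1)) := by
            have : IsFiniteLength R (K' (m + 1)) := Module.length_ne_top_iff.1
              (ne_top_of_le_ne_top (WithTop.mul_ne_top (ENat.natCast_ne_top d) hℓ) (hK' _))
            obtain ⟨_, _⟩ := isFiniteLength_iff_isNoetherian_isArtinian.1 this
            apply Submodule.length_lt
            intro h
            exact hcon m (Submodule.submoduleOf_eq_top.1 h)
          rwa [(Submodule.submoduleOfEquivOfLe (hmono m)).length_eq] at hx
        push_cast
        exact (add_le_add_left ih 1).trans (Order.add_one_le_of_lt hlt)
    obtain ⟨b, hb⟩ := ENat.ne_top_iff_exists.1 (WithTop.mul_ne_top (ENat.natCast_ne_top d) hℓ)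
    have h7 : ((b + 1 : ℕ) : ℕ∞) ≤ (b : ℕ∞) :=
      ((hlow (b + 1)).trans (hK' (b + 1))).trans_eq hb.symm
    have h8 := Nat.cast_le.1 h7
    omega
  obtain ⟨m, hm⟩ := hstab
  -- Where the chain pauses, the new vector is congruent to a combination of the earlier ones, and
  -- the difference is monic.
  obtain ⟨c, hc, hce⟩ := hm ⟨e m, mem_initialSpan e (Nat.lt_succ_self m), rfl⟩
  refine ⟨m, c, hc, (Submodule.Quotient.mk_eq_zero N).1 ?_⟩
  rw [map_sub, Submodule.Quotient.mk_sub, sub_eq_zero]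
  exact hce.symm

end MonicMultiplier

/-! ### Monic skew polynomials -/

section SkewPoly

universe v u

open SkewPolynomial Multiplicative

namespace SkewPolyRing

variable {k : Type v} {D : Type u} [Field k] [Ring D] [Algebra k D] {α : D ≃ₐ[k] D}

/-- Monic skew polynomials. -/
def IsMonic (p : SkewPolyRing α) : Prop :=
  ∃ m, p.coeff m = 1 ∧ ∀ i, m < i → p.coeff i = 0

theorem IsMonic.mem_nonZeroDivisors {p : SkewPolyRing α} (h : IsMonic p) :
    p ∈ nonZeroDivisors (SkewPolyRing α) := by
  obtain ⟨m, h1, h2⟩ := h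
  have h3 : ∀ i, m ≤ i → (monomial m 1 - p).coeff i = 0 := by
    intro i hi
    rw [coeff_sub, coeff_monomial]
    split_ifs with h
    · rw [← h, h1, sub_self]
    · rw [h2 i (by omega), sub_zero]
  have h4 := SkewOre.monic_mem (R := Twist α) (powersHom (D ≃ₐ[k] D) α (ofAdd 1)).injective m
    (SkewOre.coeffs m (monomial m 1 - p))
  rwa [SkewOre.trunc_coeffs h3, sub_sub_cancel] at h4

theorem isMonic_one : IsMonic (1 : SkewPolyRing α) :=
  ⟨0, by simp, fun i hi ↦ by rw [coeff_one, if_neg (by omega)]⟩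

theorem isMonic_X : IsMonic (X : SkewPolyRing α) :=
  ⟨1, by simp, fun i hi ↦ coeff_X_of_ne_one (by omega)⟩

theorem IsMonic.mul {p q : SkewPolyRing α} (hp : IsMonic p) (hq : IsMonic q) : IsMonic (p * q) := by
  obtain ⟨m, hm, hm'⟩ := hp
  obtain ⟨n, hn, hn'⟩ := hq
  refine ⟨m + n, ?_, fun i hi ↦ ?_⟩
  · rw [SkewOre.coeff_mul, Finset.sum_eq_single (m, n), hm, hn, smul_one, mul_one]
    · rintro ⟨a, b⟩ hab hne
      rw [Finset.HasAntidiagonal.mem_antidiagonal] at hab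
      dsimp only at hab ⊢
      rcases lt_trichotomy a m with h | h | h
      · rw [hn' b (by omega), smul_zero, mul_zero]
      · exact absurd (by rw [h, show b = n by omega]) hne
      · rw [hm' a h, zero_mul]
    · intro h
      exact absurd (Finset.HasAntidiagonal.mem_antidiagonal.2 (by rfl)) h
  · rw [SkewOre.coeff_mul]
    refine Finset.sum_eq_zero fun p hp ↦ ?_
    rw [Finset.HasAntidiagonal.mem_antidiagonal] at hp
    by_cases h : m < p.1
    · rw [hm' _ h, zero_mul]
    · rw [hn' p.2 (by omega), smul_zero, mul_zero]

theorem isMonic_monomial_sub {m : ℕ} {c : SkewPolyRing α} (hc : ∀ i, m ≤ i → c.coeff i = 0) :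
    IsMonic (monomial m 1 - c) := by
  refine ⟨m, ?_, fun i hi ↦ ?_⟩
  · rw [coeff_sub, coeff_monomial, if_pos rfl, hc m le_rfl, sub_zero]
  · rw [coeff_sub, coeff_monomial, if_neg hi.ne, hc i hi.le, sub_zero]

/-! ### Monic multipliers, for left and right coefficients at once -/

section Basis

variable {S M : Type u} [Ring S] [AddCommGroup M] [Module S M] {θ : M ≃+ SkewPolyRing α} {e : ℕ → M}
  {τ : ℕ → S ≃+ Twist α}

theorem coeff_sum_smul (h : ∀ i s, θ (s • e i) = monomial i (τ i s)) (s : Finset ℕ) (g : ℕ → S)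
    (j : ℕ) : (θ (∑ i ∈ s, g i • e i)).coeff j = if j ∈ s then τ j (g j) else 0 := by
  simp only [map_sum, h, SkewOre.coeff_sum', coeff_monomial]
  rw [Finset.sum_ite_eq']

theorem linearIndependent_of_monomial (h : ∀ i s, θ (s • e i) = monomial i (τ i s)) :
    LinearIndependent S e := by
  refine linearIndependent_iff'.2 fun s g hg i hi ↦ ?_
  have := coeff_sum_smul h s g i
  rw [hg, map_zero, if_pos hi, coeff_zero] at this
  exact (map_eq_zero_iff _ (τ i).injective).1 this.symm

theorem mem_initialSpan_iff (h : ∀ i s, θ (s • e i) = monomial i (τ i s)) {m : ℕ} {x : M} :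
    x ∈ initialSpan S e m ↔ ∀ i, m ≤ i → (θ x).coeff i = 0 := by
  constructor
  · intro hx
    obtain ⟨c, rfl⟩ := (Submodule.mem_span_range_iff_exists_fun S).1 hx
    intro i hi
    simp only [map_sum, h, SkewOre.coeff_sum', coeff_monomial]
    exact Finset.sum_eq_zero fun j _ ↦ if_neg (by omega)
  · intro hx
    have : x = ∑ i ∈ Finset.range m, (τ i).symm ((θ x).coeff i) • e i := by
      refine θ.injective (SkewPolynomial.ext fun j ↦ ?_)
      rw [coeff_sum_smul h, AddEquiv.apply_symm_apply]
      split_ifs with hj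
      · rfl
      · exact hx j (by simpa using hj)
    rw [this]
    exact Submodule.sum_mem _ fun i hi ↦
      Submodule.smul_mem _ _ (mem_initialSpan e (Finset.mem_range.1 hi))

/-- The maps `τ i` let the same count serve both sides: for right coefficients, moving `s` across
`tⁱ` applies `αⁱ`. -/
theorem exists_isMonic_mem_range [IsArtinianRing S] (h : ∀ i s, θ (s • e i) = monomial i (τ i s))
    (h1 : ∀ i, τ i 1 = 1) {φ ψ : M →ₗ[S] M} {d d' : ℕ} (hφ : Function.Injective φ)
    (hφd : ∀ m x, (∀ i, m ≤ i → (θ x).coeff i = 0) → ∀ i, m + d ≤ i → (θ (φ x)).coeff i = 0)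
    (hψd : ∀ m x, (∀ i, m ≤ i → (θ x).coeff i = 0) → ∀ i, m + d' ≤ i → (θ (ψ x)).coeff i = 0) :
    ∃ x y, IsMonic (θ x) ∧ ψ x = φ y := by
  obtain ⟨m, c, hc, y, hy⟩ := exists_sub_mem_range (linearIndependent_of_monomial h) hφ
    (fun m x hx ↦ (mem_initialSpan_iff h).2 (hφd m x ((mem_initialSpan_iff h).1 hx)))
    (fun m x hx ↦ (mem_initialSpan_iff h).2 (hψd m x ((mem_initialSpan_iff h).1 hx)))
  refine ⟨e m - c, y, ?_, hy.symm⟩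
  have h2 : θ (e m) = monomial m 1 := by rw [← one_smul S (e m), h, h1]
  rw [map_sub, h2]
  exact isMonic_monomial_sub ((mem_initialSpan_iff h).1 hc)

end Basis

theorem exists_isMonic_mul_eq [IsArtinianRing D] {f : SkewPolyRing α}
    (hf : f ∈ nonZeroDivisors (SkewPolyRing α)) : ∃ c r, IsMonic c ∧ c = r * f := by
  obtain ⟨d, hd⟩ := SkewOre.exists_bound f
  obtain ⟨c, r, hc, h⟩ := exists_isMonic_mem_range (S := Twist α) (θ := AddEquiv.refl (SkewPolyRing α))
    (e := fun i ↦ monomial i 1) (τ := fun _ ↦ AddEquiv.refl _) (φ := SkewOre.mulR f)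
    (ψ := LinearMap.id) (d := d) (d' := 0)
    (fun i s ↦ by
      change s • monomial i 1 = monomial i s
      rw [smul_monomial, smul_eq_mul, mul_one]) (fun _ ↦ rfl)
    (fun x y h ↦ mul_cancel_right_mem_nonZeroDivisors hf |>.1 h)
    (fun m x hx ↦ SkewOre.mul_bound hx hd) (fun m x hx ↦ hx)
  exact ⟨c, r, hc, h⟩

/-- Skew polynomials as a right module over the coefficients. -/
def RightModule (α : D ≃ₐ[k] D) : Type u := SkewPolyRing α

noncomputable instance : AddCommGroup (RightModule α) := inferInstanceAs (AddCommGroup (SkewPolyRing α))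

noncomputable instance : Module (Twist α)ᵐᵒᵖ (RightModule α) :=
  Module.compHom (SkewPolyRing α) (RingHom.op (CRingHom (R := Twist α)))

/-- Left multiplication, as a map of right modules. -/
noncomputable def mulL (f : SkewPolyRing α) : RightModule α →ₗ[(Twist α)ᵐᵒᵖ] RightModule α where
  toFun := fun p : SkewPolyRing α ↦ f * p
  map_add' _ _ := mul_add f _ _
  map_smul' s _ := (mul_assoc f _ (C s.unop)).symm

/-- This is the right Ore condition with a monic multiplier. The quotient ring is built from left
fractions, so right denominators need this separate argument. -/
theorem exists_mul_isMonic_eq [IsArtinianRing Dᵐᵒᵖ] {f : SkewPolyRing α}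
    (hf : f ∈ nonZeroDivisors (SkewPolyRing α)) (g : SkewPolyRing α) :
    ∃ c r, IsMonic c ∧ g * c = f * r := by
  have : IsArtinianRing (Twist α)ᵐᵒᵖ := inferInstanceAs (IsArtinianRing Dᵐᵒᵖ)
  obtain ⟨d, hd⟩ := SkewOre.exists_bound f
  obtain ⟨d', hd'⟩ := SkewOre.exists_bound g
  exact exists_isMonic_mem_range (S := (Twist α)ᵐᵒᵖ) (M := RightModule α)
    (θ := AddEquiv.refl (SkewPolyRing α))
    (e := fun i ↦ (monomial i (1 : Twist α) : SkewPolyRing α))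
    (τ := fun i ↦ MulOpposite.opAddEquiv.symm.trans ((powersHom (D ≃ₐ[k] D) α (ofAdd i)).toAddEquiv))
    (φ := mulL f) (ψ := mulL g) (d := d) (d' := d')
    (fun i s ↦ by
      change monomial i (1 : Twist α) * monomial 0 s.unop = monomial i _
      rw [monomial_mul_monomial, one_mul, add_zero, φ_iterate_apply]
      rfl) (fun i ↦ map_one (powersHom (D ≃ₐ[k] D) α (ofAdd i)))
    (fun x y h ↦ mul_cancel_left_mem_nonZeroDivisors hf |>.1 h)
    (fun m x hx i hi ↦ SkewOre.mul_bound hd hx i (by omega))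
    (fun m x hx i hi ↦ SkewOre.mul_bound hd' hx i (by omega))

end SkewPolyRing

end SkewPoly

/-! ### Skew rational functions -/

section SkewRat

universe v u

open SkewPolynomial Multiplicative SkewPolyRing

namespace SkewRatRing

variable {k : Type v} {D : Type u} [Field k] [Ring D] [Algebra k D] [IsArtinianRing D]
  (α : D ≃ₐ[k] D)

/-- The inclusion of the skew polynomials. -/
noncomputable def num : SkewPolyRing α →+* SkewRatRing α := OreLocalization.numeratorRingHom

theorem num_injective : Function.Injective (num α) :=
  OreLocalization.numeratorHom_inj fun _ hx ↦ (mem_nonZeroDivisors_iff.1 hx).1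

theorem isUnit_num {p : SkewPolyRing α} (hp : p ∈ nonZeroDivisors (SkewPolyRing α)) :
    IsUnit (num α p) :=
  OreLocalization.numerator_isUnit (⟨p, hp⟩ : nonZeroDivisors (SkewPolyRing α))

theorem exists_num_mul_eq (x : SkewRatRing α) :
    ∃ s ∈ nonZeroDivisors (SkewPolyRing α), ∃ r, num α s * x = num α r := by
  induction x using OreLocalization.ind with
  | c r s => exact ⟨s, s.2, r, OreLocalization.mul_cancel⟩

/-- The inclusion of the coefficients. -/
noncomputable def incl : D →ₐ[k] SkewRatRing α where
  __ := (num α).comp ((CRingHom (R := Twist α)).comp (toTwist α).toRingHom)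
  commutes' _ := rfl

theorem incl_apply (d : D) : incl α d = num α (monomial 0 (toTwist α d)) := rfl

/-- The variable. -/
noncomputable def var : (SkewRatRing α)ˣ := (isUnit_num α isMonic_X.mem_nonZeroDivisors).unit

theorem var_val : (var α : SkewRatRing α) = num α X := rfl

theorem incl_mul_var_zpow (i : ℕ) (d : D) :
    incl α d * (var α ^ (i : ℤ) : (SkewRatRing α)ˣ) = num α (monomial i (toTwist α d)) := by
  rw [zpow_natCast, Units.val_pow_eq_pow_val, var_val, ← map_pow, incl_apply, ← map_mul,
    monomial_mul_X_pow, zero_add]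

/-- Laurent polynomials are quotients of polynomials by powers of the variable. -/
theorem exists_sum_mul_var (f : ℤ →₀ D) : ∃ (N : ℕ) (p : SkewPolyRing α),
    (f.sum fun a d ↦ incl α d * (var α ^ a : (SkewRatRing α)ˣ)) * (var α ^ N : (SkewRatRing α)ˣ) =
      num α p ∧ (p = 0 → f = 0) := by
  -- The sum of the absolute values of the exponents is a crude shift making all of them
  -- nonnegative.
  obtain ⟨N, hN⟩ : ∃ N : ℕ, ∀ a ∈ f.support, 0 ≤ a + N := by
    refine ⟨∑ a ∈ f.support, a.natAbs, fun a ha ↦ ?_⟩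
    have := Finset.single_le_sum (f := fun a : ℤ ↦ a.natAbs) (fun _ _ ↦ Nat.zero_le _) ha
    omega
  refine ⟨N, ∑ a ∈ f.support, monomial (a + N).toNat (toTwist α (f a)), ?_, fun h ↦ ?_⟩
  · rw [Finsupp.sum, Finset.sum_mul, map_sum]
    refine Finset.sum_congr rfl fun a ha ↦ ?_
    rw [← incl_mul_var_zpow, Int.toNat_of_nonneg (hN a ha), zpow_add, Units.val_mul, mul_assoc,
      zpow_natCast]
  · ext b
    by_contra hb
    have hb' : b ∈ f.support := Finsupp.mem_support_iff.2 hb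
    have h0 := congrArg (fun p : SkewPolyRing α ↦ p.coeff (b + N).toNat) h
    simp only [SkewOre.coeff_sum', coeff_monomial, coeff_zero] at h0
    rw [Finset.sum_eq_single b, if_pos rfl] at h0
    · exact hb h0
    · intro a ha hab
      refine if_neg fun hh ↦ hab ?_
      have := hN a ha
      have := hN b hb'
      omega
    · exact fun h ↦ absurd hb' h

theorem exists_sum_eq (p : SkewPolyRing α) : ∃ f : ℤ →₀ D,
    (f.sum fun a d ↦ incl α d * (var α ^ a : (SkewRatRing α)ˣ)) = num α p ∧
      (∀ i : ℕ, f i = p.coeff i) ∧ ∀ a : ℤ, a < 0 → f a = 0 := by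
  let g : ℕ →₀ D := (SkewMonoidAlgebra.coeff p : Multiplicative ℕ →₀ Twist α)
  refine ⟨g.mapDomain (fun i : ℕ ↦ (i : ℤ)), ?_, fun i ↦ Finsupp.mapDomain_apply Nat.cast_injective _ _,
    fun a ha ↦ Finsupp.mapDomain_of_notMem_range _ _ ?_⟩
  · rw [Finsupp.sum_mapDomain_index (by simp) (fun _ _ _ ↦ by rw [map_add, add_mul])]
    simp only [incl_mul_var_zpow]
    exact (map_sum (num α) (fun i ↦ monomial i (toTwist α (g i))) g.support).symm.trans
      (congrArg (num α) (SkewMonoidAlgebra.sum_single p))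
  · rintro ⟨i, rfl⟩
    simp only at ha
    omega

variable [IsArtinianRing Dᵐᵒᵖ]

/-- Skew rational functions, with monic polynomials as denominators. -/
noncomputable def skewExt : SkewExt k D (SkewRatRing α) where
  ι := incl α
  α := α
  t := var α
  C :=
    { carrier := {c | ∃ p, IsMonic p ∧ num α p = c}
      one_mem' := ⟨1, isMonic_one, map_one _⟩
      mul_mem' := by
        rintro _ _ ⟨p, hp, rfl⟩ ⟨q, hq, rfl⟩
        exact ⟨p * q, hp.mul hq, map_mul _ _ _⟩ }
  t_mul d := by
    rw [var_val, incl_apply, incl_apply, ← map_mul, ← map_mul, X_mul_monomial, monomial_mul_X]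
    rfl
  indep f hf := by
    obtain ⟨N, p, h, h0⟩ := exists_sum_mul_var α f
    rw [hf, zero_mul] at h
    exact h0 (num_injective α (h.symm.trans (map_zero _).symm))
  isUnit := by
    rintro _ ⟨p, hp, rfl⟩
    exact isUnit_num α hp.mem_nonZeroDivisors
  monic := by
    rintro _ ⟨p, ⟨m, hm, hm'⟩, rfl⟩
    obtain ⟨f, hf, h, h0⟩ := exists_sum_eq α p
    refine ⟨f, m, hf, (h m).trans hm, fun a ha ↦ ?_⟩
    by_contra! hlt
    lift a to ℕ using by omega
    exact ha ((h a).trans (hm' a (by omega)))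
  den_left x := by
    obtain ⟨s, hs, r, h⟩ := exists_num_mul_eq α x
    obtain ⟨c, r', hc, hcr⟩ := exists_isMonic_mul_eq hs
    obtain ⟨f, hf, -⟩ := exists_sum_eq α (r' * r)
    exact ⟨_, ⟨c, hc, rfl⟩, f, by rw [hf, hcr, map_mul, map_mul, mul_assoc, h]⟩
  den_right x := by
    obtain ⟨s, hs, r, h⟩ := exists_num_mul_eq α x
    obtain ⟨c, r', hc, hcr⟩ := exists_mul_isMonic_eq hs r
    obtain ⟨f, hf, -⟩ := exists_sum_eq α r'
    -- From `s x = r` and `r c = s r'` it follows that `x c = r'`, on cancelling the unit `s`.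
    refine ⟨_, ⟨c, hc, rfl⟩, f, (isUnit_num α hs).mul_right_injective ?_⟩
    dsimp only
    rw [hf, ← mul_assoc, h, ← map_mul, ← map_mul, hcr]

theorem exists_lin_skewExt (p : SkewPolyRing α) : ∃ f, (skewExt α).lin f = num α p :=
  let ⟨f, hf, _⟩ := exists_sum_eq α p
  ⟨f, hf⟩

/-- Laurent polynomials that are not zero divisors among Laurent polynomials are invertible. -/
theorem isUnit_lin {f : ℤ →₀ D}
    (hl : ∀ g, (skewExt α).lin f * (skewExt α).lin g = 0 → (skewExt α).lin g = 0)
    (hr : ∀ g, (skewExt α).lin g * (skewExt α).lin f = 0 → (skewExt α).lin g = 0) :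
    IsUnit ((skewExt α).lin f) := by
  obtain ⟨N, p, h, -⟩ := exists_sum_mul_var α f
  change (skewExt α).lin f * _ = _ at h
  -- The polynomial `p` is `f` times a power of the variable, so it inherits regularity, and regular
  -- polynomials are invertible by construction.
  have hp : p ∈ nonZeroDivisors (SkewPolyRing α) := by
    refine mem_nonZeroDivisors_iff.2 ⟨fun q hq ↦ ?_, fun q hq ↦ ?_⟩
    · obtain ⟨g, hg⟩ := exists_lin_skewExt α (X ^ N * q)
      have h1 : ((var α ^ N : (SkewRatRing α)ˣ) : SkewRatRing α) * num α q = num α (X ^ N * q) := by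
        rw [Units.val_pow_eq_pow_val, var_val, map_mul, map_pow]
      have h2 := hl g (by rw [hg, ← h1, ← mul_assoc, h, ← map_mul, hq, map_zero])
      rw [hg, ← h1, Units.mul_right_eq_zero] at h2
      exact num_injective α (h2.trans (map_zero _).symm)
    · obtain ⟨g, hg⟩ := exists_lin_skewExt α q
      have h2 := hr g (by
        rw [hg, ← Units.mul_left_eq_zero (var α ^ N), mul_assoc, h, ← map_mul, hq, map_zero])
      rw [hg] at h2
      exact num_injective α (h2.trans (map_zero _).symm)
  have := isUnit_num α hp
  rwa [← h, Units.isUnit_mul_units] at this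

end SkewRatRing

end SkewRat

theorem proposition2p6 {k : Type*} {D : Type*} [Field k] [Ring D] [Algebra k D]
    [IsSimpleRing D] [IsArtinianRing D] (hD : IsDoublyNoetherian k D) (α : D ≃ₐ[k] D) :
    fhtr k (SkewLaurentRing α) = fhtr k (SkewRatRing α) ∧
      fhtr k (SkewRatRing α) = fhtr k D + 1 ∧
      (IsRigid k D ↔ IsRigid k (SkewRatRing α)) := by
  have h := (SkewRatRing.skewExt α).fhtr_eq hD
  have : Nontrivial (Twist α) := inferInstanceAs (Nontrivial D)
  have : Nontrivial (SkewRatRing α) := (SkewRatRing.num_injective α).nontrivial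
  exact ⟨((SkewLaurentRing.skewExt α).fhtr_eq hD).trans h.symm, h,
    (SkewRatRing.skewExt α).isRigid_iff hD fun f hl hr ↦ SkewRatRing.isUnit_lin α hl hr⟩
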